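/- Let $(X_{ij})_{(i,j)\in\mathbb{Z}^2}$ be real random variables with $\mathbb{E}X_{ij}=0$ and $\mathbb{E}X_{ij}^2=\sigma_{ij}^2<\infty$, and let $(Y_{ij})_{i,j\ge 1}$ be independent centered (possibly degenerate) real Gaussian variables with $\mathbb{E}Y_{ij}^2=\sigma_{ij}^2$, the whole family $(Y_{ij})$ being independent of $(X_{ij})$; all variables live on one probability space. Order $\mathbb{Z}^2$ lexicographically: $(u,v)\le_{\mathrm{lex}}(i,j)$ if $u<i$, or $u=i$ and $v\le j$. For an integer $a\ge 0$ and $j\le i$ put $B_{ij}^a=\{(u,v)\in\mathbb{Z}^2:\max(|u-i|,|v-j|)\ge a,\ (u,v)\le_{\mathrm{lex}}(i,j)\}$ and $\mathcal{F}_{ij}^a=\sigma\big(X_{uv}:(u,v)\in B_{ij}^a,\ v\le u\big)$. Let $\mathbf{X}_n$ be the symmetric $n\times n$ matrix with entries $X_{ij}$ for $1\le j\le i\le n$ (and $X_{ji}$ for $i<j$), let $\mathbb{X}_n=n^{-1/2}\mathbf{X}_n$, and let $S^{\mathbb{X}_n}(z)=\int (x-z)^{-1}\,d\mathbf{F}^{\mathbb{X}_n}(x)=\frac1n\mathrm{Tr}(\mathbb{X}_n-z\mathbf{I}_n)^{-1}$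 be the Stieltjes transform of its empirical spectral distribution $\mathbf{F}^{\mathbb{X}_n}(t)=\frac1n\#\{k:\lambda_k\le t\}$, where $\lambda_1,\dots,\lambda_n$ are the eigenvalues of $\mathbb{X}_n$. Define $\mathbf{Y}_n$, $\mathbb{Y}_n$ and $S^{\mathbb{Y}_n}$ in the same way from $(Y_{ij})$. Assume that 1. $\mathbb{E}(X_{ij}\mid\mathcal{F}_{ij}^1)=0$ a.s. for all $1\le j\le i$; 2. there are a non-decreasing function $h:[0,\infty)\to[1,\infty)$, with $x^{-1}h(x)$ non-increasing on $(0,\infty)$ and $\sum_{n\ge1}(n\,h(n))^{-1}<\infty$, and a constant $C>0$ such that $\mathbb{E}\big(X_{ij}^2\,h(|X_{ij}|)\big)\le C$ for all $1\le j\le i$; 3. almost surely, $$\lim_{a\to\infty}\limsup_{n\to\infty}\frac1{n^2}\sum_{1\le j\le i\le n}\big|\mathbb{E}(X_{ij}^2-\sigma_{ij}^2\mid\mathcal{F}_{ij}^a)\big|=0.$$ Then, for every $z\in\mathbb{C}$ with $\operatorname{Im}z>0$, $S^{\mathbb{X}_n}(z)-S^{\mathbb{Y}_n}(z)\to0$ almost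 surely as $n\to\infty$. -/

import Mathlib

open MeasureTheory ProbabilityTheory Filter Topology
open scoped NNReal ENNReal

namespace MartingaleMatrix

/-- The index set `B_{ij}^a`: all `(u, v) ∈ ℤ²` at sup-distance at least `a` from `p = (i, j)` which
do not come after `p` in the lexicographic order, i.e. `u < i`, or `u = i` and `v ≤ j`. -/
def pastIndices (a : ℕ) (p : ℤ × ℤ) : Set (ℤ × ℤ) :=
  {q | (a : ℤ) ≤ max |q.1 - p.1| |q.2 - p.2| ∧ toLex q ≤ toLex p}

/-- The sigma-algebra `F_{ij}^a` for `p = (i, j)` with `j ≤ i`, generated by the variables `X_{uv}`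
with `(u, v) ∈ B_{ij}^a` and `v ≤ u` (trivial if there are none). -/
abbrev pastSigma {Ω : Type*} (X : ℤ × ℤ → Ω → ℝ) (a : ℕ) (p : ℤ × ℤ) : MeasurableSpace Ω :=
  ⨆ q ∈ {q : ℤ × ℤ | q ∈ pastIndices a p ∧ q.2 ≤ q.1},
    MeasurableSpace.comap (X q) (inferInstance : MeasurableSpace ℝ)

/-- The symmetric `n × n` matrix with lower triangular entries `x_{ij}`, `1 ≤ j ≤ i ≤ n`. Rows and
columns are numbered from `0` by `Fin n`, so row `i` of the code is row `i + 1`. -/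
def symMatrix (x : ℕ+ × ℕ+ → ℝ) (n : ℕ) : Matrix (Fin n) (Fin n) ℝ :=
  Matrix.of fun i j =>
    if j ≤ i then x (Nat.succPNat i, Nat.succPNat j) else x (Nat.succPNat j, Nat.succPNat i)

/-- The symmetric matrix scaled by `n^{-1/2}`. -/
noncomputable def scaledMatrix (x : ℕ+ × ℕ+ → ℝ) (n : ℕ) : Matrix (Fin n) (Fin n) ℝ :=
  (Real.sqrt n)⁻¹ • symMatrix x n

theorem scaledMatrix_isHermitian (x : ℕ+ × ℕ+ → ℝ) (n : ℕ) : (scaledMatrix x n).IsHermitian := by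
  ext i j
  simp only [scaledMatrix, symMatrix, Matrix.conjTranspose_apply, Matrix.smul_apply,
    Matrix.of_apply, star_trivial]
  congr 1
  rcases lt_trichotomy i j with h | h | h
  · simp [h.le, h.not_ge]
  · simp [h]
  · simp [h.le, h.not_ge]

/-- The empirical spectral distribution of a symmetric matrix: mass `1/n` at each eigenvalue,
counted with multiplicity. Its distribution function is `t ↦ (1/n) #{k | λ_k ≤ t}`. -/
noncomputable def spectralDistribution {n : ℕ} {A : Matrix (Fin n) (Fin n) ℝ}
    (hA : A.IsHermitian) : Measure ℝ :=
  (n : ℝ≥0∞)⁻¹ • ∑ k, Measure.dirac (hA.eigenvalues k)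

/-- The Stieltjes transform `z ↦ ∫ 1 / (x - z) dμ(x)` of a measure on the real line. -/
noncomputable def stieltjesTransform (μ : Measure ℝ) (z : ℂ) : ℂ :=
  ∫ x : ℝ, ((x : ℂ) - z)⁻¹ ∂μ

/-- The Stieltjes transform of the empirical spectral distribution of the scaled matrix. -/
noncomputable def spectralStieltjes (x : ℕ+ × ℕ+ → ℝ) (n : ℕ) (z : ℂ) : ℂ :=
  stieltjesTransform (spectralDistribution (scaledMatrix_isHermitian x n)) z

/-- The Stieltjes transform of the empirical spectral distribution is the normalized trace of the
resolvent. -/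
theorem spectralStieltjes_eq_trace (x : ℕ+ × ℕ+ → ℝ) (n : ℕ) (z : ℂ) (hz : 0 < z.im) :
    spectralStieltjes x n z =
      (1 / (n : ℂ)) * Matrix.trace ((scaledMatrix x n).map (fun t : ℝ => (t : ℂ)) - z • 1)⁻¹ := by
  have hA := scaledMatrix_isHermitian x n
  have hne : ∀ t : ℝ, (t : ℂ) - z ≠ 0 := by
    intro t h0
    have := congrArg Complex.im h0
    simp at this
    exact hz.ne' this
  have hleft : spectralStieltjes x n z = (1 / (n : ℂ)) * ∑ k, ((hA.eigenvalues k : ℂ) - z)⁻¹ := by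
    unfold spectralStieltjes stieltjesTransform spectralDistribution
    rw [integral_smul_measure, integral_finsetSum_measure]
    · simp
    · intro i _
      exact integrable_dirac (by simp)
  rw [hleft]
  congr 1
  set U : Matrix (Fin n) (Fin n) ℝ := hA.eigenvectorUnitary.1 with hU
  have hUU : U * star U = 1 := Unitary.mul_star_self_of_mem hA.eigenvectorUnitary.2
  have hUU' : star U * U = 1 := Unitary.star_mul_self_of_mem hA.eigenvectorUnitary.2
  have hspec : scaledMatrix x n = U * Matrix.diagonal hA.eigenvalues * star U := by
    conv_lhs => rw [hA.spectral_theorem, Unitary.conjStarAlgAut_apply]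
    rfl
  let f : ℝ →+* ℂ := Complex.ofRealHom
  have h1 : U.map f * (star U).map f = 1 := by
    rw [← Matrix.map_mul, hUU, Matrix.map_one f (map_zero f) (map_one f)]
  have h2 : (star U).map f * U.map f = 1 := by
    rw [← Matrix.map_mul, hUU', Matrix.map_one f (map_zero f) (map_one f)]
  have h3 : (scaledMatrix x n).map (fun t : ℝ => (t : ℂ)) - z • 1 =
      U.map f * Matrix.diagonal (fun k => (hA.eigenvalues k : ℂ) - z) * (star U).map f := by
    have e1 : (scaledMatrix x n).map (fun t : ℝ => (t : ℂ)) =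
        U.map f * Matrix.diagonal (fun k => (hA.eigenvalues k : ℂ)) * (star U).map f := by
      have : (scaledMatrix x n).map (fun t : ℝ => (t : ℂ)) = (scaledMatrix x n).map f := rfl
      rw [this]
      conv_lhs => rw [hspec, Matrix.map_mul, Matrix.map_mul, Matrix.diagonal_map (map_zero f)]
      rfl
    have e2 : Matrix.diagonal (fun k => (hA.eigenvalues k : ℂ) - z) =
        Matrix.diagonal (fun k => (hA.eigenvalues k : ℂ)) - z • (1 : Matrix (Fin n) (Fin n) ℂ) := by
      rw [Matrix.smul_one_eq_diagonal, Matrix.diagonal_sub]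
    rw [e1, e2, mul_sub, sub_mul, mul_smul_comm, smul_mul_assoc, mul_one, h1]
  have h4 : ((scaledMatrix x n).map (fun t : ℝ => (t : ℂ)) - z • 1)⁻¹ =
      U.map f * Matrix.diagonal (fun k => ((hA.eigenvalues k : ℂ) - z)⁻¹) * (star U).map f := by
    apply Matrix.inv_eq_right_inv
    rw [h3]
    calc _ = U.map f * Matrix.diagonal (fun k => (hA.eigenvalues k : ℂ) - z) *
          ((star U).map f * U.map f) *
          (Matrix.diagonal (fun k => ((hA.eigenvalues k : ℂ) - z)⁻¹) * (star U).map f) := by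
            simp only [mul_assoc]
      _ = U.map f * (Matrix.diagonal (fun k => (hA.eigenvalues k : ℂ) - z) *
          Matrix.diagonal (fun k => ((hA.eigenvalues k : ℂ) - z)⁻¹)) * (star U).map f := by
            rw [h2]; simp only [mul_assoc, one_mul]
      _ = 1 := by
            rw [Matrix.diagonal_mul_diagonal]
            simp only [mul_inv_cancel₀ (hne _), Matrix.diagonal_one, mul_one, h1]
  rw [h4, Matrix.trace_mul_comm, ← mul_assoc, h2, one_mul, Matrix.trace_diagonal]

end MartingaleMatrix

/-! The proof is a Lindeberg replacement carried out almost surely. The lower triangle is read row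
by row, an order in which strict predecessors are lexicographic predecessors. The Gaussian entries
are exchanged for the entries of `X` one at a time, and each exchange is expanded to second order
about the configuration with a zero at the exchanged place. Changing one entry perturbs the matrix
by rank at most two, so the first and second Taylor coefficients of the Stieltjes transform are
O(n^(-3/2)) and O(n^(-2)), uniformly in the other entries (`triStieltjes_update_sub`, abstracted as
`SmoothAtScale`). `SmoothAtScale.abs_sub_le` leaves two linear sums, two quadratic sums and a
remainder, and each has to vanish almost surely.

Everything is truncated at a level ℓ of order n^(1/16) that is constant on dyadic blocks of n.
Condensing the series of 1/(n h(n)) makes the tail second moments summable over blocks, so averages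
of squared tails vanish almost surely (`ae_tendsto_dyadic_average`). Bounded parts are handled by
fourth moments of martingales, which are summable in n.

The linear sum in `X` is a martingale for the past of `X` enlarged by all of `Y`. The sums in `Y`
are martingales in reverse order, with all of `X` known from the start.

The quadratic sum in `X` (`ae_tendsto_quadratic_X`) is the delicate one, since the conditional
variance is controlled only given a past at distance a. The entries within distance a are removed
from the coefficient; a Lipschitz bound and the tail averages make this free in the limit. The
truncated square is then centered given that remote past. The centered part, grouped by rows, is a
martingale up to a lag of a rows (`ae_tendsto_lagged_martingale`). What remains is at most the
average in the conditional variance hypothesis plus a conditional tail average, so n tends to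
infinity for fixed a, and a is chosen large according to the outcome. -/

namespace MartingaleMatrix

/-! ### Row-major enumeration of the lower triangle -/

/-- The number of entries of a lower triangle with `n` rows. -/
def triSize : ℕ → ℕ
  | 0 => 0
  | n + 1 => triSize n + (n + 1)

theorem triSize_mono : Monotone triSize :=
  monotone_nat_of_le_succ fun n => by simp [triSize]

theorem le_triSize (n : ℕ) : n ≤ triSize n := by
  cases n <;> simp [triSize]

theorem triSize_le_sq (n : ℕ) : triSize n ≤ n ^ 2 := by
  induction n with
  | zero => simp [triSize]
  | succ n ih => simp only [triSize]; nlinarith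

theorem sum_range_triSize {M : Type*} [AddCommMonoid M] (f : ℕ → M) (n : ℕ) :
    ∑ k ∈ Finset.range (triSize n), f k =
      ∑ i ∈ Finset.range n, ∑ j ∈ Finset.range (i + 1), f (triSize i + j) := by
  induction n with
  | zero => simp [triSize]
  | succ n ih => rw [Finset.sum_range_succ, ← ih, triSize, Finset.sum_range_add]

/-- The row of the `k`-th entry of the lower triangle. -/
def triRow (k : ℕ) : ℕ := Nat.findGreatest (fun i => triSize i ≤ k) k

/-- The column of the `k`-th entry of the lower triangle. -/
def triCol (k : ℕ) : ℕ := k - triSize (triRow k)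

theorem triSize_triRow_le (k : ℕ) : triSize (triRow k) ≤ k :=
  Nat.findGreatest_spec (P := fun i => triSize i ≤ k) (Nat.zero_le k) (by simp [triSize])

theorem triSize_triRow_add_triCol (k : ℕ) : triSize (triRow k) + triCol k = k := by
  have := triSize_triRow_le k
  unfold triCol
  omega

theorem lt_triSize_triRow_succ (k : ℕ) : k < triSize (triRow k + 1) := by
  by_contra! hk
  have h1 : triRow k + 1 ≤ k := (le_triSize _).trans hk
  have := Nat.le_findGreatest (P := fun i => triSize i ≤ k) h1 hk
  unfold triRow at this
  omega

theorem triCol_le_triRow (k : ℕ) : triCol k ≤ triRow k := by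
  have h1 := lt_triSize_triRow_succ k
  have h2 := triSize_triRow_add_triCol k
  simp only [triSize] at h1
  omega

theorem triRow_eq {i j : ℕ} (hj : j ≤ i) : triRow (triSize i + j) = i := by
  set k := triSize i + j
  have h1 := triSize_triRow_le k
  have h2 := lt_triSize_triRow_succ k
  rcases lt_trichotomy (triRow k) i with h | h | h
  · have := triSize_mono (show triRow k + 1 ≤ i from h)
    omega
  · exact h
  · have := triSize_mono (show i + 1 ≤ triRow k from h)
    simp only [triSize] at this
    omega

theorem triCol_eq {i j : ℕ} (hj : j ≤ i) : triCol (triSize i + j) = j := by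
  unfold triCol
  rw [triRow_eq hj]
  omega

theorem triRow_mono : Monotone triRow := by
  intro k l hkl
  by_contra! h
  have h1 := triSize_mono (show triRow l + 1 ≤ triRow k from h)
  have h2 := lt_triSize_triRow_succ l
  have h3 := triSize_triRow_le k
  omega

theorem triRow_lt_iff {k n : ℕ} : triRow k < n ↔ k < triSize n := by
  constructor
  · intro h
    exact (lt_triSize_triRow_succ k).trans_le (triSize_mono h)
  · intro h
    by_contra! h'
    exact absurd ((triSize_mono h').trans (triSize_triRow_le k)) (by omega)

theorem triIndex_lex {q k : ℕ} (h : q < k) :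
    triRow q < triRow k ∨ triRow q = triRow k ∧ triCol q < triCol k := by
  rcases (triRow_mono h.le).lt_or_eq with h1 | h1
  · exact Or.inl h1
  · refine Or.inr ⟨h1, ?_⟩
    have h2 := triSize_triRow_add_triCol q
    have h3 := triSize_triRow_add_triCol k
    rw [h1] at h2
    omega

/-! ### The resolvent of a symmetric matrix -/

section Resolvent

open scoped Matrix.Norms.L2Operator

variable {n : ℕ}

/-- The resolvent `(A - z)⁻¹`. -/
noncomputable def resolvent (z : ℂ) (A : Matrix (Fin n) (Fin n) ℂ) : Matrix (Fin n) (Fin n) ℂ :=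
  (A - z • 1)⁻¹

theorem isUnit_sub_smul_one {A : Matrix (Fin n) (Fin n) ℂ} (hA : IsSelfAdjoint A) {z : ℂ}
    (hz : 0 < z.im) : IsUnit (A - z • 1) := by
  by_contra h
  have hmem : z ∈ spectrum ℂ A := by
    rw [spectrum.mem_iff, Algebra.algebraMap_eq_smul_one, IsUnit.sub_iff]
    exact h
  exact hz.ne' (hA.im_eq_zero_of_mem_spectrum hmem)

theorem resolvent_mul {A : Matrix (Fin n) (Fin n) ℂ} (hA : IsSelfAdjoint A) {z : ℂ}
    (hz : 0 < z.im) : resolvent z A * (A - z • 1) = 1 :=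
  Matrix.nonsing_inv_mul _ ((Matrix.isUnit_iff_isUnit_det _).1 (isUnit_sub_smul_one hA hz))

theorem mul_resolvent {A : Matrix (Fin n) (Fin n) ℂ} (hA : IsSelfAdjoint A) {z : ℂ}
    (hz : 0 < z.im) : (A - z • 1) * resolvent z A = 1 :=
  Matrix.mul_nonsing_inv _ ((Matrix.isUnit_iff_isUnit_det _).1 (isUnit_sub_smul_one hA hz))

theorem resolvent_sub_resolvent {A B : Matrix (Fin n) (Fin n) ℂ} (hA : IsSelfAdjoint A)
    (hB : IsSelfAdjoint B) {z : ℂ} (hz : 0 < z.im) :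
    resolvent z A - resolvent z B = resolvent z A * (B - A) * resolvent z B := by
  have h : B - A = (B - z • 1) - (A - z • 1) := by abel
  rw [h, mul_sub, sub_mul, mul_assoc, mul_resolvent hB hz, resolvent_mul hA hz, mul_one, one_mul]

/-- With G the resolvent, G - G* = (z - conj z) G* G. Taking norms, the C*-identity turns this into
2 Im z ‖G‖² ≤ 2‖G‖. -/
theorem norm_resolvent_le {A : Matrix (Fin n) (Fin n) ℂ} (hA : IsSelfAdjoint A) {z : ℂ}
    (hz : 0 < z.im) : ‖resolvent z A‖ ≤ z.im⁻¹ := by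
  set G := resolvent z A
  have h1 : (A - z • 1) * G = 1 := mul_resolvent hA hz
  have h2 : star G * (A - star z • 1) = 1 := by
    have := congrArg star h1
    rwa [star_mul, star_sub, star_smul, star_one, hA.star_eq] at this
  have h3 : G - star G = (z - star z) • (star G * G) := by
    calc G - star G = star G * (A - star z • 1) * G - star G * ((A - z • 1) * G) := by
          rw [h1, h2, one_mul, mul_one]
      _ = star G * ((A - star z • 1) - (A - z • 1)) * G := by noncomm_ring
      _ = star G * ((z - star z) • 1) * G := by
          congr 2
          rw [sub_smul]
          abel
      _ = _ := by rw [mul_smul_comm, mul_one, smul_mul_assoc]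
  have h4 : ‖z - star z‖ = 2 * z.im := by
    have : z - star z = ((2 * z.im : ℝ) : ℂ) * Complex.I := by
      apply Complex.ext <;> simp
      ring
    rw [this, norm_mul, Complex.norm_I, mul_one, Complex.norm_real, Real.norm_eq_abs,
      abs_of_pos (by positivity)]
  have h5 : 2 * z.im * (‖G‖ * ‖G‖) ≤ 2 * ‖G‖ := by
    calc 2 * z.im * (‖G‖ * ‖G‖) = ‖G - star G‖ := by
          rw [h3, norm_smul, CStarRing.norm_star_mul_self, h4]
      _ ≤ ‖G‖ + ‖star G‖ := norm_sub_le _ _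
      _ = 2 * ‖G‖ := by rw [norm_star]; ring
  rcases (norm_nonneg G).eq_or_lt with h0 | h0
  · rw [← h0]; positivity
  · rw [← one_div, le_div_iff₀ hz]
    nlinarith

theorem norm_single_le (i j : Fin n) : ‖(Matrix.single i j 1 : Matrix (Fin n) (Fin n) ℂ)‖ ≤ 1 := by
  have h : star (Matrix.single i j 1 : Matrix (Fin n) (Fin n) ℂ) * Matrix.single i j 1 =
      Matrix.diagonal (Pi.single j 1) := by
    rw [Matrix.star_eq_conjTranspose, Matrix.conjTranspose_single, Matrix.single_mul_single_same,
      Matrix.diagonal_single]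
    simp
  have h2 : ‖(Matrix.single i j 1 : Matrix (Fin n) (Fin n) ℂ)‖ *
      ‖(Matrix.single i j 1 : Matrix (Fin n) (Fin n) ℂ)‖ = 1 := by
    rw [← CStarRing.norm_star_mul_self, h, Matrix.l2_opNorm_diagonal, Pi.norm_single, norm_one]
  nlinarith

/-- The trace is a single entry of `M`, so the operator norm bounds it without a factor n. All the
scales in n used later rest on this. -/
theorem norm_trace_mul_single_le (M : Matrix (Fin n) (Fin n) ℂ) (i j : Fin n) :
    ‖(M * Matrix.single i j 1).trace‖ ≤ ‖M‖ := by
  have h1 : (M * Matrix.single i j 1).trace = M j i := by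
    rw [Matrix.trace_mul_single]; simp
  have h3 : Matrix.single j j 1 * M * Matrix.single i i 1 = M j i • Matrix.single j i 1 := by
    simp
  have h4 : ‖(Matrix.single j i 1 : Matrix (Fin n) (Fin n) ℂ)‖ = 1 := by
    apply le_antisymm (norm_single_le _ _)
    have h : (Matrix.single i j 1 : Matrix (Fin n) (Fin n) ℂ) * Matrix.single j i 1 =
        Matrix.single i i 1 := by simp
    have h5 : ‖(Matrix.single i i 1 : Matrix (Fin n) (Fin n) ℂ)‖ = 1 := by
      rw [← Matrix.diagonal_single, Matrix.l2_opNorm_diagonal, Pi.norm_single, norm_one]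
    have := norm_mul_le (Matrix.single i j 1 : Matrix (Fin n) (Fin n) ℂ) (Matrix.single j i 1)
    rw [h, h5] at this
    nlinarith [norm_single_le i j, norm_nonneg (Matrix.single j i 1 : Matrix (Fin n) (Fin n) ℂ)]
  rw [h1]
  calc ‖M j i‖ = ‖M j i • (Matrix.single j i 1 : Matrix (Fin n) (Fin n) ℂ)‖ := by
        rw [norm_smul, h4, mul_one]
    _ = ‖(Matrix.single j j 1 : Matrix (Fin n) (Fin n) ℂ) * M * Matrix.single i i 1‖ := by rw [h3]
    _ ≤ ‖(Matrix.single j j 1 : Matrix (Fin n) (Fin n) ℂ)‖ * ‖M‖ *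
        ‖(Matrix.single i i 1 : Matrix (Fin n) (Fin n) ℂ)‖ :=
        (norm_mul_le _ _).trans (mul_le_mul_of_nonneg_right (norm_mul_le _ _) (norm_nonneg _))
    _ ≤ 1 * ‖M‖ * 1 := by gcongr <;> exact norm_single_le _ _
    _ = ‖M‖ := by ring

end Resolvent

/-! ### The Stieltjes transform as a function of the lower triangular entries -/

section Configuration

open scoped Matrix.Norms.L2Operator

/-- The scaled symmetric matrix whose lower triangle is filled row by row from the sequence `c`. -/
noncomputable def triMatrix (n : ℕ) (c : ℕ → ℝ) : Matrix (Fin n) (Fin n) ℂ :=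
  Matrix.of fun i j => (((√n)⁻¹ * c (triSize (max i j : Fin n) + (min i j : Fin n)) : ℝ) : ℂ)

/-- The symmetric `0`-`1` matrix supported on the positions of the `k`-th lower triangular entry. -/
def triBump (n k : ℕ) : Matrix (Fin n) (Fin n) ℂ :=
  Matrix.of fun i j => if triSize (max i j : Fin n) + (min i j : Fin n) = k then 1 else 0

theorem isSelfAdjoint_triMatrix (n : ℕ) (c : ℕ → ℝ) : IsSelfAdjoint (triMatrix n c) := by
  rw [IsSelfAdjoint, Matrix.star_eq_conjTranspose]
  ext i j
  simp only [triMatrix, Matrix.conjTranspose_apply, Matrix.of_apply, max_comm j i, min_comm j i]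
  simp [Complex.conj_ofReal]

theorem triMatrix_update (n k : ℕ) (c : ℕ → ℝ) (hc : c k = 0) (x : ℝ) :
    triMatrix n (Function.update c k x) =
      triMatrix n c + (((√n)⁻¹ * x : ℝ) : ℂ) • triBump n k := by
  ext i j
  simp only [triMatrix, triBump, Matrix.of_apply, Matrix.add_apply, Matrix.smul_apply,
    Function.update_apply]
  split_ifs with h
  · rw [h, hc]; simp
  · simp

theorem index_lt_triSize {n : ℕ} (i j : Fin n) :
    triSize (max i j : Fin n) + (min i j : Fin n) < triSize n := by
  rw [← triRow_lt_iff, triRow_eq (by exact_mod_cast min_le_max)]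
  exact Fin.is_lt _

theorem triMatrix_sub (n : ℕ) (c c' : ℕ → ℝ) :
    triMatrix n c' - triMatrix n c =
      ∑ k ∈ Finset.range (triSize n), (((√n)⁻¹ * (c' k - c k) : ℝ) : ℂ) • triBump n k := by
  ext i j
  have h := index_lt_triSize i j
  simp only [triMatrix, triBump, Matrix.of_apply, Matrix.sub_apply, Matrix.sum_apply,
    Matrix.smul_apply, smul_eq_mul, mul_ite, mul_one, mul_zero]
  rw [Finset.sum_ite_eq, if_pos (Finset.mem_range.2 h)]
  push_cast
  ring

theorem triBump_eq {n k : ℕ} (hk : k < triSize n) :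
    ∃ i j : Fin n, triBump n k = Matrix.single i j 1 ∨
      triBump n k = Matrix.single i j 1 + Matrix.single j i 1 := by
  have hi : triRow k < n := triRow_lt_iff.2 hk
  have hj : triCol k < n := (triCol_le_triRow k).trans_lt hi
  have key : ∀ a b : Fin n, triSize (max a b : Fin n) + (min a b : Fin n) = k ↔
      ((max a b : Fin n) : ℕ) = triRow k ∧ ((min a b : Fin n) : ℕ) = triCol k := by
    intro a b
    constructor
    · intro h
      have hle : ((min a b : Fin n) : ℕ) ≤ (max a b : Fin n) := by exact_mod_cast min_le_max
      rw [← h]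
      exact ⟨(triRow_eq hle).symm, (triCol_eq hle).symm⟩
    · rintro ⟨h1, h2⟩
      rw [h1, h2, triSize_triRow_add_triCol]
  have hle := triCol_le_triRow k
  refine ⟨⟨triRow k, hi⟩, ⟨triCol k, hj⟩, ?_⟩
  by_cases hd : triRow k = triCol k
  · left
    ext a b
    simp only [triBump, Matrix.of_apply, key, Matrix.single_apply, Fin.ext_iff]
    congr 1
    simp only [Fin.coe_max, Fin.coe_min, eq_iff_iff]
    omega
  · right
    ext a b
    simp only [triBump, Matrix.of_apply, key, Matrix.add_apply, Matrix.single_apply, Fin.ext_iff]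
    simp only [Fin.coe_max, Fin.coe_min]
    split_ifs <;> first | omega | simp

theorem norm_triBump_le {n k : ℕ} (hk : k < triSize n) : ‖triBump n k‖ ≤ 2 := by
  obtain ⟨i, j, h | h⟩ := triBump_eq hk
  · rw [h]; linarith [norm_single_le i j]
  · rw [h]
    exact (norm_add_le _ _).trans (by linarith [norm_single_le i j, norm_single_le j i])

theorem norm_trace_mul_triBump_le {n k : ℕ} (hk : k < triSize n) (M : Matrix (Fin n) (Fin n) ℂ) :
    ‖(M * triBump n k).trace‖ ≤ 2 * ‖M‖ := by
  have hM := norm_nonneg M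
  obtain ⟨i, j, h | h⟩ := triBump_eq hk
  · rw [h]; linarith [norm_trace_mul_single_le M i j]
  · rw [h, mul_add, Matrix.trace_add]
    exact (norm_add_le _ _).trans
      (by linarith [norm_trace_mul_single_le M i j, norm_trace_mul_single_le M j i])

/-- The resolvent as a function of the lower triangular entries. -/
noncomputable def triResolvent (z : ℂ) (n : ℕ) (c : ℕ → ℝ) : Matrix (Fin n) (Fin n) ℂ :=
  resolvent z (triMatrix n c)

/-- The normalized trace of the resolvent as a function of the lower triangular entries. -/
noncomputable def triStieltjes (z : ℂ) (n : ℕ) (c : ℕ → ℝ) : ℂ :=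
  (1 / (n : ℂ)) * (triResolvent z n c).trace

/-- The first Taylor coefficient of `triStieltjes` in the `k`-th entry. -/
noncomputable def triStieltjes₁ (z : ℂ) (n k : ℕ) (c : ℕ → ℝ) : ℂ :=
  -((((n : ℝ) * √n)⁻¹ : ℝ) : ℂ) *
    (triResolvent z n c * triBump n k * triResolvent z n c).trace

/-- The second Taylor coefficient of `triStieltjes` in the `k`-th entry. -/
noncomputable def triStieltjes₂ (z : ℂ) (n k : ℕ) (c : ℕ → ℝ) : ℂ :=
  ((((n : ℝ) ^ 2)⁻¹ : ℝ) : ℂ) * (triResolvent z n c * triBump n k * triResolvent z n c *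
    triBump n k * triResolvent z n c).trace

variable {z : ℂ} {n k : ℕ} {c c' : ℕ → ℝ}

theorem norm_triResolvent_le (hz : 0 < z.im) (c : ℕ → ℝ) : ‖triResolvent z n c‖ ≤ z.im⁻¹ :=
  norm_resolvent_le (isSelfAdjoint_triMatrix n c) hz

/-- Continuity serves only to make the Taylor coefficients measurable; it comes from the adjugate
formula with a nonvanishing determinant. -/
theorem continuous_triResolvent (hz : 0 < z.im) : Continuous (triResolvent z n) := by
  have hM : Continuous fun c => triMatrix n c - z • (1 : Matrix (Fin n) (Fin n) ℂ) := by
    refine Continuous.sub (continuous_matrix fun i j => ?_) continuous_const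
    simp only [triMatrix, Matrix.of_apply]
    fun_prop
  have hdet : Continuous fun c => (triMatrix n c - z • (1 : Matrix (Fin n) (Fin n) ℂ)).det :=
    hM.matrix_det
  have h : triResolvent z n = fun c => (triMatrix n c - z • (1 : Matrix (Fin n) (Fin n) ℂ)).det⁻¹ •
      (triMatrix n c - z • (1 : Matrix (Fin n) (Fin n) ℂ)).adjugate := by
    funext c
    rw [triResolvent, resolvent, Matrix.inv_def, Ring.inverse_eq_inv']
  rw [h]
  refine (hdet.inv₀ fun c => ?_).smul hM.matrix_adjugate
  exact ((Matrix.isUnit_iff_isUnit_det _).1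
    (isUnit_sub_smul_one (isSelfAdjoint_triMatrix n c) hz)).ne_zero

theorem continuous_triStieltjes₁ (hz : 0 < z.im) : Continuous (triStieltjes₁ z n k) := by
  have h := continuous_triResolvent (n := n) hz
  exact continuous_const.mul ((h.mul continuous_const).mul h).matrix_trace

theorem continuous_triStieltjes₂ (hz : 0 < z.im) : Continuous (triStieltjes₂ z n k) := by
  have h := continuous_triResolvent (n := n) hz
  exact continuous_const.mul
    ((((h.mul continuous_const).mul h).mul continuous_const).mul h).matrix_trace

theorem triStieltjes_congr (h : ∀ q < triSize n, c q = c' q) :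
    triStieltjes z n c = triStieltjes z n c' := by
  have : triMatrix n c = triMatrix n c' := by
    ext i j
    simp only [triMatrix, Matrix.of_apply, h _ (index_lt_triSize i j)]
  simp only [triStieltjes, triResolvent, this]

theorem norm_mul_le_of_le {a b : ℝ} {A B : Matrix (Fin n) (Fin n) ℂ} (hA : ‖A‖ ≤ a)
    (hB : ‖B‖ ≤ b) : ‖A * B‖ ≤ a * b :=
  (norm_mul_le _ _).trans (mul_le_mul hA hB (norm_nonneg _) ((norm_nonneg _).trans hA))

theorem norm_triStieltjes₁_le (hz : 0 < z.im) (hk : k < triSize n) :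
    ‖triStieltjes₁ z n k c‖ ≤ 2 * z.im⁻¹ ^ 2 / (n * √n) := by
  set G := triResolvent z n c with hG
  have hGn : ‖G‖ ≤ z.im⁻¹ := norm_triResolvent_le hz c
  have h : ‖(G * triBump n k * G).trace‖ ≤ 2 * z.im⁻¹ ^ 2 := by
    rw [Matrix.trace_mul_comm, ← mul_assoc]
    refine (norm_trace_mul_triBump_le hk _).trans ?_
    have := norm_mul_le_of_le hGn hGn
    linarith [sq z.im⁻¹]
  rw [triStieltjes₁, norm_mul, norm_neg, Complex.norm_real, Real.norm_eq_abs,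
    abs_of_nonneg (by positivity), div_eq_inv_mul]
  gcongr

theorem norm_triStieltjes₂_le (hz : 0 < z.im) (hk : k < triSize n) :
    ‖triStieltjes₂ z n k c‖ ≤ 4 * z.im⁻¹ ^ 3 / n ^ 2 := by
  set G := triResolvent z n c with hG
  have hGn : ‖G‖ ≤ z.im⁻¹ := norm_triResolvent_le hz c
  have h : ‖(G * triBump n k * G * triBump n k * G).trace‖ ≤ 4 * z.im⁻¹ ^ 3 := by
    rw [Matrix.trace_mul_comm, ← mul_assoc]
    refine (norm_trace_mul_triBump_le hk _).trans ?_
    have := norm_mul_le_of_le hGn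
      (norm_mul_le_of_le (norm_mul_le_of_le hGn (norm_triBump_le hk)) hGn)
    linarith [show z.im⁻¹ * (z.im⁻¹ * 2 * z.im⁻¹) = 2 * z.im⁻¹ ^ 3 by ring]
  rw [triStieltjes₂, norm_mul, Complex.norm_real, Real.norm_eq_abs,
    abs_of_nonneg (by positivity), div_eq_inv_mul]
  gcongr

/-- Two forms of the same remainder: the first will be bounded by x²/n², the second by |x|³/n^(5/2).
The former is affordable for large entries, the latter for truncated ones. -/
theorem triStieltjes_update_sub (hz : 0 < z.im) (hc : c k = 0) (x : ℝ) :
    triStieltjes z n (Function.update c k x) - triStieltjes z n c - x * triStieltjes₁ z n k c -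
      (x : ℂ) ^ 2 * triStieltjes₂ z n k c =
    ((x ^ 2 / (n : ℝ) ^ 2 : ℝ) : ℂ) *
      ((triResolvent z n (Function.update c k x) * triBump n k * triResolvent z n c *
        triBump n k * triResolvent z n c).trace -
      (triResolvent z n c * triBump n k * triResolvent z n c *
        triBump n k * triResolvent z n c).trace) ∧
    triStieltjes z n (Function.update c k x) - triStieltjes z n c - x * triStieltjes₁ z n k c -
      (x : ℂ) ^ 2 * triStieltjes₂ z n k c =
    -((x ^ 3 / ((n : ℝ) ^ 2 * √n) : ℝ) : ℂ) *
      (triResolvent z n (Function.update c k x) * triBump n k * triResolvent z n c *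
        triBump n k * triResolvent z n c * triBump n k * triResolvent z n c).trace := by
  set G := triResolvent z n c with hG
  set H := triResolvent z n (Function.update c k x) with hH
  set E := triBump n k
  set s : ℂ := (((√n)⁻¹ * x : ℝ) : ℂ) with hs
  -- The resolvent identity H = G - s H E G is substituted repeatedly for the leftmost factor; each
  -- substitution gives one more order in s.
  have e0 : H = G - s • (H * E * G) := by
    have h := resolvent_sub_resolvent (isSelfAdjoint_triMatrix n (Function.update c k x))
      (isSelfAdjoint_triMatrix n c) hz
    have h2 : triMatrix n c - triMatrix n (Function.update c k x) = -(s • E) := by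
      rw [triMatrix_update n k c hc x]
      abel
    rw [h2, mul_neg, neg_mul, mul_smul_comm, smul_mul_assoc] at h
    exact (sub_eq_iff_eq_add'.1 h).trans (sub_eq_add_neg _ _).symm
  have e1 : H.trace = G.trace - s * (H * E * G).trace := by
    conv_lhs => rw [e0]
    rw [Matrix.trace_sub, Matrix.trace_smul, smul_eq_mul]
  have e2 : (H * E * G).trace = (G * E * G).trace - s * (H * E * G * E * G).trace := by
    conv_lhs => rw [e0]
    rw [sub_mul, sub_mul, smul_mul_assoc, smul_mul_assoc, Matrix.trace_sub, Matrix.trace_smul,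
      smul_eq_mul]
  have e3 : (H * E * G * E * G).trace =
      (G * E * G * E * G).trace - s * (H * E * G * E * G * E * G).trace := by
    conv_lhs => rw [e0]
    simp only [sub_mul, smul_mul_assoc, Matrix.trace_sub, Matrix.trace_smul, smul_eq_mul]
  have r1 : (1 / (n : ℂ)) * s = x * ((((n : ℝ) * √n)⁻¹ : ℝ) : ℂ) := by
    rw [hs]; push_cast; rw [mul_inv]; ring
  have r2 : (1 / (n : ℂ)) * s ^ 2 = x ^ 2 * ((((n : ℝ) ^ 2)⁻¹ : ℝ) : ℂ) := by
    have h : ((√n)⁻¹ * x) ^ 2 = (n : ℝ)⁻¹ * x ^ 2 := by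
      rw [mul_pow, inv_pow, Real.sq_sqrt n.cast_nonneg]
    rw [hs, ← Complex.ofReal_pow, h]; push_cast; rw [sq (n : ℂ), mul_inv]; ring
  have r3 : (((x ^ 2 / (n : ℝ) ^ 2 : ℝ) : ℂ)) * s = ((x ^ 3 / ((n : ℝ) ^ 2 * √n) : ℝ) : ℂ) := by
    rw [hs, ← Complex.ofReal_mul]
    congr 1
    rw [div_eq_mul_inv, div_eq_mul_inv, mul_inv]; ring
  have main : triStieltjes z n (Function.update c k x) - triStieltjes z n c -
      x * triStieltjes₁ z n k c - (x : ℂ) ^ 2 * triStieltjes₂ z n k c =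
      ((x ^ 2 / (n : ℝ) ^ 2 : ℝ) : ℂ) *
        ((H * E * G * E * G).trace - (G * E * G * E * G).trace) := by
    have r4 : ((x ^ 2 / (n : ℝ) ^ 2 : ℝ) : ℂ) = x ^ 2 * ((((n : ℝ) ^ 2)⁻¹ : ℝ) : ℂ) := by
      rw [div_eq_mul_inv]; push_cast; ring
    simp only [triStieltjes, triStieltjes₁, triStieltjes₂]
    rw [← hG, ← hH, r4]
    linear_combination (1 / (n : ℂ)) * e1 - (1 / (n : ℂ)) * s * e2 -
      ((G * E * G).trace) * r1 + (H * E * G * E * G).trace * r2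
  refine ⟨main, ?_⟩
  rw [main]
  linear_combination ((x ^ 2 / (n : ℝ) ^ 2 : ℝ) : ℂ) * e3 -
    (H * E * G * E * G * E * G).trace * r3

theorem norm_triStieltjes_taylor_sq (hz : 0 < z.im) (hk : k < triSize n) (hc : c k = 0) (x : ℝ) :
    ‖triStieltjes z n (Function.update c k x) - triStieltjes z n c - x * triStieltjes₁ z n k c -
      (x : ℂ) ^ 2 * triStieltjes₂ z n k c‖ ≤ 8 * z.im⁻¹ ^ 3 * (x ^ 2 / n ^ 2) := by
  have hG := norm_triResolvent_le (n := n) hz c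
  have hE := norm_triBump_le hk
  have bound : ∀ d : ℕ → ℝ, ‖(triResolvent z n d * triBump n k * triResolvent z n c *
        triBump n k * triResolvent z n c).trace‖ ≤ 4 * z.im⁻¹ ^ 3 := by
    intro d
    rw [Matrix.trace_mul_comm, ← mul_assoc]
    refine (norm_trace_mul_triBump_le hk _).trans ?_
    have := norm_mul_le_of_le hG
      (norm_mul_le_of_le (norm_mul_le_of_le (norm_triResolvent_le hz d) hE) hG)
    linarith [show z.im⁻¹ * (z.im⁻¹ * 2 * z.im⁻¹) = 2 * z.im⁻¹ ^ 3 by ring]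
  rw [(triStieltjes_update_sub hz hc x).1, norm_mul, Complex.norm_real, Real.norm_eq_abs,
    abs_of_nonneg (by positivity), mul_comm]
  gcongr
  exact (norm_sub_le _ _).trans
    (by linarith [bound c, bound (Function.update c k x)])

theorem norm_triStieltjes_taylor_cube (hz : 0 < z.im) (hk : k < triSize n) (hc : c k = 0) (x : ℝ) :
    ‖triStieltjes z n (Function.update c k x) - triStieltjes z n c - x * triStieltjes₁ z n k c -
      (x : ℂ) ^ 2 * triStieltjes₂ z n k c‖ ≤ 8 * z.im⁻¹ ^ 4 * (|x| ^ 3 / (n ^ 2 * √n)) := by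
  have hG := norm_triResolvent_le (n := n) hz c
  have hE := norm_triBump_le hk
  rw [(triStieltjes_update_sub hz hc x).2, norm_mul, norm_neg, Complex.norm_real, Real.norm_eq_abs,
    abs_div, abs_pow, abs_of_nonneg (a := (n : ℝ) ^ 2 * √n) (by positivity), mul_comm]
  gcongr
  rw [Matrix.trace_mul_comm, ← mul_assoc]
  refine (norm_trace_mul_triBump_le hk _).trans ?_
  have := norm_mul_le_of_le hG (norm_mul_le_of_le (norm_mul_le_of_le (norm_mul_le_of_le
    (norm_mul_le_of_le (norm_triResolvent_le hz (Function.update c k x)) hE) hG) hE) hG)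
  linarith [show z.im⁻¹ * (z.im⁻¹ * 2 * z.im⁻¹ * 2 * z.im⁻¹) = 4 * z.im⁻¹ ^ 4 by ring]

theorem min_one_sum_le {ι : Type*} (s : Finset ι) (t : ι → ℝ) (ht : ∀ i, 0 ≤ t i) :
    min 1 (∑ i ∈ s, t i) ≤ ∑ i ∈ s, min 1 (t i) := by
  classical
  induction s using Finset.induction_on with
  | empty => simp
  | insert a s ha ih =>
    rw [Finset.sum_insert ha, Finset.sum_insert ha]
    have h1 : 0 ≤ ∑ i ∈ s, t i := Finset.sum_nonneg fun i _ => ht i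
    have h2 := ht a
    have : min 1 (t a + ∑ i ∈ s, t i) ≤ min 1 (t a) + min 1 (∑ i ∈ s, t i) := by
      simp only [min_def]; split_ifs <;> linarith
    linarith

/-- The trivial bound 2 / Im z and the resolvent identity combine into a minimum, which is
subadditive over the changed entries. The cap at 1 matters: a large entry then costs a constant
instead of its size. -/
theorem norm_triResolvent_sub_le (hz : 0 < z.im) (c c' : ℕ → ℝ) :
    ‖triResolvent z n c - triResolvent z n c'‖ ≤ 2 * (z.im⁻¹ + z.im⁻¹ ^ 2) *
      ∑ q ∈ Finset.range (triSize n), min 1 (|c q - c' q| / √n) := by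
  set t : ℕ → ℝ := fun q => |c q - c' q| / √n
  have ht : ∀ q, 0 ≤ t q := fun q => by positivity
  have hv : 0 < z.im⁻¹ := by positivity
  have h1 : ‖triResolvent z n c - triResolvent z n c'‖ ≤ 2 * z.im⁻¹ :=
    (norm_sub_le _ _).trans
      (by linarith [norm_triResolvent_le (n := n) hz c, norm_triResolvent_le (n := n) hz c'])
  have hdiff : ‖triMatrix n c' - triMatrix n c‖ ≤ 2 * ∑ q ∈ Finset.range (triSize n), t q := by
    rw [triMatrix_sub, Finset.mul_sum]
    refine norm_sum_le_of_le _ fun q hq => ?_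
    rw [norm_smul, Complex.norm_real, Real.norm_eq_abs, abs_mul, abs_inv,
      abs_of_nonneg (Real.sqrt_nonneg _), abs_sub_comm, mul_comm 2, inv_mul_eq_div]
    exact mul_le_mul_of_nonneg_left (norm_triBump_le (Finset.mem_range.1 hq)) (ht q)
  have h2 : ‖triResolvent z n c - triResolvent z n c'‖ ≤
      2 * z.im⁻¹ ^ 2 * ∑ q ∈ Finset.range (triSize n), t q := by
    have := resolvent_sub_resolvent (isSelfAdjoint_triMatrix n c) (isSelfAdjoint_triMatrix n c') hz
    rw [triResolvent, triResolvent, this]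
    have := norm_mul_le_of_le (norm_mul_le_of_le (norm_triResolvent_le (n := n) hz c) hdiff)
      (norm_triResolvent_le (n := n) hz c')
    refine this.trans (le_of_eq (by ring))
  have h3 : ‖triResolvent z n c - triResolvent z n c'‖ ≤ 2 * (z.im⁻¹ + z.im⁻¹ ^ 2) *
      min 1 (∑ q ∈ Finset.range (triSize n), t q) := by
    have h0 : 0 ≤ ∑ q ∈ Finset.range (triSize n), t q := Finset.sum_nonneg fun q _ => ht q
    rcases min_choice 1 (∑ q ∈ Finset.range (triSize n), t q) with h | h <;> rw [h] <;> nlinarith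
  refine h3.trans ?_
  gcongr
  exact min_one_sum_le _ _ ht

theorem norm_triStieltjes₂_sub_le (hz : 0 < z.im) (hk : k < triSize n) (c c' : ℕ → ℝ) :
    ‖triStieltjes₂ z n k c - triStieltjes₂ z n k c'‖ ≤
      24 * z.im⁻¹ ^ 2 * (z.im⁻¹ + z.im⁻¹ ^ 2) *
        ((∑ q ∈ Finset.range (triSize n), min 1 (|c q - c' q| / √n)) / n ^ 2) := by
  set G := triResolvent z n c with hG
  set H := triResolvent z n c' with hH
  set E := triBump n k with hE
  have hGn : ‖G‖ ≤ z.im⁻¹ := norm_triResolvent_le hz c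
  have hHn : ‖H‖ ≤ z.im⁻¹ := norm_triResolvent_le hz c'
  have hEn : ‖E‖ ≤ 2 := norm_triBump_le hk
  have hD := norm_triResolvent_sub_le (n := n) hz c c'
  rw [← hG, ← hH] at hD
  set d := 2 * (z.im⁻¹ + z.im⁻¹ ^ 2) *
      ∑ q ∈ Finset.range (triSize n), min 1 (|c q - c' q| / √n) with hd
  -- Cyclicity brings the last resolvent to the front, so that every term of the telescoping ends in
  -- a bump and its trace is controlled by an operator norm.
  have e : (G * E * G * E * G).trace - (H * E * H * E * H).trace =
      (((G - H) * G * E * G) * E).trace + ((H * (G - H) * E * G) * E).trace +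
        ((H * H * E * (G - H)) * E).trace := by
    rw [Matrix.trace_mul_comm _ G, Matrix.trace_mul_comm _ H, ← Matrix.trace_sub,
      ← Matrix.trace_add, ← Matrix.trace_add]
    congr 1
    noncomm_ring
  have hb : ‖(G * E * G * E * G).trace - (H * E * H * E * H).trace‖ ≤ 12 * z.im⁻¹ ^ 2 * d := by
    rw [e]
    have b1 := norm_mul_le_of_le (norm_mul_le_of_le (norm_mul_le_of_le hD hGn) hEn) hGn
    have b2 := norm_mul_le_of_le (norm_mul_le_of_le (norm_mul_le_of_le hHn hD) hEn) hGn
    have b3 := norm_mul_le_of_le (norm_mul_le_of_le (norm_mul_le_of_le hHn hHn) hEn) hD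
    have t1 := norm_trace_mul_triBump_le hk ((G - H) * G * E * G)
    have t2 := norm_trace_mul_triBump_le hk (H * (G - H) * E * G)
    have t3 := norm_trace_mul_triBump_le hk (H * H * E * (G - H))
    refine norm_add₃_le.trans ?_
    linarith
  rw [triStieltjes₂, triStieltjes₂, ← hG, ← hH, ← hE, ← mul_sub, norm_mul, Complex.norm_real,
    Real.norm_eq_abs, abs_of_nonneg (by positivity), ← div_eq_inv_mul, mul_div_assoc']
  gcongr
  rw [hd] at hb
  linarith

end Configuration

/-! ### Abstract smoothness at the scale of the Stieltjes transform. -/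

/-- A sequence of real functions `F n` of the entries of an `n × n` symmetric matrix which is smooth
on the scale of the normalized trace of the resolvent; `D₁ n k` and `D₂ n k` are the Taylor
coefficients in the `k`-th entry. -/
structure SmoothAtScale (K : ℝ) (F : ℕ → (ℕ → ℝ) → ℝ) (D₁ D₂ : ℕ → ℕ → (ℕ → ℝ) → ℝ) : Prop where
  nonneg : 0 ≤ K
  congr : ∀ n c c', (∀ q < triSize n, c q = c' q) → F n c = F n c'
  measurable₁ : ∀ n k, Measurable (D₁ n k)
  measurable₂ : ∀ n k, Measurable (D₂ n k)
  bound₁ : ∀ n k c, k < triSize n → |D₁ n k c| ≤ K / (n * √n)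
  bound₂ : ∀ n k c, k < triSize n → |D₂ n k c| ≤ K / n ^ 2
  taylor_sq : ∀ n k c x, k < triSize n → c k = 0 →
    |F n (Function.update c k x) - F n c - x * D₁ n k c - x ^ 2 * D₂ n k c| ≤ K * (x ^ 2 / n ^ 2)
  taylor_cube : ∀ n k c x, k < triSize n → c k = 0 →
    |F n (Function.update c k x) - F n c - x * D₁ n k c - x ^ 2 * D₂ n k c| ≤
      K * (|x| ^ 3 / (n ^ 2 * √n))
  lipschitz₂ : ∀ n k c c', k < triSize n → |D₂ n k c - D₂ n k c'| ≤
    K * ((∑ q ∈ Finset.range (triSize n), min 1 (|c q - c' q| / √n)) / n ^ 2)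

theorem smoothAtScale_triStieltjes {z : ℂ} (hz : 0 < z.im) (φ : ℂ →L[ℝ] ℝ)
    (hφ : ∀ w, |φ w| ≤ ‖w‖) :
    SmoothAtScale (48 * (1 + z.im⁻¹) ^ 4) (fun n c => φ (triStieltjes z n c))
      (fun n k c => φ (triStieltjes₁ z n k c)) (fun n k c => φ (triStieltjes₂ z n k c)) := by
  have hv : 0 < z.im⁻¹ := by positivity
  set v := z.im⁻¹ with hvdef
  have p2 : v ^ 2 ≤ (1 + v) ^ 4 := by nlinarith [sq_nonneg (v ^ 2), pow_pos hv 2, pow_pos hv 3]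
  have p3 : v ^ 3 ≤ (1 + v) ^ 4 := by nlinarith [sq_nonneg (v ^ 2), pow_pos hv 2, pow_pos hv 3]
  have p4 : v ^ 4 ≤ (1 + v) ^ 4 := by nlinarith [sq_nonneg (v ^ 2), pow_pos hv 2, pow_pos hv 3]
  have p0 : 0 ≤ (1 + v) ^ 4 := by positivity
  have hlin : ∀ (n k : ℕ) (c : ℕ → ℝ) (x : ℝ),
      φ (triStieltjes z n (Function.update c k x)) - φ (triStieltjes z n c) -
        x * φ (triStieltjes₁ z n k c) - x ^ 2 * φ (triStieltjes₂ z n k c) =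
      φ (triStieltjes z n (Function.update c k x) - triStieltjes z n c -
        x * triStieltjes₁ z n k c - (x : ℂ) ^ 2 * triStieltjes₂ z n k c) := by
    intro n k c x
    rw [map_sub, map_sub, map_sub, ← Complex.ofReal_pow, ← Complex.real_smul, ← Complex.real_smul,
      map_smul, map_smul, smul_eq_mul, smul_eq_mul]
  refine ⟨by positivity, ?_, ?_, ?_, ?_, ?_, ?_, ?_, ?_⟩
  · intro n c c' h
    simp only [triStieltjes_congr h]
  · intro n k
    exact (φ.continuous.comp (continuous_triStieltjes₁ hz)).measurable
  · intro n k
    exact (φ.continuous.comp (continuous_triStieltjes₂ hz)).measurable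
  · intro n k c hk
    refine (hφ _).trans ((norm_triStieltjes₁_le hz hk).trans ?_)
    gcongr
    linarith
  · intro n k c hk
    refine (hφ _).trans ((norm_triStieltjes₂_le hz hk).trans ?_)
    gcongr
    linarith
  · intro n k c x hk hc
    rw [hlin]
    refine (hφ _).trans ((norm_triStieltjes_taylor_sq hz hk hc x).trans ?_)
    gcongr
    linarith
  · intro n k c x hk hc
    rw [hlin]
    refine (hφ _).trans ((norm_triStieltjes_taylor_cube hz hk hc x).trans ?_)
    gcongr
    linarith
  · intro n k c c' hk
    rw [← map_sub]
    refine (hφ _).trans ((norm_triStieltjes₂_sub_le hz hk c c').trans ?_)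
    have h0 : (0 : ℝ) ≤ (∑ q ∈ Finset.range (triSize n), min 1 (|c q - c' q| / √n)) / n ^ 2 := by
      refine div_nonneg (Finset.sum_nonneg fun q _ => ?_) (by positivity)
      exact le_min zero_le_one (by positivity)
    refine mul_le_mul_of_nonneg_right ?_ h0
    -- The constant 48 is forced here: 24 v² (v + v²) = 24 (v³ + v⁴), and both powers are at most (1
    -- + v)⁴.
    nlinarith

theorem spectralStieltjes_eq_triStieltjes (x : ℕ+ × ℕ+ → ℝ) (n : ℕ) (z : ℂ) (hz : 0 < z.im) :
    spectralStieltjes x n z = triStieltjes z n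
      fun k => x (Nat.succPNat (triRow k), Nat.succPNat (triCol k)) := by
  rw [spectralStieltjes_eq_trace x n z hz, triStieltjes, triResolvent, resolvent]
  congr 4
  ext i j
  simp only [scaledMatrix, symMatrix, triMatrix, Matrix.map_apply, Matrix.smul_apply,
    Matrix.of_apply, smul_eq_mul]
  have hle : ((min i j : Fin n) : ℕ) ≤ (max i j : Fin n) := by exact_mod_cast min_le_max
  rw [triRow_eq hle, triCol_eq hle]
  split_ifs with h
  · rw [max_eq_left h, min_eq_right h]
  · rw [max_eq_right (not_le.1 h).le, min_eq_left (not_le.1 h).le]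

/-! ### Almost sure convergence and conditional expectations -/

/-- By Tonelli the random series of the `V n` has finite mean, hence converges almost surely, and
its terms tend to zero. -/
theorem ae_tendsto_zero_of_summable {Ω : Type*} {m0 : MeasurableSpace Ω} {P : Measure Ω}
    {V : ℕ → Ω → ℝ} {b : ℕ → ℝ} (hV : ∀ n, 0 ≤ᵐ[P] V n) (hVi : ∀ n, Integrable (V n) P)
    (hVb : ∀ n, ∫ ω, V n ω ∂P ≤ b n) (hb : Summable b) :
    ∀ᵐ ω ∂P, Tendsto (fun n => V n ω) atTop (𝓝 0) := by
  have hb0 : ∀ n, 0 ≤ b n := fun n => (integral_nonneg_of_ae (hV n)).trans (hVb n)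
  have h1 : ∫⁻ ω, ∑' n, ENNReal.ofReal (V n ω) ∂P ≠ ∞ := by
    rw [lintegral_tsum fun n => (hVi n).aemeasurable.ennreal_ofReal]
    have h2 : ∀ n, ∫⁻ ω, ENNReal.ofReal (V n ω) ∂P ≤ ENNReal.ofReal (b n) := fun n => by
      rw [← ofReal_integral_eq_lintegral_ofReal (hVi n) (hV n)]
      exact ENNReal.ofReal_le_ofReal (hVb n)
    refine ne_top_of_le_ne_top ?_ (ENNReal.tsum_le_tsum h2)
    rw [← ENNReal.ofReal_tsum_of_nonneg hb0 hb]
    exact ENNReal.ofReal_ne_top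
  have h3 := ae_lt_top' (AEMeasurable.tsum fun n =>
    (hVi n).aemeasurable.ennreal_ofReal) h1
  filter_upwards [h3, ae_all_iff.2 hV] with ω hω hω0
  have h4 := ENNReal.tendsto_atTop_zero_of_tsum_ne_top hω.ne
  have h5 := (ENNReal.tendsto_toReal ENNReal.zero_ne_top).comp h4
  simp only [ENNReal.toReal_zero] at h5
  refine h5.congr fun n => ?_
  exact ENNReal.toReal_ofReal (hω0 n)

theorem ae_tendsto_zero_of_pow {Ω : Type*} {m0 : MeasurableSpace Ω} {P : Measure Ω}
    {V : ℕ → Ω → ℝ} {b : ℕ → ℝ} (p : ℕ) (hp : Even p)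
    (hVi : ∀ n, Integrable (fun ω => V n ω ^ p) P)
    (hVb : ∀ n, ∫ ω, V n ω ^ p ∂P ≤ b n) (hb : Summable b) :
    ∀ᵐ ω ∂P, Tendsto (fun n => V n ω) atTop (𝓝 0) := by
  filter_upwards [ae_tendsto_zero_of_summable (fun n => ae_of_all P fun ω => hp.pow_nonneg (V n ω))
    hVi hVb hb] with ω hω
  rw [Metric.tendsto_atTop] at hω ⊢
  intro ε hε
  obtain ⟨N, hN⟩ := hω (ε ^ p) (by positivity)
  refine ⟨N, fun n hn => ?_⟩
  have := hN n hn
  rw [Real.dist_0_eq_abs, abs_pow] at this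
  rw [Real.dist_0_eq_abs]
  exact lt_of_pow_lt_pow_left₀ p hε.le this

theorem condExp_mul_eq_zero {Ω : Type*} {m0 : MeasurableSpace Ω} {P : Measure Ω}
    {𝒢 : MeasurableSpace Ω} {B ζ : Ω → ℝ}
    (hB : StronglyMeasurable[𝒢] B) (hζ : Integrable ζ P) (hBζ : Integrable (B * ζ) P)
    (h0 : P[ζ | 𝒢] =ᵐ[P] 0) : P[B * ζ | 𝒢] =ᵐ[P] 0 := by
  filter_upwards [condExp_mul_of_stronglyMeasurable_left hB hBζ hζ, h0] with ω h1 h0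
  rw [h1, Pi.mul_apply, h0]
  simp

section CondExp

variable {Ω : Type*} {m0 : MeasurableSpace Ω} {P : Measure Ω} [IsProbabilityMeasure P]

theorem setIntegral_eq_mul_of_indep {mX mY : MeasurableSpace Ω} (hX : mX ≤ m0) (hY : mY ≤ m0)
    (hind : Indep mX mY P) {u : Ω → ℝ} (hu : StronglyMeasurable[mX] u) (hui : Integrable u P)
    {B : Set Ω} (hB : MeasurableSet[mY] B) : ∫ ω in B, u ω ∂P = P.real B * ∫ ω, u ω ∂P := by
  rw [← setIntegral_condExp hY hui hB, setIntegral_congr_ae (g := fun _ => ∫ ω, u ω ∂P) (hY _ hB)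
    ((condExp_indep_eq hX hY hu hind).mono fun ω hω _ => hω), setIntegral_const, smul_eq_mul]

/-- Enlarging the conditioning by independent information does not change the conditional
expectation. -/
theorem condExp_sup_of_indep {mX mY m₁ m₂ : MeasurableSpace Ω} (hX : mX ≤ m0) (hY : mY ≤ m0)
    (h₁ : m₁ ≤ mX) (h₂ : m₂ ≤ mY) (hind : Indep mX mY P) {f : Ω → ℝ}
    (hf : StronglyMeasurable[mX] f) (hfi : Integrable f P) :
    P[f | m₁ ⊔ m₂] =ᵐ[P] P[f | m₁] := by
  have hle : m₁ ⊔ m₂ ≤ m0 := sup_le (h₁.trans hX) (h₂.trans hY)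
  set g := P[f | m₁] with hg
  have hgm : StronglyMeasurable[m₁] g := stronglyMeasurable_condExp
  have hgi : Integrable g P := integrable_condExp
  -- Intersections A ∩ B form a π-system generating the join. On them both set integrals factor as
  -- P(B) times an integral over A, where the defining property of the conditional expectation given
  -- `m₁` applies.
  set S : Set (Set Ω) := {s | ∃ A B, MeasurableSet[m₁] A ∧ MeasurableSet[m₂] B ∧ A ∩ B = s}
  have hS : m₁ ⊔ m₂ = MeasurableSpace.generateFrom S := by
    apply le_antisymm
    · refine sup_le (fun A hA => ?_) (fun B hB => ?_)
      · exact MeasurableSpace.measurableSet_generateFrom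
          ⟨A, Set.univ, hA, MeasurableSet.univ, Set.inter_univ A⟩
      · exact MeasurableSpace.measurableSet_generateFrom
          ⟨Set.univ, B, MeasurableSet.univ, hB, Set.univ_inter B⟩
    · refine MeasurableSpace.generateFrom_le ?_
      rintro s ⟨A, B, hA, hB, rfl⟩
      exact MeasurableSet.inter ((le_sup_left : m₁ ≤ m₁ ⊔ m₂) _ hA)
        ((le_sup_right : m₂ ≤ m₁ ⊔ m₂) _ hB)
  have hpi : IsPiSystem S := by
    rintro s ⟨A, B, hA, hB, rfl⟩ t ⟨A', B', hA', hB', rfl⟩ -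
    exact ⟨A ∩ A', B ∩ B', hA.inter hA', hB.inter hB', Set.inter_inter_inter_comm _ _ _ _⟩
  have hfg : ∀ s, MeasurableSet[m₁ ⊔ m₂] s → ∫ ω in s, g ω ∂P = ∫ ω in s, f ω ∂P := by
    refine MeasurableSpace.induction_on_inter hS hpi ?_ ?_ ?_ ?_
    · simp
    · rintro s ⟨A, B, hA, hB, rfl⟩
      have hA0 : MeasurableSet[m0] A := hX _ (h₁ _ hA)
      have key : ∀ u : Ω → ℝ, StronglyMeasurable[mX] u → Integrable u P →
          ∫ ω in A ∩ B, u ω ∂P = P.real B * ∫ ω in A, u ω ∂P := by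
        intro u hu hui
        rw [Set.inter_comm, ← setIntegral_indicator hA0, setIntegral_eq_mul_of_indep hX hY hind
          (hu.indicator (h₁ _ hA)) (hui.indicator hA0) (h₂ _ hB), integral_indicator hA0]
      rw [key g (hgm.mono h₁) hgi, key f hf hfi, setIntegral_condExp (h₁.trans hX) hfi hA]
    · intro s hs ih
      have hs0 := hle _ hs
      have e1 := integral_add_compl hs0 hgi
      have e2 := integral_add_compl hs0 hfi
      have e3 : ∫ ω, g ω ∂P = ∫ ω, f ω ∂P := integral_condExp (h₁.trans hX)
      linarith
    · intro s hd hs ih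
      rw [integral_iUnion (fun i => hle _ (hs i)) hd hgi.integrableOn,
        integral_iUnion (fun i => hle _ (hs i)) hd hfi.integrableOn]
      exact tsum_congr ih
  exact (ae_eq_condExp_of_forall_setIntegral_eq hle hfi (fun s _ _ => hgi.integrableOn)
    (fun s hs _ => hfg s hs) (hgm.mono le_sup_left).aestronglyMeasurable).symm

theorem integral_mul_eq_zero_of_condExp {𝒢 : MeasurableSpace Ω} (h𝒢 : 𝒢 ≤ m0) {B ζ : Ω → ℝ}
    (hB : StronglyMeasurable[𝒢] B) (hζ : Integrable ζ P) (hBζ : Integrable (B * ζ) P)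
    (h0 : P[ζ | 𝒢] =ᵐ[P] 0) : ∫ ω, B ω * ζ ω ∂P = 0 := by
  have h1 := condExp_mul_of_stronglyMeasurable_left hB hBζ hζ
  calc ∫ ω, B ω * ζ ω ∂P = ∫ ω, (P[B * ζ | 𝒢]) ω ∂P := (integral_condExp h𝒢).symm
    _ = ∫ _, (0 : ℝ) ∂P := by
        refine integral_congr_ae ?_
        filter_upwards [h1, h0] with ω h1 h0
        rw [h1, Pi.mul_apply, h0]
        simp
    _ = 0 := by simp

theorem condExp_sub_condExp_eq_zero {𝒢 : MeasurableSpace Ω} (h𝒢 : 𝒢 ≤ m0) {f : Ω → ℝ}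
    (hf : Integrable f P) : P[f - P[f | 𝒢] | 𝒢] =ᵐ[P] 0 := by
  have h1 := condExp_sub hf (integrable_condExp (f := f) (m := 𝒢) (μ := P)) 𝒢
  rw [condExp_of_stronglyMeasurable h𝒢 stronglyMeasurable_condExp integrable_condExp] at h1
  filter_upwards [h1] with ω h1
  rw [h1]
  simp

/-! ### Moments of martingales -/

theorem integral_sq_sum_martingale {𝒢 : ℕ → MeasurableSpace Ω} (hmono : Monotone 𝒢)
    (hle : ∀ k, 𝒢 k ≤ m0) {ζ : ℕ → Ω → ℝ} (K : ℕ)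
    (hζm : ∀ k < K, StronglyMeasurable[𝒢 (k + 1)] (ζ k)) (hζ2 : ∀ k < K, MemLp (ζ k) 2 P)
    (h0 : ∀ k < K, P[ζ k | 𝒢 k] =ᵐ[P] 0) :
    MemLp (fun ω => ∑ k ∈ Finset.range K, ζ k ω) 2 P ∧
      ∫ ω, (∑ k ∈ Finset.range K, ζ k ω) ^ 2 ∂P =
        ∑ k ∈ Finset.range K, ∫ ω, ζ k ω ^ 2 ∂P := by
  have hM : ∀ K' ≤ K, StronglyMeasurable[𝒢 K'] (fun ω => ∑ k ∈ Finset.range K', ζ k ω) := by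
    intro K' hK'
    refine Finset.stronglyMeasurable_fun_sum _ fun k hk => ?_
    have := Finset.mem_range.1 hk
    exact (hζm k (by omega)).mono (hmono (by omega))
  have hM2 : ∀ K' ≤ K, MemLp (fun ω => ∑ k ∈ Finset.range K', ζ k ω) 2 P := by
    intro K' hK'
    refine memLp_finsetSum _ fun k hk => hζ2 k ?_
    have := Finset.mem_range.1 hk
    omega
  refine ⟨hM2 K le_rfl, ?_⟩
  have main : ∀ K' ≤ K, ∫ ω, (∑ k ∈ Finset.range K', ζ k ω) ^ 2 ∂P =
        ∑ k ∈ Finset.range K', ∫ ω, ζ k ω ^ 2 ∂P := by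
    intro K'
    induction K' with
    | zero => simp
    | succ k ih =>
      intro hk
      have hk' : k < K := hk
      have i1 := (hM2 k hk'.le).integrable_sq
      have i2 := (hζ2 k hk').integrable_sq
      have i3 : Integrable (fun ω => (∑ k ∈ Finset.range k, ζ k ω) * ζ k ω) P :=
        (hM2 k hk'.le).integrable_mul (hζ2 k hk')
      have e0 := integral_mul_eq_zero_of_condExp (hle k) (hM k hk'.le)
        ((hζ2 k hk').integrable one_le_two) i3 (h0 k hk')
      rw [Finset.sum_range_succ, ← ih hk'.le]
      calc ∫ ω, (∑ k ∈ Finset.range (k + 1), ζ k ω) ^ 2 ∂P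
          = ∫ ω, ((∑ k ∈ Finset.range k, ζ k ω) ^ 2 +
              2 * ((∑ k ∈ Finset.range k, ζ k ω) * ζ k ω) + ζ k ω ^ 2) ∂P := by
            congr 1; ext ω; rw [Finset.sum_range_succ]; ring
        _ = _ := by
            have i13 : Integrable (fun ω => (∑ k ∈ Finset.range k, ζ k ω) ^ 2 +
              2 * ((∑ k ∈ Finset.range k, ζ k ω) * ζ k ω)) P := i1.add (i3.const_mul 2)
            rw [integral_add i13 i2, integral_add i1 (i3.const_mul 2),
              integral_const_mul, e0]
            ring
  exact main K le_rfl

theorem integrable_of_ae_abs_le {f : Ω → ℝ} {c : ℝ} (hf : AEStronglyMeasurable f P)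
    (h : ∀ᵐ ω ∂P, |f ω| ≤ c) : Integrable f P :=
  Integrable.of_bound hf c h

/-- For increments bounded by c the fourth moment grows like the square of the number of terms. This
extra decay over second moments makes the bounds summable in n. -/
theorem integral_pow_four_sum_martingale_le {𝒢 : ℕ → MeasurableSpace Ω} (hmono : Monotone 𝒢)
    (hle : ∀ k, 𝒢 k ≤ m0) {ζ : ℕ → Ω → ℝ} (K : ℕ) {c : ℝ}
    (hζm : ∀ k < K, StronglyMeasurable[𝒢 (k + 1)] (ζ k))
    (hζc : ∀ k < K, ∀ᵐ ω ∂P, |ζ k ω| ≤ c)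
    (h0 : ∀ k < K, P[ζ k | 𝒢 k] =ᵐ[P] 0) :
    Integrable (fun ω => (∑ k ∈ Finset.range K, ζ k ω) ^ 4) P ∧
      ∫ ω, (∑ k ∈ Finset.range K, ζ k ω) ^ 4 ∂P ≤ 4 * (K : ℝ) ^ 2 * c ^ 4 := by
  have hM : ∀ K' ≤ K, StronglyMeasurable[𝒢 K'] (fun ω => ∑ k ∈ Finset.range K', ζ k ω) := by
    intro K' hK'
    refine Finset.stronglyMeasurable_fun_sum _ fun k hk => ?_
    have := Finset.mem_range.1 hk
    exact (hζm k (by omega)).mono (hmono (by omega))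
  have hMb : ∀ K' ≤ K, ∀ᵐ ω ∂P, |∑ k ∈ Finset.range K', ζ k ω| ≤ K' * c := by
    intro K' hK'
    have : ∀ᵐ ω ∂P, ∀ k, k < K → |ζ k ω| ≤ c :=
      ae_all_iff.2 fun k => by
        by_cases hk : k < K
        · filter_upwards [hζc k hk] with ω h _ using h
        · exact ae_of_all _ fun ω h => absurd h hk
    filter_upwards [this] with ω hω
    refine (Finset.abs_sum_le_sum_abs _ _).trans ?_
    refine (Finset.sum_le_sum fun k hk => hω k ?_).trans ?_
    · have := Finset.mem_range.1 hk
      omega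
    · simp
  have hint : ∀ (p q : ℕ), ∀ k < K,
      Integrable (fun ω => (∑ k ∈ Finset.range k, ζ k ω) ^ p * ζ k ω ^ q) P := by
    intro p q k hk
    refine integrable_of_ae_abs_le (c := (k * c) ^ p * c ^ q) ?_ ?_
    · exact ((((hM k hk.le).mono (hle _)).pow p).mul
        (((hζm k hk).mono (hle _)).pow q)).aestronglyMeasurable
    · filter_upwards [hMb k hk.le, hζc k hk] with ω h1 h2
      rw [abs_mul, abs_pow, abs_pow]
      gcongr
      exact pow_nonneg ((abs_nonneg _).trans h1) _
  have hint4 : ∀ (p : ℕ), ∀ k ≤ K, Integrable (fun ω => (∑ k ∈ Finset.range k, ζ k ω) ^ p) P := by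
    intro p k hk
    refine integrable_of_ae_abs_le (c := (k * c) ^ p) ?_ ?_
    · exact (((hM k hk).mono (hle _)).pow p).aestronglyMeasurable
    · filter_upwards [hMb k hk] with ω h1
      rw [abs_pow]
      gcongr
  have horth : ∀ (p : ℕ), ∀ k < K, ∫ ω, (∑ k ∈ Finset.range k, ζ k ω) ^ p * ζ k ω ∂P = 0 := by
    intro p k hk
    have i1 := hint p 1 k hk
    have i2 := hint 0 1 k hk
    simp only [pow_one, pow_zero, one_mul] at i1 i2
    exact integral_mul_eq_zero_of_condExp (hle k) ((hM k hk.le).pow p) i2 i1 (h0 k hk)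
  have h2 : ∀ k ≤ K, ∫ ω, (∑ k ∈ Finset.range k, ζ k ω) ^ 2 ∂P ≤ k * c ^ 2 := by
    intro k hk
    have hLp : ∀ j < K, MemLp (ζ j) 2 P := fun j hj =>
      MemLp.of_bound ((hζm j hj).mono (hle _)).aestronglyMeasurable c (hζc j hj)
    rw [(integral_sq_sum_martingale hmono hle k (fun j hj => hζm j (by omega))
      (fun j hj => hLp j (by omega)) (fun j hj => h0 j (by omega))).2]
    calc ∑ j ∈ Finset.range k, ∫ ω, ζ j ω ^ 2 ∂P ≤ ∑ j ∈ Finset.range k, c ^ 2 := by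
          refine Finset.sum_le_sum fun j hj => ?_
          have hj' : j < K := by have := Finset.mem_range.1 hj; omega
          calc ∫ ω, ζ j ω ^ 2 ∂P ≤ ∫ _, c ^ 2 ∂P := by
                refine integral_mono_ae (hLp j hj').integrable_sq (integrable_const _) ?_
                filter_upwards [hζc j hj'] with ω hω
                exact sq_le_sq' (neg_le_of_abs_le hω) (le_of_abs_le hω)
            _ = c ^ 2 := by simp
      _ = k * c ^ 2 := by simp
  refine ⟨hint4 4 K le_rfl, ?_⟩
  have main : ∀ k ≤ K, ∫ ω, (∑ k ∈ Finset.range k, ζ k ω) ^ 4 ∂P ≤ 4 * (k : ℝ) ^ 2 * c ^ 4 := by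
    intro k
    induction k with
    | zero => simp
    | succ k ih =>
      intro hk
      have hk' : k < K := hk
      have i4 := hint4 4 k hk'.le
      have i31 := hint 3 1 k hk'
      simp only [pow_one] at i31
      have i2 := hint4 2 k hk'.le
      have e3 := horth 3 k hk'
      have hk2 := h2 k hk'.le
      calc ∫ ω, (∑ k ∈ Finset.range (k + 1), ζ k ω) ^ 4 ∂P
          ≤ ∫ ω, ((∑ k ∈ Finset.range k, ζ k ω) ^ 4 +
              4 * ((∑ k ∈ Finset.range k, ζ k ω) ^ 3 * ζ k ω) +
              8 * c ^ 2 * (∑ k ∈ Finset.range k, ζ k ω) ^ 2 + 3 * c ^ 4) ∂P := by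
            refine integral_mono_ae (hint4 4 (k + 1) hk)
              (((i4.add (i31.const_mul 4)).add (i2.const_mul _)).add (integrable_const _)) ?_
            filter_upwards [hζc k hk'] with ω hω
            have hs : ζ k ω ^ 2 ≤ c ^ 2 := sq_le_sq' (neg_le_of_abs_le hω) (le_of_abs_le hω)
            simp only [Finset.sum_range_succ]
            set M := ∑ k ∈ Finset.range k, ζ k ω
            set x := ζ k ω
            have a1 : x ^ 4 ≤ c ^ 4 := by nlinarith [sq_nonneg x]
            have a2 : M ^ 2 * x ^ 2 ≤ M ^ 2 * c ^ 2 := mul_le_mul_of_nonneg_left hs (sq_nonneg M)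
            -- In the expansion of (M + x)⁴ the cubic term is absorbed by 4Mx³ ≤ 2M²x² + 2x⁴; the
            -- term 4M³x is kept because it integrates to zero.
            nlinarith [mul_nonneg (sq_nonneg x) (sq_nonneg (M - x))]
        _ = ∫ ω, (∑ k ∈ Finset.range k, ζ k ω) ^ 4 ∂P +
              8 * c ^ 2 * ∫ ω, (∑ k ∈ Finset.range k, ζ k ω) ^ 2 ∂P + 3 * c ^ 4 := by
            have j1 : Integrable (fun ω => (∑ k ∈ Finset.range k, ζ k ω) ^ 4 +
                4 * ((∑ k ∈ Finset.range k, ζ k ω) ^ 3 * ζ k ω)) P := i4.add (i31.const_mul 4)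
            have j2 : Integrable (fun ω => (∑ k ∈ Finset.range k, ζ k ω) ^ 4 +
                4 * ((∑ k ∈ Finset.range k, ζ k ω) ^ 3 * ζ k ω) +
                8 * c ^ 2 * (∑ k ∈ Finset.range k, ζ k ω) ^ 2) P := j1.add (i2.const_mul _)
            rw [integral_add j2 (integrable_const _), integral_add j1 (i2.const_mul _),
              integral_add i4 (i31.const_mul 4), integral_const_mul, e3, integral_const_mul]
            simp
        _ ≤ _ := by
            have := ih hk'.le
            have hc4 : 0 ≤ c ^ 4 := by positivity
            push_cast
            -- The induction closes because 8k + 3 ≤ 4(k + 1)² - 4k².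
            nlinarith [mul_le_mul_of_nonneg_left hk2 (by positivity : (0 : ℝ) ≤ 8 * c ^ 2)]
  exact main K le_rfl

end CondExp

/-! ### Truncation -/

/-- The part of `x` not exceeding the level `ℓ` in absolute value. -/
noncomputable def truncBelow (ℓ x : ℝ) : ℝ := if |x| ≤ ℓ then x else 0

/-- The part of `x` exceeding the level `ℓ` in absolute value. -/
noncomputable def truncAbove (ℓ x : ℝ) : ℝ := if |x| ≤ ℓ then 0 else x

theorem truncBelow_add_truncAbove (ℓ x : ℝ) : truncBelow ℓ x + truncAbove ℓ x = x := by
  unfold truncBelow truncAbove; split_ifs <;> simp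

theorem sq_truncBelow_add_sq_truncAbove (ℓ x : ℝ) :
    truncBelow ℓ x ^ 2 + truncAbove ℓ x ^ 2 = x ^ 2 := by
  unfold truncBelow truncAbove; split_ifs <;> simp

theorem abs_truncBelow_le {ℓ : ℝ} (hℓ : 0 ≤ ℓ) (x : ℝ) : |truncBelow ℓ x| ≤ ℓ := by
  unfold truncBelow; split_ifs <;> simp_all

theorem abs_truncAbove_le (ℓ x : ℝ) : |truncAbove ℓ x| ≤ |x| := by
  unfold truncAbove; split_ifs <;> simp

theorem measurable_truncBelow (ℓ : ℝ) : Measurable (truncBelow ℓ) :=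
  Measurable.ite (measurableSet_le measurable_id.abs measurable_const) measurable_id
    measurable_const

theorem measurable_truncAbove (ℓ : ℝ) : Measurable (truncAbove ℓ) :=
  Measurable.ite (measurableSet_le measurable_id.abs measurable_const) measurable_const
    measurable_id

/-- The truncation level for matrices of dimension between `2 ^ m` and `2 ^ (m + 1)`. -/
noncomputable def truncLevel (m : ℕ) : ℝ := 2 ^ (m / 16)

theorem one_le_truncLevel (m : ℕ) : 1 ≤ truncLevel m := one_le_pow₀ one_le_two

/-- Rounding the exponent down keeps the sixteenth power of the level below 2 ^ `Nat.log 2 n` ≤ n.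
-/
theorem truncLevel_log_pow_le {n : ℕ} (hn : n ≠ 0) : truncLevel (Nat.log 2 n) ^ 8 ≤ √n := by
  refine Real.le_sqrt_of_sq_le ?_
  rw [← pow_mul, truncLevel, ← pow_mul]
  have h1 : Nat.log 2 n / 16 * (8 * 2) ≤ Nat.log 2 n := by omega
  calc (2 : ℝ) ^ (Nat.log 2 n / 16 * (8 * 2)) ≤ 2 ^ Nat.log 2 n :=
        pow_le_pow_right₀ one_le_two h1
    _ ≤ n := by exact_mod_cast Nat.pow_log_le_self 2 hn

theorem truncLevel_log_pow_le' {n p : ℕ} (hn : n ≠ 0) (hp : p ≤ 8) :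
    truncLevel (Nat.log 2 n) ^ p ≤ √n :=
  (pow_le_pow_right₀ (one_le_truncLevel _) hp).trans (truncLevel_log_pow_le hn)

theorem truncLevel_mono : Monotone truncLevel := fun _ _ h =>
  pow_le_pow_right₀ one_le_two (Nat.div_le_div_right h)

theorem tendsto_truncLevel_cube_div_sqrt :
    Tendsto (fun n : ℕ => truncLevel (Nat.log 2 n) ^ 3 / √n) atTop (𝓝 0) := by
  have h1 : ∀ᶠ n : ℕ in atTop, truncLevel (Nat.log 2 n) ^ 3 / √n ≤ √(1 / √n) := by
    filter_upwards [eventually_ge_atTop 1] with n hn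
    have hn' : n ≠ 0 := by omega
    have hs : 0 < √(n : ℝ) := by positivity
    refine Real.le_sqrt_of_sq_le ?_
    rw [div_pow, ← pow_mul, div_le_div_iff₀ (by positivity) hs]
    nlinarith [truncLevel_log_pow_le' hn' (show 3 * 2 ≤ 8 by norm_num)]
  have h2 : Tendsto (fun n : ℕ => √(1 / √(n : ℝ))) atTop (𝓝 0) := by
    have h3 : Tendsto (fun n : ℕ => √(n : ℝ)) atTop atTop :=
      Real.tendsto_sqrt_atTop.comp tendsto_natCast_atTop_atTop
    have := (Real.continuous_sqrt.tendsto 0).comp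
      ((tendsto_const_nhds (x := (1 : ℝ))).div_atTop h3)
    simpa [Function.comp_def] using this
  refine squeeze_zero' (Eventually.of_forall fun n => ?_) h1 h2
  have := one_le_truncLevel (Nat.log 2 n)
  positivity

/-- Division with remainder shows that each term is merely repeated `d` times. -/
theorem summable_comp_div {τ : ℕ → ℝ} (hτ : Summable τ) (d : ℕ) [NeZero d] :
    Summable fun m => τ (m / d) := by
  have h := (Nat.divModEquiv d).summable_iff (f := fun p : ℕ × Fin d => τ p.1)
  have e : (fun p : ℕ × Fin d => τ p.1) ∘ (Nat.divModEquiv d) = fun m => τ (m / d) := by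
    funext m; simp [Nat.divModEquiv]
  rw [← e, h]
  have := (hτ.abs).mul_of_nonneg (g := fun _ : Fin d => (1 : ℝ)) (Summable.of_finite)
    (fun _ => abs_nonneg _) (fun _ => zero_le_one)
  refine Summable.of_norm ?_
  simpa using this

/-- Cauchy condensation: the value at n = 2^m times 2^m is `τ m`. -/
theorem summable_comp_log_div {τ : ℕ → ℝ} (hτ : Summable τ) (h0 : ∀ m, 0 ≤ τ m)
    (hanti : Antitone τ) : Summable fun n : ℕ => τ (Nat.log 2 n) / n := by
  rw [← summable_condensed_iff_of_nonneg (fun n => div_nonneg (h0 _) n.cast_nonneg)]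
  · refine hτ.congr fun m => ?_
    rw [Nat.log_pow Nat.one_lt_two]
    push_cast
    field_simp
  · intro m n hm hmn
    have : (0 : ℝ) < m := by exact_mod_cast hm
    exact div_le_div₀ (h0 _) (hanti (Nat.log_mono_right hmn)) this (by exact_mod_cast hmn)

/-- Condensing the series of 1/(n h(n)) gives summability of 1/h(2^m); the truncation level only
repeats each of these terms sixteen times. -/
theorem summable_inv_comp_truncLevel {h : ℝ → ℝ} (h_mono : MonotoneOn h (Set.Ici 0))
    (h_one : ∀ x, 0 ≤ x → 1 ≤ h x) (h_sum : Summable fun n : ℕ => ((n : ℝ) * h n)⁻¹) :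
    Summable fun m => (h (truncLevel m))⁻¹ := by
  have hpos : ∀ x, 0 ≤ x → 0 < h x := fun x hx => zero_lt_one.trans_le (h_one x hx)
  have h1 : Summable fun m : ℕ => (h (2 ^ m))⁻¹ := by
    rw [← summable_condensed_iff_of_nonneg
      (fun n => inv_nonneg.2 (mul_nonneg n.cast_nonneg (hpos _ n.cast_nonneg).le))] at h_sum
    · refine h_sum.congr fun m => ?_
      push_cast
      rw [mul_inv, ← mul_assoc, mul_inv_cancel₀ (by positivity), one_mul]
    · intro m n hm hmn
      have hm' : (0 : ℝ) < m := by exact_mod_cast hm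
      have hmn' : (m : ℝ) ≤ n := by exact_mod_cast hmn
      refine inv_anti₀ (mul_pos hm' (hpos _ hm'.le)) ?_
      exact mul_le_mul hmn' (h_mono hm'.le (hm'.le.trans hmn') hmn') (hpos _ hm'.le).le
        (hm'.le.trans hmn')
  exact summable_comp_div h1 16

/-- The summands depend on n only through `Nat.log 2 n`. For 2^m ≤ n < 2^(m+1) all the averages
therefore lie below one nonnegative variable `U m`, of mean at most `4 * τ m`: the sum is extended
to size 2^(m+1) while the denominator drops to (2^m)². Only one bound per block has to be summed. -/
theorem ae_tendsto_dyadic_average {Ω : Type*} {m0 : MeasurableSpace Ω} {P : Measure Ω}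
    {V : ℕ → ℕ → Ω → ℝ} {τ : ℕ → ℝ} (hV : ∀ k m, 0 ≤ᵐ[P] V k m)
    (hVi : ∀ k m, Integrable (V k m) P) (hVτ : ∀ k m, ∫ ω, V k m ω ∂P ≤ τ m)
    (hτ : Summable τ) :
    ∀ᵐ ω ∂P, Tendsto (fun n : ℕ =>
      (∑ k ∈ Finset.range (triSize n), V k (Nat.log 2 n) ω) / n ^ 2) atTop (𝓝 0) := by
  set U : ℕ → Ω → ℝ := fun m ω =>
    (∑ k ∈ Finset.range (triSize (2 ^ (m + 1))), V k m ω) / ((2 : ℝ) ^ m) ^ 2 with hU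
  have hall : ∀ᵐ ω ∂P, ∀ k m, 0 ≤ V k m ω := ae_all_iff.2 fun k => ae_all_iff.2 fun m => hV k m
  have hUt : ∀ᵐ ω ∂P, Tendsto (fun m => U m ω) atTop (𝓝 0) := by
    refine ae_tendsto_zero_of_summable (b := fun m => 4 * τ m) (fun m => ?_) (fun m => ?_)
      (fun m => ?_) (hτ.mul_left 4)
    · filter_upwards [hall] with ω hω
      exact div_nonneg (Finset.sum_nonneg fun k _ => hω k m) (by positivity)
    · exact (integrable_finsetSum _ fun k _ => hVi k m).div_const _
    · have hτ0 : 0 ≤ τ m := (integral_nonneg_of_ae (hV 0 m)).trans (hVτ 0 m)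
      rw [hU]
      simp only
      rw [integral_div, integral_finsetSum _ fun k _ => hVi k m, div_le_iff₀ (by positivity)]
      calc ∑ k ∈ Finset.range (triSize (2 ^ (m + 1))), ∫ ω, V k m ω ∂P
          ≤ ∑ k ∈ Finset.range (triSize (2 ^ (m + 1))), τ m :=
            Finset.sum_le_sum fun k _ => hVτ k m
        _ = (triSize (2 ^ (m + 1)) : ℝ) * τ m := by simp
        _ ≤ ((2 : ℝ) ^ (m + 1)) ^ 2 * τ m := by
            gcongr
            exact_mod_cast triSize_le_sq _
        _ = 4 * τ m * (2 ^ m) ^ 2 := by ring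
  filter_upwards [hall, hUt] with ω hω hωt
  have hlog : Tendsto (Nat.log 2) atTop atTop := tendsto_atTop_atTop.2 fun b =>
    ⟨2 ^ b, fun n hn => Nat.le_log_of_pow_le Nat.one_lt_two hn⟩
  refine squeeze_zero' (Eventually.of_forall fun n => ?_) ?_ (hωt.comp hlog)
  · exact div_nonneg (Finset.sum_nonneg fun k _ => hω k _) (by positivity)
  · filter_upwards [eventually_ge_atTop 1] with n hn
    have h1 : 2 ^ Nat.log 2 n ≤ n := Nat.pow_log_le_self 2 (by omega)
    have h2 : n ≤ 2 ^ (Nat.log 2 n + 1) := (Nat.lt_pow_succ_log_self Nat.one_lt_two n).le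
    simp only [Function.comp, hU]
    refine div_le_div₀ (Finset.sum_nonneg fun k _ => hω k _) ?_ (by positivity) ?_
    · refine Finset.sum_le_sum_of_subset_of_nonneg ?_ fun k _ _ => hω k _
      exact Finset.range_subset_range.2 (triSize_mono h2)
    · gcongr
      exact_mod_cast h1

theorem memLp_truncAbove {Ω : Type*} {m0 : MeasurableSpace Ω} {P : Measure Ω} {Z : Ω → ℝ} (hZ : MemLp Z 2 P)
    (ℓ : ℝ) :
    MemLp (fun ω => truncAbove ℓ (Z ω)) 2 P :=
  hZ.mono ((measurable_truncAbove ℓ).comp_aemeasurable hZ.1.aemeasurable).aestronglyMeasurable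
    (ae_of_all _ fun _ => abs_truncAbove_le _ _)

/-- Where |Z| exceeds ℓ, monotonicity gives h(|Z|) ≥ h(ℓ), as in Markov's inequality. -/
theorem integral_sq_truncAbove_le {Ω : Type*} {m0 : MeasurableSpace Ω} {P : Measure Ω}
    {Z : Ω → ℝ} (hZ : MemLp Z 2 P) {h : ℝ → ℝ}
    (h_mono : MonotoneOn h (Set.Ici 0)) (h_one : ∀ x, 0 ≤ x → 1 ≤ h x) {C : ℝ}
    (hZi : Integrable (fun ω => Z ω ^ 2 * h |Z ω|) P)
    (hZC : ∫ ω, Z ω ^ 2 * h |Z ω| ∂P ≤ C) {ℓ : ℝ} (hℓ : 0 ≤ ℓ) :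
    ∫ ω, truncAbove ℓ (Z ω) ^ 2 ∂P ≤ C * (h ℓ)⁻¹ := by
  have hpos : ∀ x, 0 ≤ x → 0 < h x := fun x hx => zero_lt_one.trans_le (h_one x hx)
  have hT : Integrable (fun ω => truncAbove ℓ (Z ω) ^ 2) P :=
    (memLp_truncAbove hZ ℓ).integrable_sq
  have h1 : ∫ ω, truncAbove ℓ (Z ω) ^ 2 ∂P ≤ ∫ ω, Z ω ^ 2 * h |Z ω| * (h ℓ)⁻¹ ∂P := by
    refine integral_mono hT (hZi.mul_const _) fun ω => ?_
    simp only
    rw [← div_eq_mul_inv, le_div_iff₀ (hpos ℓ hℓ)]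
    unfold truncAbove
    split_ifs with hle
    · have := hpos |Z ω| (abs_nonneg _)
      have : 0 ≤ Z ω ^ 2 * h |Z ω| := by positivity
      simpa using this
    · exact mul_le_mul_of_nonneg_left (h_mono hℓ (abs_nonneg (Z ω)) (not_le.1 hle).le)
        (sq_nonneg _)
  rw [integral_mul_const] at h1
  exact h1.trans (mul_le_mul_of_nonneg_right hZC (inv_nonneg.2 (hpos ℓ hℓ).le))

/-! ### Linear martingale terms -/

section Terms

variable {Ω : Type*} {m0 : MeasurableSpace Ω} {P : Measure Ω} [IsProbabilityMeasure P]

theorem integral_sq_sub_condExp_le {𝒢 : MeasurableSpace Ω} (h𝒢 : 𝒢 ≤ m0) {u : Ω → ℝ}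
    (hu : MemLp u 2 P) : ∫ ω, (u - P[u | 𝒢]) ω ^ 2 ∂P ≤ ∫ ω, u ω ^ 2 ∂P := by
  have h1 := condVar_ae_le_condExp_sq h𝒢 hu
  have h2 : ∫ ω, (u - P[u | 𝒢]) ω ^ 2 ∂P = ∫ ω, (Var[u; P | 𝒢]) ω ∂P :=
    (integral_condExp h𝒢).symm
  have h3 : ∫ ω, (P[u ^ 2 | 𝒢]) ω ∂P = ∫ ω, u ω ^ 2 ∂P := integral_condExp h𝒢
  rw [h2, ← h3]
  exact integral_mono_ae integrable_condVar integrable_condExp h1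

/-- Each `Z n k` is split at the truncation level and both halves are recentered. With coefficients
O(n^(-3/2)), the bounded half has fourth moment O(ℓ⁴ / n²), while the tail half has second moment
O(τ / n); both are summable. -/
theorem ae_tendsto_linear_martingale {𝒢 : ℕ → ℕ → MeasurableSpace Ω}
    (hmono : ∀ n, Monotone (𝒢 n)) (hle : ∀ n k, 𝒢 n k ≤ m0) {Z B : ℕ → ℕ → Ω → ℝ}
    {τ : ℕ → ℝ} {K : ℝ}
    (hZm : ∀ n, ∀ k < triSize n, StronglyMeasurable[𝒢 n (k + 1)] (Z n k))
    (hZ2 : ∀ n, ∀ k < triSize n, MemLp (Z n k) 2 P)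
    (hZ0 : ∀ n, ∀ k < triSize n, P[Z n k | 𝒢 n k] =ᵐ[P] 0)
    (hZτ : ∀ n m, ∀ k < triSize n, ∫ ω, truncAbove (truncLevel m) (Z n k ω) ^ 2 ∂P ≤ τ m)
    (hτ : Summable fun n : ℕ => τ (Nat.log 2 n) / n)
    (hBm : ∀ n, ∀ k < triSize n, StronglyMeasurable[𝒢 n k] (B n k))
    (hBb : ∀ n, ∀ k < triSize n, ∀ ω, |B n k ω| ≤ K / (n * √n)) :
    ∀ᵐ ω ∂P, Tendsto (fun n : ℕ => ∑ k ∈ Finset.range (triSize n), Z n k ω * B n k ω)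
      atTop (𝓝 0) := by
  set ℓ : ℕ → ℝ := fun n => truncLevel (Nat.log 2 n) with hℓ
  have hℓ0 : ∀ n, 0 ≤ ℓ n := fun n => zero_le_one.trans (one_le_truncLevel _)
  set x : ℕ → ℕ → Ω → ℝ := fun n k ω => truncBelow (ℓ n) (Z n k ω)
  set u : ℕ → ℕ → Ω → ℝ := fun n k ω => truncAbove (ℓ n) (Z n k ω)
  set x₀ : ℕ → ℕ → Ω → ℝ := fun n k => x n k - P[x n k | 𝒢 n k]
  set u₀ : ℕ → ℕ → Ω → ℝ := fun n k => u n k - P[u n k | 𝒢 n k]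
  have hxm : ∀ n, ∀ k < triSize n, StronglyMeasurable[𝒢 n (k + 1)] (x n k) := fun n k hk =>
    ((measurable_truncBelow _).comp (hZm n k hk).measurable).stronglyMeasurable
  have hum : ∀ n, ∀ k < triSize n, StronglyMeasurable[𝒢 n (k + 1)] (u n k) := fun n k hk =>
    ((measurable_truncAbove _).comp (hZm n k hk).measurable).stronglyMeasurable
  have hu2 : ∀ n, ∀ k < triSize n, MemLp (u n k) 2 P := fun n k hk =>
    memLp_truncAbove (hZ2 n k hk) _
  have hxi : ∀ n, ∀ k < triSize n, Integrable (x n k) P := fun n k hk =>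
    Integrable.of_bound ((hxm n k hk).mono (hle _ _)).aestronglyMeasurable (ℓ n)
      (ae_of_all _ fun ω => abs_truncBelow_le (hℓ0 n) _)
  have hcond : ∀ n k (f : Ω → ℝ), StronglyMeasurable[𝒢 n (k + 1)] (P[f | 𝒢 n k]) := fun n k f =>
    stronglyMeasurable_condExp.mono (hmono n (Nat.le_succ k))
  have hBmul : ∀ n, ∀ k < triSize n, ∀ f : Ω → ℝ, MemLp f 2 P →
      MemLp (fun ω => B n k ω * f ω) 2 P := fun n k hk f hf =>
    hf.mul (MemLp.of_bound (p := ⊤) ((hBm n k hk).mono (hle _ _)).aestronglyMeasurable _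
      (ae_of_all _ (hBb n k hk)))
  have hx₀b : ∀ n, ∀ k < triSize n, ∀ᵐ ω ∂P, |x₀ n k ω| ≤ 2 * ℓ n := by
    intro n k hk
    have h1 := ae_bdd_abs_condExp_of_ae_bdd_abs (m := 𝒢 n k) (μ := P) (R := ℓ n) (f := x n k)
      (ae_of_all _ fun ω => abs_truncBelow_le (hℓ0 n) _)
    filter_upwards [h1] with ω h1
    have h2 : |x n k ω| ≤ ℓ n := abs_truncBelow_le (hℓ0 n) _
    refine (abs_sub _ _).trans ?_
    have h3 : |(P[x n k | 𝒢 n k]) ω| ≤ ℓ n := h1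
    linarith
  have hx₀2 : ∀ n, ∀ k < triSize n, MemLp (x₀ n k) 2 P := fun n k hk =>
    MemLp.of_bound (((hxm n k hk).sub (hcond n k _)).mono (hle _ _)).aestronglyMeasurable _
      (hx₀b n k hk)
  have hu₀2 : ∀ n, ∀ k < triSize n, MemLp (u₀ n k) 2 P := fun n k hk =>
    (hu2 n k hk).sub ((hu2 n k hk).condExp one_le_two)
  have t1 : ∀ᵐ ω ∂P, Tendsto (fun n : ℕ => ∑ k ∈ Finset.range (triSize n), B n k ω * x₀ n k ω)
      atTop (𝓝 0) := by
    have h4 := fun n => integral_pow_four_sum_martingale_le (P := P) (hmono n) (hle n)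
      (ζ := fun k ω => B n k ω * x₀ n k ω) (triSize n) (c := 2 * ℓ n * (K / (n * √n)))
      (fun k hk => ((hBm n k hk).mono (hmono n (Nat.le_succ k))).mul
        ((hxm n k hk).sub (hcond n k _)))
      (fun k hk => by
        filter_upwards [hx₀b n k hk] with ω hω
        rw [abs_mul, mul_comm]
        exact mul_le_mul hω (hBb n k hk ω) (abs_nonneg _) (by have := hℓ0 n; positivity))
      (fun k hk => condExp_mul_eq_zero (hBm n k hk) ((hx₀2 n k hk).integrable one_le_two)
        ((hBmul n k hk _ (hx₀2 n k hk)).integrable one_le_two)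
        (condExp_sub_condExp_eq_zero (hle n k) (hxi n k hk)))
    refine ae_tendsto_zero_of_pow (b := fun n : ℕ => 64 * K ^ 4 * (1 / (n : ℝ) ^ (3 / 2 : ℝ))) 4
      (by decide) (fun n => (h4 n).1) (fun n => (h4 n).2.trans ?_)
      ((Real.summable_one_div_nat_rpow.2 (by norm_num)).mul_left _)
    rcases Nat.eq_zero_or_pos n with rfl | hn
    · simp [triSize]
    have hn' : (0 : ℝ) < n := by exact_mod_cast hn
    have e1 : (n : ℝ) ^ (3 / 2 : ℝ) = n * √n := by
      rw [Real.sqrt_eq_rpow, ← Real.rpow_one_add' hn'.le (by norm_num)]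
      norm_num
    have e2 : ℓ n ^ 4 ≤ √n := truncLevel_log_pow_le' hn.ne' (by norm_num)
    have e3 : (triSize n : ℝ) ≤ (n : ℝ) ^ 2 := by exact_mod_cast triSize_le_sq n
    have hs : 0 < √(n : ℝ) := Real.sqrt_pos.2 hn'
    have e4 : √(n : ℝ) ^ 2 = n := Real.sq_sqrt hn'.le
    have hK4 : 0 ≤ K ^ 4 := by positivity
    rw [e1]
    calc 4 * (triSize n : ℝ) ^ 2 * (2 * ℓ n * (K / (n * √n))) ^ 4
        ≤ 4 * ((n : ℝ) ^ 2) ^ 2 * (2 * ℓ n * (K / (n * √n))) ^ 4 := by gcongr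
      _ = 64 * K ^ 4 * ℓ n ^ 4 * (n ^ 4 / (n * √n) ^ 4) := by ring
      _ = 64 * K ^ 4 * ℓ n ^ 4 * (1 / n ^ 2) := by
          have : ((n : ℝ) * √n) ^ 4 = (n : ℝ) ^ 6 := by
            calc ((n : ℝ) * √n) ^ 4 = (n : ℝ) ^ 4 * (√n ^ 2) ^ 2 := by ring
              _ = (n : ℝ) ^ 6 := by rw [e4]; ring
          rw [this]
          field_simp
      _ ≤ 64 * K ^ 4 * √n * (1 / n ^ 2) := by gcongr
      _ = 64 * K ^ 4 * (1 / (n * √n)) := by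
          rw [mul_assoc]
          congr 1
          field_simp
          exact e4
  have t2 : ∀ᵐ ω ∂P, Tendsto (fun n : ℕ => ∑ k ∈ Finset.range (triSize n), B n k ω * u₀ n k ω)
      atTop (𝓝 0) := by
    have h2 := fun n => integral_sq_sum_martingale (P := P) (hmono n) (hle n)
      (ζ := fun k ω => B n k ω * u₀ n k ω) (triSize n)
      (fun k hk => ((hBm n k hk).mono (hmono n (Nat.le_succ k))).mul
        ((hum n k hk).sub (hcond n k _)))
      (fun k hk => hBmul n k hk _ (hu₀2 n k hk))
      (fun k hk => condExp_mul_eq_zero (hBm n k hk) ((hu₀2 n k hk).integrable one_le_two)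
        ((hBmul n k hk _ (hu₀2 n k hk)).integrable one_le_two)
        (condExp_sub_condExp_eq_zero (hle n k) ((hu2 n k hk).integrable one_le_two)))
    refine ae_tendsto_zero_of_pow (b := fun n : ℕ => K ^ 2 * (τ (Nat.log 2 n) / n)) 2
      even_two (fun n => (h2 n).1.integrable_sq) (fun n => (h2 n).2.le.trans ?_)
      (hτ.mul_left _)
    rcases Nat.eq_zero_or_pos n with rfl | hn
    · simp [triSize]
    have hn' : (0 : ℝ) < n := by exact_mod_cast hn
    have e4 : √(n : ℝ) ^ 2 = n := Real.sq_sqrt hn'.le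
    have hterm : ∀ k ∈ Finset.range (triSize n), ∫ ω, (B n k ω * u₀ n k ω) ^ 2 ∂P ≤
        (K / (n * √n)) ^ 2 * τ (Nat.log 2 n) := by
      intro k hk
      have hk := Finset.mem_range.1 hk
      calc ∫ ω, (B n k ω * u₀ n k ω) ^ 2 ∂P
          ≤ ∫ ω, (K / (n * √n)) ^ 2 * u₀ n k ω ^ 2 ∂P := by
            refine integral_mono (hBmul n k hk _ (hu₀2 n k hk)).integrable_sq
              ((hu₀2 n k hk).integrable_sq.const_mul _) fun ω => ?_
            simp only
            rw [mul_pow]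
            refine mul_le_mul_of_nonneg_right ?_ (sq_nonneg _)
            rw [← sq_abs (B n k ω)]
            exact pow_le_pow_left₀ (abs_nonneg _) (hBb n k hk ω) 2
        _ = (K / (n * √n)) ^ 2 * ∫ ω, u₀ n k ω ^ 2 ∂P := integral_const_mul _ _
        _ ≤ _ := by
            refine mul_le_mul_of_nonneg_left ?_ (sq_nonneg _)
            exact (integral_sq_sub_condExp_le (hle n k) (hu2 n k hk)).trans (hZτ n _ k hk)
    have hτ0 : 0 ≤ τ (Nat.log 2 n) := by
      have h0 : 0 < triSize n := hn.trans_le (le_triSize n)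
      exact (integral_nonneg fun ω => sq_nonneg _).trans (hZτ n (Nat.log 2 n) 0 h0)
    calc ∑ k ∈ Finset.range (triSize n), ∫ ω, (B n k ω * u₀ n k ω) ^ 2 ∂P
        ≤ (triSize n : ℝ) * ((K / (n * √n)) ^ 2 * τ (Nat.log 2 n)) := by
          refine (Finset.sum_le_sum hterm).trans (le_of_eq ?_)
          simp
      _ ≤ (n : ℝ) ^ 2 * ((K / (n * √n)) ^ 2 * τ (Nat.log 2 n)) := by
          gcongr
          exact_mod_cast triSize_le_sq n
      _ = K ^ 2 * (τ (Nat.log 2 n) / n) := by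
          rw [div_pow, mul_pow, e4]
          field_simp
  -- `Z` is conditionally centered, so the conditional means subtracted from its two halves cancel.
  have hsplit : ∀ᵐ ω ∂P, ∀ n k, k < triSize n → Z n k ω = x₀ n k ω + u₀ n k ω := by
    refine ae_all_iff.2 fun n => ae_all_iff.2 fun k => ?_
    by_cases hk : k < triSize n
    · have hxu : x n k + u n k = Z n k := by
        funext ω; exact truncBelow_add_truncAbove _ _
      have h1 := condExp_add (hxi n k hk) ((hu2 n k hk).integrable one_le_two) (𝒢 n k)
      rw [hxu] at h1
      filter_upwards [h1, hZ0 n k hk] with ω h1 h2 _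
      rw [h2] at h1
      have h3 : Z n k ω = x n k ω + u n k ω := by rw [← hxu]; rfl
      simp only [Pi.add_apply, Pi.zero_apply] at h1
      simp only [x₀, u₀, Pi.sub_apply]
      linarith
    · exact ae_of_all _ fun ω h => absurd h hk
  filter_upwards [t1, t2, hsplit] with ω h1 h2 h3
  have h4 := h1.add h2
  rw [add_zero] at h4
  refine h4.congr fun n => ?_
  rw [← Finset.sum_add_distrib]
  refine Finset.sum_congr rfl fun k hk => ?_
  rw [h3 n k (Finset.mem_range.1 hk)]
  ring

/-- Coefficients O(n^(-2)) on at most n² terms already give a summable variance, so neither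
truncation nor fourth moments are needed. -/
theorem ae_tendsto_quadratic_martingale {𝒢 : ℕ → ℕ → MeasurableSpace Ω}
    (hmono : ∀ n, Monotone (𝒢 n)) (hle : ∀ n k, 𝒢 n k ≤ m0) {Z B : ℕ → ℕ → Ω → ℝ}
    {D K : ℝ}
    (hZm : ∀ n, ∀ k < triSize n, StronglyMeasurable[𝒢 n (k + 1)] (Z n k))
    (hZ2 : ∀ n, ∀ k < triSize n, MemLp (Z n k) 2 P)
    (hZ0 : ∀ n, ∀ k < triSize n, P[Z n k | 𝒢 n k] =ᵐ[P] 0)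
    (hZD : ∀ n, ∀ k < triSize n, ∫ ω, Z n k ω ^ 2 ∂P ≤ D)
    (hBm : ∀ n, ∀ k < triSize n, StronglyMeasurable[𝒢 n k] (B n k))
    (hBb : ∀ n, ∀ k < triSize n, ∀ ω, |B n k ω| ≤ K / n ^ 2) :
    ∀ᵐ ω ∂P, Tendsto (fun n : ℕ => ∑ k ∈ Finset.range (triSize n), Z n k ω * B n k ω)
      atTop (𝓝 0) := by
  have hBmul : ∀ n, ∀ k < triSize n, MemLp (fun ω => Z n k ω * B n k ω) 2 P := fun n k hk => by
    have := (hZ2 n k hk).mul (r := 2) (MemLp.of_bound (p := ⊤)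
      ((hBm n k hk).mono (hle _ _)).aestronglyMeasurable _ (ae_of_all _ (hBb n k hk)))
    have e : (fun ω => Z n k ω * B n k ω) = B n k * Z n k := by
      funext ω; exact mul_comm _ _
    rw [e]
    exact this
  have h2 := fun n => integral_sq_sum_martingale (P := P) (hmono n) (hle n)
    (ζ := fun k ω => Z n k ω * B n k ω) (triSize n)
    (fun k hk => (hZm n k hk).mul ((hBm n k hk).mono (hmono n (Nat.le_succ k))))
    (hBmul n)
    (fun k hk => by
      have h1 := (hBmul n k hk).integrable one_le_two
      have e : (fun ω => Z n k ω * B n k ω) = B n k * Z n k := by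
        funext ω; exact mul_comm _ _
      rw [e] at h1 ⊢
      exact condExp_mul_eq_zero (hBm n k hk) ((hZ2 n k hk).integrable one_le_two) h1 (hZ0 n k hk))
  refine ae_tendsto_zero_of_pow (b := fun n : ℕ => K ^ 2 * D * (1 / (n : ℝ) ^ 2)) 2
    even_two (fun n => (h2 n).1.integrable_sq) (fun n => (h2 n).2.le.trans ?_)
    ((Real.summable_one_div_nat_pow.2 one_lt_two).mul_left _)
  rcases Nat.eq_zero_or_pos n with rfl | hn
  · simp [triSize]
  have hn' : (0 : ℝ) < n := by exact_mod_cast hn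
  have hterm : ∀ k ∈ Finset.range (triSize n), ∫ ω, (Z n k ω * B n k ω) ^ 2 ∂P ≤
      (K / n ^ 2) ^ 2 * D := by
    intro k hk
    have hk := Finset.mem_range.1 hk
    calc ∫ ω, (Z n k ω * B n k ω) ^ 2 ∂P ≤ ∫ ω, (K / n ^ 2) ^ 2 * Z n k ω ^ 2 ∂P := by
          refine integral_mono (hBmul n k hk).integrable_sq
            ((hZ2 n k hk).integrable_sq.const_mul _) fun ω => ?_
          simp only
          rw [mul_pow, mul_comm]
          refine mul_le_mul_of_nonneg_right ?_ (sq_nonneg _)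
          rw [← sq_abs (B n k ω)]
          exact pow_le_pow_left₀ (abs_nonneg _) (hBb n k hk ω) 2
      _ = (K / n ^ 2) ^ 2 * ∫ ω, Z n k ω ^ 2 ∂P := integral_const_mul _ _
      _ ≤ _ := mul_le_mul_of_nonneg_left (hZD n k hk) (sq_nonneg _)
  have hD0 : 0 ≤ D :=
    (integral_nonneg fun ω => sq_nonneg _).trans (hZD n 0 (hn.trans_le (le_triSize n)))
  calc ∑ k ∈ Finset.range (triSize n), ∫ ω, (Z n k ω * B n k ω) ^ 2 ∂P
      ≤ (triSize n : ℝ) * ((K / n ^ 2) ^ 2 * D) := by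
        refine (Finset.sum_le_sum hterm).trans (le_of_eq ?_)
        simp
    _ ≤ (n : ℝ) ^ 2 * ((K / n ^ 2) ^ 2 * D) := by
        gcongr
        exact_mod_cast triSize_le_sq n
    _ = K ^ 2 * D * (1 / n ^ 2) := by field_simp

end Terms

/-! ### Sums of terms which are centered given a delayed past -/

/-- `R n i` is known at time i + 1 and has zero mean given time i + 1 - a, so it is the sum of its
`a` successive projection increments. For a fixed lag s these increments are martingale differences
of the filtration shifted by s, and fourth moments apply to each of the finitely many sums. The
times are integers so that i - s may be negative. -/
theorem ae_tendsto_lagged_martingale {Ω : Type*} {m0 : MeasurableSpace Ω} {P : Measure Ω}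
    [IsProbabilityMeasure P] {𝓡 : ℤ → MeasurableSpace Ω} (hmono : Monotone 𝓡)
    (hle : ∀ i, 𝓡 i ≤ m0) (a : ℕ) {R : ℕ → ℕ → Ω → ℝ} {c : ℕ → ℝ}
    (hRm : ∀ n : ℕ, ∀ i : ℕ, i < n → StronglyMeasurable[𝓡 (i + 1)] (R n i))
    (hRc : ∀ n, ∀ i < n, ∀ᵐ ω ∂P, |R n i ω| ≤ c n)
    (hR0 : ∀ n : ℕ, ∀ i : ℕ, i < n → P[R n i | 𝓡 (i + 1 - a)] =ᵐ[P] 0)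
    (hc : Summable fun n : ℕ => 4 * (n : ℝ) ^ 2 * (2 * c n) ^ 4) :
    ∀ᵐ ω ∂P, Tendsto (fun n : ℕ => ∑ i ∈ Finset.range n, R n i ω) atTop (𝓝 0) := by
  set ζ : ℕ → ℕ → ℕ → Ω → ℝ := fun s n i =>
    P[R n i | 𝓡 (i + 1 - s)] - P[R n i | 𝓡 (i - s)] with hζ
  have hRi : ∀ n, ∀ i < n, Integrable (R n i) P := fun n i hi =>
    integrable_of_ae_abs_le ((hRm n i hi).mono (hle _)).aestronglyMeasurable (hRc n i hi)
  have hconv : ∀ s, ∀ᵐ ω ∂P, Tendsto (fun n : ℕ => ∑ i ∈ Finset.range n, ζ s n i ω)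
      atTop (𝓝 0) := by
    intro s
    have h4 := fun n => integral_pow_four_sum_martingale_le (P := P)
      (𝒢 := fun i : ℕ => 𝓡 ((i : ℤ) - s)) (fun i j hij => hmono (by omega)) (fun i => hle _)
      (ζ := ζ s n) n (c := 2 * c n)
      (fun i hi => by
        refine StronglyMeasurable.sub ?_ ?_
        · exact stronglyMeasurable_condExp.mono (hmono (by push_cast; omega))
        · exact stronglyMeasurable_condExp.mono (hmono (by push_cast; omega)))
      (fun i hi => by
        filter_upwards [ae_bdd_abs_condExp_of_ae_bdd_abs (m := 𝓡 (i + 1 - s)) (hRc n i hi),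
          ae_bdd_abs_condExp_of_ae_bdd_abs (m := 𝓡 (i - s)) (hRc n i hi)] with ω h1 h2
        refine (abs_sub _ _).trans ?_
        linarith)
      (fun i hi => by
        have h1 := condExp_sub (μ := P) (integrable_condExp (f := R n i) (m := 𝓡 (i + 1 - s)))
          (integrable_condExp (f := R n i) (m := 𝓡 (i - s))) (𝓡 (i - s))
        have h2 := condExp_condExp_of_le (f := R n i) (μ := P)
          (hmono (show (i : ℤ) - s ≤ i + 1 - s by omega)) (hle _)
        have h3 := condExp_condExp_of_le (f := R n i) (μ := P) (le_refl (𝓡 (i - s))) (hle _)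
        filter_upwards [h1, h2, h3] with ω h1 h2 h3
        rw [h1, Pi.sub_apply, h2, h3, sub_self, Pi.zero_apply])
    exact ae_tendsto_zero_of_pow 4 (by decide) (fun n => (h4 n).1) (fun n => (h4 n).2) hc
  have hsum : ∀ᵐ ω ∂P, ∀ n i, i < n → ∑ s ∈ Finset.range a, ζ s n i ω = R n i ω := by
    refine ae_all_iff.2 fun n => ae_all_iff.2 fun i => ?_
    by_cases hi : i < n
    · have h1 : ∀ ω, ∑ s ∈ Finset.range a, ζ s n i ω =
          (P[R n i | 𝓡 (i + 1 - (0 : ℕ))]) ω - (P[R n i | 𝓡 (i + 1 - a)]) ω := by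
        intro ω
        rw [← Finset.sum_range_sub' (fun s : ℕ => (P[R n i | 𝓡 (i + 1 - s)]) ω) a]
        refine Finset.sum_congr rfl fun s _ => ?_
        have : (i : ℤ) + 1 - ((s + 1 : ℕ) : ℤ) = i - s := by push_cast; ring
        rw [this, hζ]
        rfl
      have h2 : P[R n i | 𝓡 (i + 1 - (0 : ℕ))] = R n i := by
        refine condExp_of_stronglyMeasurable (hle _) ?_ (hRi n i hi)
        simpa using hRm n i hi
      filter_upwards [hR0 n i hi] with ω h3 _
      rw [h1, h2, h3]
      simp
    · exact ae_of_all _ fun ω h => absurd h hi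
  filter_upwards [hsum, ae_all_iff.2 hconv] with ω h1 h2
  have h3 := tendsto_finsetSum (Finset.range a) fun s _ => h2 s
  rw [Finset.sum_const_zero] at h3
  refine h3.congr fun n => ?_
  rw [Finset.sum_comm]
  exact Finset.sum_congr rfl fun i hi => h1 n i (Finset.mem_range.1 hi)

/-! ### Replacing the entries one at a time -/

/-- The sup-distance of the positions of two entries of the lower triangle. -/
def triDist (q k : ℕ) : ℤ :=
  max |((triRow q : ℤ) - triRow k)| |((triCol q : ℤ) - triCol k)|

theorem one_le_triDist {q k : ℕ} (h : q < k) : 1 ≤ triDist q k := by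
  unfold triDist
  rcases triIndex_lex h with h1 | ⟨h1, h2⟩
  · refine le_max_of_le_left ?_
    rw [abs_sub_comm, abs_of_pos] <;> omega
  · refine le_max_of_le_right ?_
    rw [abs_sub_comm, abs_of_pos] <;> omega

/-- The entries of `x` before `k` at distance at least `a` from `k`, the entries of `y` after `k`,
and zero elsewhere. -/
def hybrid (a : ℕ) (x y : ℕ → ℝ) (k q : ℕ) : ℝ :=
  if k < q then y q else if q < k ∧ (a : ℤ) ≤ triDist q k then x q else 0

theorem hybrid_self (a : ℕ) (x y : ℕ → ℝ) (k : ℕ) : hybrid a x y k k = 0 := by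
  simp [hybrid]

/-- At distance parameter 1 nothing before `k` is deleted, since distinct positions are at distance
at least 1. -/
theorem update_hybrid_one (x y : ℕ → ℝ) (k : ℕ) (t : ℝ) :
    Function.update (hybrid 1 x y k) k t =
      fun q => if k < q then y q else if q < k then x q else t := by
  funext q
  rcases lt_trichotomy q k with h | h | h
  · have := one_le_triDist h
    simp [hybrid, h.ne, h, h.not_gt, this]
  · simp [h]
  · simp [hybrid, h.ne', h]

theorem abs_hybrid_sub_le (a : ℕ) (x y : ℕ → ℝ) (k q : ℕ) :
    |hybrid 1 x y k q - hybrid a x y k q| ≤ if triDist q k < a then |x q| else 0 := by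
  unfold hybrid
  by_cases h1 : k < q
  · simp only [h1, if_true, sub_self, abs_zero]
    split_ifs <;> simp
  · by_cases h2 : q < k
    · have := one_le_triDist h2
      by_cases h3 : triDist q k < a
      · simp [h1, h2, h3, this, not_le.2 h3]
      · simp [h1, h2, h3, this, not_lt.1 h3]
    · simp only [h1, h2, if_false, false_and, sub_self, abs_zero]
      split_ifs <;> simp

theorem card_triDist_lt_le (a q N : ℕ) :
    ((Finset.range N).filter fun k => triDist q k < a).card ≤ (2 * a) ^ 2 := by
  have h := Finset.card_le_card_of_injOn (s := (Finset.range N).filter fun k => triDist q k < a)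
    (t := Finset.Ico ((triRow q : ℤ) - a) (triRow q + a) ×ˢ
      Finset.Ico ((triCol q : ℤ) - a) (triCol q + a))
    (fun k => ((triRow k : ℤ), (triCol k : ℤ)))
    (fun k hk => by
      have h1 := (Finset.mem_filter.1 hk).2
      rw [triDist, max_lt_iff, abs_lt, abs_lt] at h1
      simp only [Finset.coe_product, Set.mem_prod, Finset.mem_coe, Finset.mem_Ico]
      omega)
    (fun k _ l _ hkl => by
      have h1 : triRow k = triRow l := by have := congrArg Prod.fst hkl; simpa using this
      have h2 : triCol k = triCol l := by have := congrArg Prod.snd hkl; simpa using this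
      rw [← triSize_triRow_add_triCol k, ← triSize_triRow_add_triCol l, h1, h2])
  refine h.trans (le_of_eq ?_)
  rw [Finset.card_product, Int.card_Ico, Int.card_Ico]
  have e1 : ((triRow q : ℤ) + a - (triRow q - a)).toNat = 2 * a := by omega
  have e2 : ((triCol q : ℤ) + a - (triCol q - a)).toNat = 2 * a := by omega
  rw [e1, e2, sq]

section Deterministic

variable {K : ℝ} {F : ℕ → (ℕ → ℝ) → ℝ} {D₁ D₂ : ℕ → ℕ → (ℕ → ℝ) → ℝ}

/-- The average over the lower triangle of the squares of the entries exceeding `ℓ`. -/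
noncomputable def tailAverage (ℓ : ℝ) (x : ℕ → ℝ) (n : ℕ) : ℝ :=
  (∑ k ∈ Finset.range (triSize n), truncAbove ℓ (x k) ^ 2) / n ^ 2

theorem triSize_div_sq_le_one (n : ℕ) : (triSize n : ℝ) / n ^ 2 ≤ 1 :=
  div_le_one_of_le₀ (by exact_mod_cast triSize_le_sq n) (by positivity)

/-- The cubic remainder is used below the truncation level and the quadratic one above it. -/
theorem SmoothAtScale.abs_taylor_le (hF : SmoothAtScale K F D₁ D₂) {ℓ : ℝ} {n k : ℕ}
    (hk : k < triSize n) {c : ℕ → ℝ} (hc : c k = 0) (t : ℝ) :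
    |F n (Function.update c k t) - F n c - t * D₁ n k c - t ^ 2 * D₂ n k c| ≤
      K * ((|ℓ| ^ 3 / √n + truncAbove ℓ t ^ 2) / n ^ 2) := by
  have hK := hF.nonneg
  unfold truncAbove
  split_ifs with h
  · refine (hF.taylor_cube n k c t hk hc).trans ?_
    rw [mul_comm ((n : ℝ) ^ 2), ← div_div]
    have : |t| ≤ |ℓ| := h.trans (le_abs_self ℓ)
    gcongr
    simp only [ne_eq, OfNat.ofNat_ne_zero, not_false_eq_true, zero_pow, add_zero]
    gcongr
  · refine (hF.taylor_sq n k c t hk hc).trans ?_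
    gcongr
    have : 0 ≤ |ℓ| ^ 3 / √n := by positivity
    linarith

/-- Inserting `x k` and inserting `y k` are expanded about the same point, the hybrid with zero at
`k`, so the constant terms cancel in the telescoping sum. The common value `s k ^ 2` is subtracted
from both squares for free, which centers each quadratic sum. -/
theorem SmoothAtScale.abs_sub_le (hF : SmoothAtScale K F D₁ D₂) (ℓ : ℝ) (n : ℕ)
    (x y s : ℕ → ℝ) :
    |F n x - F n y| ≤
      |∑ k ∈ Finset.range (triSize n), x k * D₁ n k (hybrid 1 x y k)| +
      |∑ k ∈ Finset.range (triSize n), y k * D₁ n k (hybrid 1 x y k)| +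
      |∑ k ∈ Finset.range (triSize n), (x k ^ 2 - s k ^ 2) * D₂ n k (hybrid 1 x y k)| +
      |∑ k ∈ Finset.range (triSize n), (y k ^ 2 - s k ^ 2) * D₂ n k (hybrid 1 x y k)| +
      K * (2 * (|ℓ| ^ 3 / √n) + tailAverage ℓ x n + tailAverage ℓ y n) := by
  set A : ℕ → ℕ → ℝ := hybrid 1 x y with hA
  set H : ℕ → ℕ → ℝ := fun k q => if q < k then x q else y q with hH
  have hx : ∀ k, H (k + 1) = Function.update (A k) k (x k) := by
    intro k
    rw [hA, update_hybrid_one]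
    funext q
    simp only [hH]
    rcases lt_trichotomy q k with h | h | h
    · simp [h, h.not_gt, Nat.lt_succ_of_lt h]
    · simp [h]
    · have : ¬ q < k + 1 := by omega
      simp [h, this]
  have hy : ∀ k, H k = Function.update (A k) k (y k) := by
    intro k
    rw [hA, update_hybrid_one]
    funext q
    simp only [hH]
    rcases lt_trichotomy q k with h | h | h
    · simp [h, h.not_gt]
    · simp [h]
    · simp [h, h.not_gt]
  set r : (ℕ → ℝ) → ℕ → ℝ := fun w k =>
    F n (Function.update (A k) k (w k)) - F n (A k) - w k * D₁ n k (A k) -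
      w k ^ 2 * D₂ n k (A k) with hr
  have htel : F n x - F n y = ∑ k ∈ Finset.range (triSize n), (F n (H (k + 1)) - F n (H k)) := by
    rw [Finset.sum_range_sub (fun k => F n (H k))]
    congr 1
    exact hF.congr _ _ _ fun q hq => by simp [hH, hq]
  have hdec : F n x - F n y =
      ∑ k ∈ Finset.range (triSize n), x k * D₁ n k (A k) -
      ∑ k ∈ Finset.range (triSize n), y k * D₁ n k (A k) +
      ∑ k ∈ Finset.range (triSize n), (x k ^ 2 - s k ^ 2) * D₂ n k (A k) -
      ∑ k ∈ Finset.range (triSize n), (y k ^ 2 - s k ^ 2) * D₂ n k (A k) +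
      ∑ k ∈ Finset.range (triSize n), r x k - ∑ k ∈ Finset.range (triSize n), r y k := by
    rw [htel, ← Finset.sum_sub_distrib, ← Finset.sum_add_distrib, ← Finset.sum_sub_distrib,
      ← Finset.sum_add_distrib, ← Finset.sum_sub_distrib]
    refine Finset.sum_congr rfl fun k _ => ?_
    rw [hx, hy]
    simp only [hr]
    ring
  have hrb : ∀ w : ℕ → ℝ, |∑ k ∈ Finset.range (triSize n), r w k| ≤
      K * (|ℓ| ^ 3 / √n + tailAverage ℓ w n) := by
    intro w
    have hK := hF.nonneg
    have h0 : 0 ≤ |ℓ| ^ 3 / √n := by positivity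
    calc |∑ k ∈ Finset.range (triSize n), r w k|
        ≤ ∑ k ∈ Finset.range (triSize n), |r w k| := Finset.abs_sum_le_sum_abs _ _
      _ ≤ ∑ k ∈ Finset.range (triSize n),
            K * ((|ℓ| ^ 3 / √n + truncAbove ℓ (w k) ^ 2) / n ^ 2) :=
          Finset.sum_le_sum fun k hk =>
            hF.abs_taylor_le (Finset.mem_range.1 hk) (hybrid_self 1 x y k) _
      _ = K * (|ℓ| ^ 3 / √n * ((triSize n : ℝ) / n ^ 2) + tailAverage ℓ w n) := by
          rw [← Finset.mul_sum, ← Finset.sum_div, Finset.sum_add_distrib, tailAverage,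
            Finset.sum_const, Finset.card_range, nsmul_eq_mul]
          ring
      _ ≤ _ := by
          gcongr
          exact mul_le_of_le_one_right h0 (triSize_div_sq_le_one n)
  have h1 := hrb x
  have h2 := hrb y
  rw [hdec]
  refine (abs_sub _ _).trans ?_
  refine (add_le_add (abs_add_le _ _) le_rfl).trans ?_
  refine (add_le_add (add_le_add (abs_sub _ _) le_rfl) le_rfl).trans ?_
  refine (add_le_add (add_le_add (add_le_add (abs_add_le _ _) le_rfl) le_rfl) le_rfl).trans ?_
  refine (add_le_add (add_le_add (add_le_add (add_le_add (abs_sub _ _) le_rfl) le_rfl)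
    le_rfl) le_rfl).trans ?_
  linarith

/-- Deleting the entries near `k` is charged to the deleted entries. Each entry is deleted for at
most (2a)² indices `k`, so after exchanging the sums the total cost is an average over single
entries. -/
theorem SmoothAtScale.abs_sum_mul_hybrid_sub_le (hF : SmoothAtScale K F D₁ D₂) {ℓ : ℝ} (hℓ : 1 ≤ ℓ)
    (a n : ℕ) (x y w : ℕ → ℝ) {M : ℝ} (hw : ∀ k < triSize n, |w k| ≤ M * ℓ ^ 2) (hM : 0 ≤ M) :
    |∑ k ∈ Finset.range (triSize n),
      w k * (D₂ n k (hybrid 1 x y k) - D₂ n k (hybrid a x y k))| ≤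
      M * K * (2 * a) ^ 2 * (ℓ ^ 3 / √n + tailAverage ℓ x n) := by
  have hK := hF.nonneg
  have hℓ0 : 0 < ℓ := zero_lt_one.trans_le hℓ
  set g : ℕ → ℝ := fun q => ℓ ^ 3 / √n + truncAbove ℓ (x q) ^ 2 with hg
  have hg0 : ∀ q, 0 ≤ g q := fun q => by positivity
  -- An entry below ℓ costs ℓ² · ℓ/√n. For a larger one the minimum is replaced by 1, and ℓ² is at
  -- most the squared tail.
  have hmin : ∀ q, ℓ ^ 2 * min 1 (|x q| / √n) ≤ g q := by
    intro q
    simp only [hg]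
    unfold truncAbove
    split_ifs with h
    · have : ℓ ^ 2 * min 1 (|x q| / √n) ≤ ℓ ^ 2 * (ℓ / √n) := by
        gcongr
        exact (min_le_right _ _).trans (by gcongr)
      refine this.trans (le_of_eq ?_)
      ring
    · have h1 : ℓ ^ 2 * min 1 (|x q| / √n) ≤ ℓ ^ 2 * 1 := by
        gcongr
        exact min_le_left _ _
      have h2 : ℓ ^ 2 ≤ x q ^ 2 := by
        rw [← sq_abs (x q)]
        exact pow_le_pow_left₀ hℓ0.le (not_le.1 h).le 2
      have h3 : 0 ≤ ℓ ^ 3 / √n := by positivity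
      linarith
  have hterm : ∀ k ∈ Finset.range (triSize n),
      |w k * (D₂ n k (hybrid 1 x y k) - D₂ n k (hybrid a x y k))| ≤
        M * K * ((∑ q ∈ Finset.range (triSize n), if triDist q k < a then g q else 0) / n ^ 2) := by
    intro k hk
    have hk := Finset.mem_range.1 hk
    have h1 : ∑ q ∈ Finset.range (triSize n),
        ℓ ^ 2 * min 1 (|hybrid 1 x y k q - hybrid a x y k q| / √n) ≤
        ∑ q ∈ Finset.range (triSize n), if triDist q k < a then g q else 0 := by
      refine Finset.sum_le_sum fun q _ => ?_
      have h2 := abs_hybrid_sub_le a x y k q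
      split_ifs at h2 ⊢ with h3
      · refine le_trans ?_ (hmin q)
        gcongr
      · have h4 : |hybrid 1 x y k q - hybrid a x y k q| = 0 := le_antisymm h2 (abs_nonneg _)
        simp [h4]
    rw [abs_mul]
    calc |w k| * |D₂ n k (hybrid 1 x y k) - D₂ n k (hybrid a x y k)|
        ≤ (M * ℓ ^ 2) * (K * ((∑ q ∈ Finset.range (triSize n),
            min 1 (|hybrid 1 x y k q - hybrid a x y k q| / √n)) / n ^ 2)) :=
          mul_le_mul (hw k hk) (hF.lipschitz₂ n k _ _ hk) (abs_nonneg _) (by positivity)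
      _ = M * K * ((∑ q ∈ Finset.range (triSize n),
            ℓ ^ 2 * min 1 (|hybrid 1 x y k q - hybrid a x y k q| / √n)) / n ^ 2) := by
          rw [← Finset.mul_sum]; ring
      _ ≤ _ := by gcongr
  have hswap : ∑ k ∈ Finset.range (triSize n), ∑ q ∈ Finset.range (triSize n),
      (if triDist q k < a then g q else 0) ≤
        (2 * (a : ℝ)) ^ 2 * ∑ q ∈ Finset.range (triSize n), g q := by
    rw [Finset.sum_comm, Finset.mul_sum]
    refine Finset.sum_le_sum fun q _ => ?_
    rw [← Finset.sum_filter, Finset.sum_const, nsmul_eq_mul]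
    refine mul_le_mul_of_nonneg_right ?_ (hg0 q)
    exact_mod_cast card_triDist_lt_le a q (triSize n)
  calc |∑ k ∈ Finset.range (triSize n),
        w k * (D₂ n k (hybrid 1 x y k) - D₂ n k (hybrid a x y k))|
      ≤ ∑ k ∈ Finset.range (triSize n), M * K *
          ((∑ q ∈ Finset.range (triSize n), if triDist q k < a then g q else 0) / n ^ 2) :=
        (Finset.abs_sum_le_sum_abs _ _).trans (Finset.sum_le_sum hterm)
    _ = M * K * ((∑ k ∈ Finset.range (triSize n), ∑ q ∈ Finset.range (triSize n),
          if triDist q k < a then g q else 0) / n ^ 2) := by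
        rw [← Finset.mul_sum, ← Finset.sum_div]
    _ ≤ M * K * (((2 * (a : ℝ)) ^ 2 * ∑ q ∈ Finset.range (triSize n), g q) / n ^ 2) := by gcongr
    _ = M * K * (2 * a) ^ 2 * (ℓ ^ 3 / √n * ((triSize n : ℝ) / n ^ 2) + tailAverage ℓ x n) := by
        simp only [hg]
        rw [Finset.sum_add_distrib, tailAverage, Finset.sum_const, Finset.card_range,
          nsmul_eq_mul]
        ring
    _ ≤ _ := by
        gcongr
        exact mul_le_of_le_one_right (by positivity) (triSize_div_sq_le_one n)

end Deterministic

/-! ### The sigma-algebras -/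

/-- The position in `ℤ²` of the `k`-th entry of the lower triangle. -/
def triPos (k : ℕ) : ℤ × ℤ := ((triRow k : ℤ) + 1, (triCol k : ℤ) + 1)

/-- The position in `ℕ+ × ℕ+` of the `k`-th entry of the lower triangle. -/
def triPosPNat (k : ℕ) : ℕ+ × ℕ+ := (Nat.succPNat (triRow k), Nat.succPNat (triCol k))

theorem triPos_snd_le_fst (k : ℕ) : (triPos k).2 ≤ (triPos k).1 := by
  have := triCol_le_triRow k
  simp only [triPos]
  omega

theorem triPosPNat_injective : Function.Injective triPosPNat := by
  intro k l h
  have h1 : triRow k = triRow l := Nat.succPNat_injective (congrArg Prod.fst h)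
  have h2 : triCol k = triCol l := Nat.succPNat_injective (congrArg Prod.snd h)
  rw [← triSize_triRow_add_triCol k, ← triSize_triRow_add_triCol l, h1, h2]

theorem triPos_mem_pastIndices {a q k : ℕ} (h : q < k) (hd : (a : ℤ) ≤ triDist q k) :
    triPos q ∈ pastIndices a (triPos k) := by
  refine ⟨?_, ?_⟩
  · simpa [triPos, triDist] using hd
  · rw [Prod.Lex.toLex_le_toLex]
    rcases triIndex_lex h with h1 | ⟨h1, h2⟩
    · left; simpa [triPos] using h1
    · right; exact ⟨by simp [triPos, h1], by simpa [triPos] using h2.le⟩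

/-- Distinct integer points are at sup-distance at least 1, so for a = 1 the past is the strict
lexicographic past, which grows along the enumeration. For larger a the pasts of successive entries
need not be nested. -/
theorem mem_pastIndices_one_iff {p q : ℤ × ℤ} : q ∈ pastIndices 1 p ↔ toLex q < toLex p := by
  have h1 : ∀ x : ℤ, 1 ≤ |x| ↔ x ≠ 0 := fun x =>
    ⟨fun h => abs_pos.1 (by omega), fun h => by have := abs_pos.2 h; omega⟩
  change ((1 : ℕ) : ℤ) ≤ max |q.1 - p.1| |q.2 - p.2| ∧ toLex q ≤ toLex p ↔ _
  rw [lt_iff_le_and_ne, and_comm]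
  refine and_congr_right fun _ => ?_
  rw [Ne, toLex_inj, Prod.ext_iff, le_max_iff, Nat.cast_one, h1, h1, sub_ne_zero, sub_ne_zero]
  tauto

section Sigma

variable {Ω : Type*} {ι : Type*}

/-- The sigma-algebra generated by a whole family of variables. -/
abbrev fullSigma (X : ι → Ω → ℝ) : MeasurableSpace Ω :=
  MeasurableSpace.comap (fun ω p => X p ω) MeasurableSpace.pi

theorem measurable_fullSigma (X : ι → Ω → ℝ) (p : ι) : Measurable[fullSigma X] (X p) :=
  (measurable_pi_apply p).comp (comap_measurable fun ω p => X p ω)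

theorem fullSigma_le {m0 : MeasurableSpace Ω} {X : ι → Ω → ℝ} (hX : ∀ p, Measurable (X p)) :
    fullSigma X ≤ m0 :=
  (measurable_pi_iff.2 hX).comap_le

variable (X : ℤ × ℤ → Ω → ℝ)

/-- The sigma-algebra generated by the lower triangular entries in the rows up to `i`. -/
abbrev rowSigma (i : ℤ) : MeasurableSpace Ω :=
  ⨆ q ∈ {q : ℤ × ℤ | q.1 ≤ i ∧ q.2 ≤ q.1},
    MeasurableSpace.comap (X q) (inferInstance : MeasurableSpace ℝ)

theorem measurable_iSup_comap {s : Set ι} {Z : ι → Ω → ℝ} {q : ι} (hq : q ∈ s) :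
    Measurable[⨆ q ∈ s, MeasurableSpace.comap (Z q) (inferInstance : MeasurableSpace ℝ)] (Z q) :=
  Measurable.mono (comap_measurable (Z q)) (le_iSup₂_of_le q hq le_rfl) le_rfl

theorem iSup_comap_mono {s t : Set ι} (hst : s ⊆ t) (Z : ι → Ω → ℝ) :
    ⨆ q ∈ s, MeasurableSpace.comap (Z q) (inferInstance : MeasurableSpace ℝ) ≤
      ⨆ q ∈ t, MeasurableSpace.comap (Z q) (inferInstance : MeasurableSpace ℝ) :=
  biSup_mono hst

theorem iSup_comap_le_fullSigma (s : Set ι) (Z : ι → Ω → ℝ) :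
    ⨆ q ∈ s, MeasurableSpace.comap (Z q) (inferInstance : MeasurableSpace ℝ) ≤ fullSigma Z :=
  iSup₂_le fun q _ => (measurable_fullSigma Z q).comap_le

theorem pastSigma_one_mono : Monotone fun k => pastSigma X 1 (triPos k) := by
  intro k l hkl
  refine iSup_comap_mono ?_ X
  rintro q ⟨h1, h2⟩
  refine ⟨?_, h2⟩
  rcases hkl.eq_or_lt with rfl | hkl
  · exact h1
  · rw [mem_pastIndices_one_iff] at h1 ⊢
    exact h1.trans (mem_pastIndices_one_iff.1
      (triPos_mem_pastIndices hkl (by exact_mod_cast one_le_triDist hkl)))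

theorem measurable_pastSigma_one {q k : ℕ} (h : q < k) :
    Measurable[pastSigma X 1 (triPos k)] (X (triPos q)) :=
  measurable_iSup_comap (s := {q : ℤ × ℤ | q ∈ pastIndices 1 (triPos k) ∧ q.2 ≤ q.1})
    ⟨triPos_mem_pastIndices h (by exact_mod_cast one_le_triDist h), triPos_snd_le_fst q⟩

theorem rowSigma_mono : Monotone (rowSigma X) := by
  intro i j hij
  refine iSup_comap_mono ?_ X
  rintro q ⟨h1, h2⟩
  exact ⟨h1.trans hij, h2⟩

/-- A row at least `a` above that of `k` is far from `k` whatever the column; `1 ≤ a` makes that row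
strictly earlier, which settles the lexicographic comparison. Full rows thus provide a genuine
filtration inside the non-nested pasts. -/
theorem rowSigma_le_pastSigma {a : ℕ} (ha : 1 ≤ a) (k : ℕ) :
    rowSigma X ((triRow k : ℤ) + 1 - a) ≤ pastSigma X a (triPos k) := by
  refine iSup_comap_mono ?_ X
  rintro q ⟨h1, h2⟩
  refine ⟨⟨le_max_of_le_left ?_, ?_⟩, h2⟩
  · simp only [triPos]
    rw [abs_sub_comm]
    exact le_trans (by omega) (le_abs_self _)
  · rw [Prod.Lex.toLex_le_toLex]
    left
    simp only [triPos]
    omega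

theorem pastSigma_le_rowSigma (a k : ℕ) :
    pastSigma X a (triPos k) ≤ rowSigma X ((triRow k : ℤ) + 1) := by
  refine iSup_comap_mono ?_ X
  rintro q ⟨⟨h1, h3⟩, h2⟩
  refine ⟨?_, h2⟩
  rw [Prod.Lex.toLex_le_toLex] at h3
  simp only [triPos] at h3
  rcases h3 with h | h
  · exact h.le
  · exact h.1.le

variable (Y : ℕ+ × ℕ+ → Ω → ℝ)

theorem measurable_hybrid {𝒢 : MeasurableSpace Ω} (a k : ℕ)
    (hX : ∀ q < k, (a : ℤ) ≤ triDist q k → Measurable[𝒢] (X (triPos q)))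
    (hY : ∀ q, k < q → Measurable[𝒢] (Y (triPosPNat q))) :
    Measurable[𝒢] fun ω => hybrid a (fun q => X (triPos q) ω) (fun q => Y (triPosPNat q) ω) k := by
  refine measurable_pi_iff.2 fun q => ?_
  unfold hybrid
  by_cases h1 : k < q
  · simpa only [h1, if_true] using hY q h1
  · by_cases h2 : q < k ∧ (a : ℤ) ≤ triDist q k
    · simpa only [h1, h2, if_false, and_self, if_true] using hX q h2.1 h2.2
    · simp only [h1, h2, if_false]
      exact measurable_const

theorem measurable_hybrid_pastSigma (a k : ℕ) :
    Measurable[pastSigma X a (triPos k) ⊔ fullSigma Y] fun ω =>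
      hybrid a (fun q => X (triPos q) ω) (fun q => Y (triPosPNat q) ω) k := by
  refine measurable_hybrid X Y a k (fun q hq hd => ?_) fun q _ =>
    (measurable_fullSigma Y _).mono le_sup_right le_rfl
  exact (measurable_iSup_comap (s := {q : ℤ × ℤ | q ∈ pastIndices a (triPos k) ∧ q.2 ≤ q.1})
    ⟨triPos_mem_pastIndices hq hd, triPos_snd_le_fst q⟩).mono le_sup_left le_rfl

end Sigma

/-! ### Terms of the Lindeberg expansion -/

section Terms

variable {Ω : Type*} {m0 : MeasurableSpace Ω} {P : Measure Ω} [IsProbabilityMeasure P]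
  {X : ℤ × ℤ → Ω → ℝ} {Y : ℕ+ × ℕ+ → Ω → ℝ} {K : ℝ} {F : ℕ → (ℕ → ℝ) → ℝ}
  {D₁ D₂ : ℕ → ℕ → (ℕ → ℝ) → ℝ} {τ : ℕ → ℝ}

/-- The coefficient involves the Gaussian entries after `k`, so all of `Y` is adjoined to the past.
Independence keeps the martingale property (`condExp_sup_of_indep`). -/
theorem ae_tendsto_linear_X (hF : SmoothAtScale K F D₁ D₂) (hX : ∀ p, Measurable (X p))
    (hY : ∀ p, Measurable (Y p)) (hind : Indep (fullSigma X) (fullSigma Y) P)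
    (hX2 : ∀ p, MemLp (X p) 2 P)
    (hX0 : ∀ k, P[X (triPos k) | pastSigma X 1 (triPos k)] =ᵐ[P] 0)
    (hXτ : ∀ k m, ∫ ω, truncAbove (truncLevel m) (X (triPos k) ω) ^ 2 ∂P ≤ τ m)
    (hτ : Summable fun n : ℕ => τ (Nat.log 2 n) / n) :
    ∀ᵐ ω ∂P, Tendsto (fun n : ℕ => ∑ k ∈ Finset.range (triSize n), X (triPos k) ω *
      D₁ n k (hybrid 1 (fun q => X (triPos q) ω) (fun q => Y (triPosPNat q) ω) k))
      atTop (𝓝 0) := by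
  refine ae_tendsto_linear_martingale (K := K)
    (𝒢 := fun _ k => pastSigma X 1 (triPos k) ⊔ fullSigma Y)
    (fun n k l hkl => sup_le_sup_right (pastSigma_one_mono X hkl) _)
    (fun n k => sup_le ((iSup_comap_le_fullSigma _ X).trans (fullSigma_le hX)) (fullSigma_le hY))
    (Z := fun _ k => X (triPos k)) (fun n k _ => ?_) (fun n k _ => hX2 _) (fun n k _ => ?_)
    (fun n m k _ => hXτ k m) hτ (fun n k _ => ?_) (fun n k hk ω => hF.bound₁ n k _ hk)
  · have : Measurable[pastSigma X 1 (triPos (k + 1)) ⊔ fullSigma Y] (X (triPos k)) :=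
      (measurable_pastSigma_one X (Nat.lt_add_one k)).mono le_sup_left le_rfl
    exact this.stronglyMeasurable
  · exact (condExp_sup_of_indep (fullSigma_le hX) (fullSigma_le hY)
      (iSup_comap_le_fullSigma _ X) le_rfl hind (measurable_fullSigma X _).stronglyMeasurable
      ((hX2 _).integrable one_le_two)).trans (hX0 k)
  · exact ((hF.measurable₁ n k).comp (measurable_hybrid_pastSigma X Y 1 k)).stronglyMeasurable

/-- Conditioning on all the variables `X` and on the variables `Y` at the other positions in `s`
does not change the mean of a function of `Y` at one position. -/
theorem condExp_fullSigma_sup_eq (hX : ∀ p, Measurable (X p)) (hY : ∀ p, Measurable (Y p))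
    (hind : Indep (fullSigma X) (fullSigma Y) P) (hYind : iIndepFun Y P) {k : ℕ} {s : Set ℕ}
    (hk : k ∉ s) {f : ℝ → ℝ} (hf : Measurable f)
    (hfi : Integrable (fun ω => f (Y (triPosPNat k) ω)) P) :
    P[fun ω => f (Y (triPosPNat k) ω) | (⨆ q ∈ s, MeasurableSpace.comap (Y (triPosPNat q))
      (inferInstance : MeasurableSpace ℝ)) ⊔ fullSigma X] =ᵐ[P]
        fun _ => ∫ ω, f (Y (triPosPNat k) ω) ∂P := by
  have hle : ⨆ q ∈ s, MeasurableSpace.comap (Y (triPosPNat q))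
      (inferInstance : MeasurableSpace ℝ) ≤ fullSigma Y :=
    iSup₂_le fun q _ => (measurable_fullSigma Y _).comap_le
  have h1 := condExp_sup_of_indep (fullSigma_le hY) (fullSigma_le hX) hle le_rfl hind.symm
    (hf.comp (measurable_fullSigma Y (triPosPNat k))).stronglyMeasurable hfi
  refine h1.trans ?_
  have h2 : iIndepFun (fun k => Y (triPosPNat k)) P := hYind.precomp triPosPNat_injective
  have h3 := indep_iSup_of_disjoint (fun q => (hY (triPosPNat q)).comap_le) h2.iIndep
    (S := {k}) (T := s) (Set.disjoint_singleton_left.2 hk)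
  refine condExp_indep_eq (m₁ := ⨆ q ∈ ({k} : Set ℕ), MeasurableSpace.comap (Y (triPosPNat q))
    (inferInstance : MeasurableSpace ℝ)) (iSup₂_le fun q _ => (hY _).comap_le)
    (iSup₂_le fun q _ => (hY _).comap_le) ?_ h3
  exact (hf.comp (measurable_iSup_comap (Z := fun q => Y (triPosPNat q))
    (Set.mem_singleton k))).stronglyMeasurable

/-- The information available when the entries are processed in reverse order. -/
abbrev reverseSigma (X : ℤ × ℤ → Ω → ℝ) (Y : ℕ+ × ℕ+ → Ω → ℝ) (n k : ℕ) : MeasurableSpace Ω :=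
  (⨆ q ∈ {q : ℕ | triSize n ≤ q + k}, MeasurableSpace.comap (Y (triPosPNat q))
      (inferInstance : MeasurableSpace ℝ)) ⊔ fullSigma X

theorem reverseSigma_mono (X : ℤ × ℤ → Ω → ℝ) (Y : ℕ+ × ℕ+ → Ω → ℝ) (n : ℕ) :
    Monotone (reverseSigma X Y n) := by
  intro k l hkl
  refine sup_le_sup_right (iSup_comap_mono (fun q (hq : triSize n ≤ q + k) => ?_) _) _
  exact hq.trans (by omega)

theorem reverseSigma_le (hX : ∀ p, Measurable (X p)) (hY : ∀ p, Measurable (Y p)) (n k : ℕ) :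
    reverseSigma X Y n k ≤ m0 :=
  sup_le (iSup₂_le fun _ _ => (hY _).comap_le) (fullSigma_le hX)

theorem measurable_reverseSigma {n k q : ℕ} (h : triSize n ≤ q + k) :
    Measurable[reverseSigma X Y n k] (Y (triPosPNat q)) :=
  (measurable_iSup_comap (Z := fun q => Y (triPosPNat q))
    (s := {q : ℕ | triSize n ≤ q + k}) h).mono le_sup_left le_rfl

theorem measurable_hybrid_reverseSigma {n k : ℕ} (hk : k < triSize n) :
    Measurable[reverseSigma X Y n k] fun ω => hybrid 1 (fun q => X (triPos q) ω)
      (fun q => Y (triPosPNat q) ω) (triSize n - 1 - k) :=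
  measurable_hybrid X Y 1 _
    (fun q _ _ => (measurable_fullSigma X _).mono le_sup_right le_rfl)
    (fun q hq => measurable_reverseSigma (by omega))

/-- The coefficient at `k` depends on `X` and on the Gaussian entries after `k` only, so the sum is
a martingale when read backwards. At stage k the indices q ≥ `triSize n - k` are revealed, and the
next one is `triSize n - 1 - k`. -/
theorem ae_tendsto_linear_Y (hF : SmoothAtScale K F D₁ D₂) (hX : ∀ p, Measurable (X p))
    (hY : ∀ p, Measurable (Y p)) (hind : Indep (fullSigma X) (fullSigma Y) P)
    (hYind : iIndepFun Y P) (hY2 : ∀ k, MemLp (Y (triPosPNat k)) 2 P)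
    (hY0 : ∀ k, ∫ ω, Y (triPosPNat k) ω ∂P = 0)
    (hYτ : ∀ k m, ∫ ω, truncAbove (truncLevel m) (Y (triPosPNat k) ω) ^ 2 ∂P ≤ τ m)
    (hτ : Summable fun n : ℕ => τ (Nat.log 2 n) / n) :
    ∀ᵐ ω ∂P, Tendsto (fun n : ℕ => ∑ k ∈ Finset.range (triSize n), Y (triPosPNat k) ω *
      D₁ n k (hybrid 1 (fun q => X (triPos q) ω) (fun q => Y (triPosPNat q) ω) k))
      atTop (𝓝 0) := by
  have h := ae_tendsto_linear_martingale (K := K) (reverseSigma_mono X Y) (reverseSigma_le hX hY)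
    (Z := fun n k => Y (triPosPNat (triSize n - 1 - k)))
    (B := fun n k ω => D₁ n (triSize n - 1 - k) (hybrid 1 (fun q => X (triPos q) ω)
      (fun q => Y (triPosPNat q) ω) (triSize n - 1 - k)))
    (fun n k hk => (measurable_reverseSigma (by omega)).stronglyMeasurable) (fun n k _ => hY2 _)
    (fun n k hk => by
      have := condExp_fullSigma_sup_eq hX hY hind hYind (k := triSize n - 1 - k)
        (s := {q : ℕ | triSize n ≤ q + k}) (fun h : triSize n ≤ triSize n - 1 - k + k => by omega) measurable_id
        ((hY2 _).integrable one_le_two)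
      simp only [id, hY0] at this
      exact this)
    (fun n m k _ => hYτ _ m) hτ
    (fun n k hk => ((hF.measurable₁ n _).comp
      (measurable_hybrid_reverseSigma hk)).stronglyMeasurable)
    (fun n k hk ω => hF.bound₁ n _ _ (by omega))
  filter_upwards [h] with ω hω
  refine hω.congr fun n => ?_
  exact Finset.sum_range_reflect (fun k => Y (triPosPNat k) ω *
    D₁ n k (hybrid 1 (fun q => X (triPos q) ω) (fun q => Y (triPosPNat q) ω) k)) (triSize n)

theorem ae_tendsto_quadratic_Y (hF : SmoothAtScale K F D₁ D₂) (hX : ∀ p, Measurable (X p))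
    (hY : ∀ p, Measurable (Y p)) (hind : Indep (fullSigma X) (fullSigma Y) P)
    (hYind : iIndepFun Y P) {s : ℕ → ℝ} {D : ℝ}
    (hY4 : ∀ k, MemLp (fun ω => Y (triPosPNat k) ω ^ 2 - s k ^ 2) 2 P)
    (hY0 : ∀ k, ∫ ω, (Y (triPosPNat k) ω ^ 2 - s k ^ 2) ∂P = 0)
    (hYD : ∀ k, ∫ ω, (Y (triPosPNat k) ω ^ 2 - s k ^ 2) ^ 2 ∂P ≤ D) :
    ∀ᵐ ω ∂P, Tendsto (fun n : ℕ => ∑ k ∈ Finset.range (triSize n),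
      (Y (triPosPNat k) ω ^ 2 - s k ^ 2) *
      D₂ n k (hybrid 1 (fun q => X (triPos q) ω) (fun q => Y (triPosPNat q) ω) k))
      atTop (𝓝 0) := by
  have hpoly : ∀ k, Measurable fun t : ℝ => t ^ 2 - s k ^ 2 := fun k => by fun_prop
  have h := ae_tendsto_quadratic_martingale (K := K) (D := D)
    (reverseSigma_mono X Y) (reverseSigma_le hX hY)
    (Z := fun n k ω => Y (triPosPNat (triSize n - 1 - k)) ω ^ 2 - s (triSize n - 1 - k) ^ 2)
    (B := fun n k ω => D₂ n (triSize n - 1 - k) (hybrid 1 (fun q => X (triPos q) ω)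
      (fun q => Y (triPosPNat q) ω) (triSize n - 1 - k)))
    (fun n k hk => ((hpoly _).comp
      (measurable_reverseSigma (by omega))).stronglyMeasurable) (fun n k _ => hY4 _)
    (fun n k hk => by
      have := condExp_fullSigma_sup_eq hX hY hind hYind (k := triSize n - 1 - k)
        (s := {q : ℕ | triSize n ≤ q + k}) (fun h : triSize n ≤ triSize n - 1 - k + k => by omega) (hpoly _)
        ((hY4 _).integrable one_le_two)
      simp only [hY0] at this
      exact this)
    (fun n k _ => hYD _)
    (fun n k hk => ((hF.measurable₂ n _).comp
      (measurable_hybrid_reverseSigma hk)).stronglyMeasurable)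
    (fun n k hk ω => hF.bound₂ n _ _ (by omega))
  filter_upwards [h] with ω hω
  refine hω.congr fun n => ?_
  exact Finset.sum_range_reflect (fun k => (Y (triPosPNat k) ω ^ 2 - s k ^ 2) *
    D₂ n k (hybrid 1 (fun q => X (triPos q) ω) (fun q => Y (triPosPNat q) ω) k)) (triSize n)

/-- With the entries near `k` deleted, the coefficient is measurable for the past at distance `a`
joined with `Y`, so each product is centered given that information. Since these pasts are not a
filtration, the products are summed over rows and treated as a martingale with a lag of `a` rows. -/
theorem ae_tendsto_quadratic_X_centered (hF : SmoothAtScale K F D₁ D₂) (hX : ∀ p, Measurable (X p))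
    (hY : ∀ p, Measurable (Y p)) (hind : Indep (fullSigma X) (fullSigma Y) P) {a : ℕ}
    (ha : 1 ≤ a) :
    ∀ᵐ ω ∂P, Tendsto (fun n : ℕ => ∑ k ∈ Finset.range (triSize n),
      (truncBelow (truncLevel (Nat.log 2 n)) (X (triPos k) ω) ^ 2 -
        (P[fun ω' => truncBelow (truncLevel (Nat.log 2 n)) (X (triPos k) ω') ^ 2 |
          pastSigma X a (triPos k)]) ω) *
      D₂ n k (hybrid a (fun q => X (triPos q) ω) (fun q => Y (triPosPNat q) ω) k))
      atTop (𝓝 0) := by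
  set ℓ : ℕ → ℝ := fun n => truncLevel (Nat.log 2 n) with hℓ
  have hℓ1 : ∀ n, 1 ≤ ℓ n := fun n => one_le_truncLevel _
  set W : ℕ → ℕ → Ω → ℝ := fun n k ω => truncBelow (ℓ n) (X (triPos k) ω) ^ 2 with hW
  set B : ℕ → ℕ → Ω → ℝ := fun n k ω =>
    D₂ n k (hybrid a (fun q => X (triPos q) ω) (fun q => Y (triPosPNat q) ω) k) with hB
  set W₀ : ℕ → ℕ → Ω → ℝ := fun n k => W n k - P[W n k | pastSigma X a (triPos k)] with hW₀
  set D : ℕ → ℕ → Ω → ℝ := fun n k => B n k * W₀ n k with hD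
  have hK := hF.nonneg
  have hXle := fullSigma_le hX
  have hYle := fullSigma_le hY
  have hpast : ∀ k, pastSigma X a (triPos k) ≤ fullSigma X := fun k => iSup_comap_le_fullSigma _ X
  have hbig : ∀ k, pastSigma X a (triPos k) ⊔ fullSigma Y ≤ m0 := fun k =>
    sup_le ((hpast k).trans hXle) hYle
  have hrow : ∀ k, pastSigma X a (triPos k) ⊔ fullSigma Y ≤
      rowSigma X ((triRow k : ℤ) + 1) ⊔ fullSigma Y := fun k =>
    sup_le_sup_right (pastSigma_le_rowSigma X a k) _
  have hrowle : ∀ i, rowSigma X i ⊔ fullSigma Y ≤ m0 := fun i =>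
    sup_le ((iSup_comap_le_fullSigma _ X).trans hXle) hYle
  have hXrow : ∀ k, Measurable[rowSigma X ((triRow k : ℤ) + 1)] (X (triPos k)) := fun k =>
    measurable_iSup_comap (s := {q : ℤ × ℤ | q.1 ≤ (triRow k : ℤ) + 1 ∧ q.2 ≤ q.1})
      ⟨le_rfl, triPos_snd_le_fst k⟩
  have hWfun : ∀ n, Measurable fun t : ℝ => truncBelow (ℓ n) t ^ 2 := fun n =>
    (measurable_truncBelow _).pow_const 2
  have hWb : ∀ n k ω, |W n k ω| ≤ ℓ n ^ 2 := fun n k ω => by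
    rw [hW]
    simp only
    rw [abs_pow]
    exact pow_le_pow_left₀ (abs_nonneg _) (abs_truncBelow_le (zero_le_one.trans (hℓ1 n)) _) 2
  have hWi : ∀ n k, Integrable (W n k) P := fun n k =>
    integrable_of_ae_abs_le ((hWfun n).comp (hX _)).aestronglyMeasurable
      (ae_of_all _ (hWb n k))
  have hBm : ∀ n k, StronglyMeasurable[pastSigma X a (triPos k) ⊔ fullSigma Y] (B n k) :=
    fun n k => ((hF.measurable₂ n k).comp (measurable_hybrid_pastSigma X Y a k)).stronglyMeasurable
  have hBb : ∀ n k, k < triSize n → ∀ ω, |B n k ω| ≤ K / n ^ 2 := fun n k hk ω =>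
    hF.bound₂ n k _ hk
  have hcm : ∀ n k, StronglyMeasurable[pastSigma X a (triPos k) ⊔ fullSigma Y]
      (P[W n k | pastSigma X a (triPos k)]) := fun n k =>
    stronglyMeasurable_condExp.mono le_sup_left
  have hW₀b : ∀ n k, ∀ᵐ ω ∂P, |W₀ n k ω| ≤ 2 * ℓ n ^ 2 := fun n k => by
    filter_upwards [ae_bdd_abs_condExp_of_ae_bdd_abs (m := pastSigma X a (triPos k))
      (ae_of_all P (hWb n k))] with ω h1
    refine (abs_sub _ _).trans ?_
    have := hWb n k ω
    linarith
  have hDm : ∀ n k, StronglyMeasurable[rowSigma X ((triRow k : ℤ) + 1) ⊔ fullSigma Y] (D n k) := by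
    intro n k
    refine ((hBm n k).mono (hrow k)).mul (StronglyMeasurable.sub ?_ ((hcm n k).mono (hrow k)))
    have : Measurable[rowSigma X ((triRow k : ℤ) + 1) ⊔ fullSigma Y] (X (triPos k)) :=
      (hXrow k).mono le_sup_left le_rfl
    exact ((hWfun n).comp this).stronglyMeasurable
  have hDb : ∀ n k, k < triSize n → ∀ᵐ ω ∂P, |D n k ω| ≤ K / n ^ 2 * (2 * ℓ n ^ 2) := by
    intro n k hk
    filter_upwards [hW₀b n k] with ω h1
    rw [hD]
    simp only [Pi.mul_apply]
    rw [abs_mul]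
    exact mul_le_mul (hBb n k hk ω) h1 (abs_nonneg _) (by positivity)
  have hDi : ∀ n k, k < triSize n → Integrable (D n k) P := fun n k hk =>
    integrable_of_ae_abs_le ((hDm n k).mono (hrowle _)).aestronglyMeasurable (hDb n k hk)
  have hW₀0 : ∀ n k, P[W₀ n k | pastSigma X a (triPos k) ⊔ fullSigma Y] =ᵐ[P] 0 := by
    intro n k
    have h1 := condExp_sup_of_indep hXle hYle (hpast k) le_rfl hind
      ((hWfun n).comp (measurable_fullSigma X (triPos k))).stronglyMeasurable (hWi n k)
    have h2 := condExp_sub (hWi n k)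
      (integrable_condExp (f := W n k) (m := pastSigma X a (triPos k)) (μ := P))
      (pastSigma X a (triPos k) ⊔ fullSigma Y)
    rw [condExp_of_stronglyMeasurable (hbig k) (hcm n k) integrable_condExp] at h2
    filter_upwards [h1, h2] with ω h1 h2
    rw [hW₀]
    simp only
    rw [h2, Pi.sub_apply]
    exact sub_eq_zero.2 h1
  -- The tower property passes from the past at distance `a` to the smaller sigma-algebra of rows at
  -- least `a` earlier.
  have hD0 : ∀ n k, k < triSize n →
      P[D n k | rowSigma X ((triRow k : ℤ) + 1 - a) ⊔ fullSigma Y] =ᵐ[P] 0 := by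
    intro n k hk
    have h1 := condExp_mul_eq_zero (hBm n k)
      (integrable_of_ae_abs_le ((hWi n k).1.sub integrable_condExp.1) (hW₀b n k))
      (hDi n k hk) (hW₀0 n k)
    have h2 := condExp_condExp_of_le (f := D n k) (μ := P)
      (sup_le_sup_right (rowSigma_le_pastSigma X ha k) (fullSigma Y)) (hbig k)
    have h3 := condExp_congr_ae (m := rowSigma X ((triRow k : ℤ) + 1 - a) ⊔ fullSigma Y) h1
    refine h2.symm.trans (h3.trans ?_)
    rw [condExp_zero]
  have hidx : ∀ {n i j : ℕ}, i < n → j ∈ Finset.range (i + 1) → triSize i + j < triSize n := by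
    intro n i j hi hj
    rw [← triRow_lt_iff, triRow_eq (Nat.lt_succ_iff.1 (Finset.mem_range.1 hj))]
    exact hi
  have hrowidx : ∀ {i j : ℕ}, j ∈ Finset.range (i + 1) → triRow (triSize i + j) = i := by
    intro i j hj
    exact triRow_eq (Nat.lt_succ_iff.1 (Finset.mem_range.1 hj))
  have main := ae_tendsto_lagged_martingale (P := P)
    (𝓡 := fun i => rowSigma X i ⊔ fullSigma Y)
    (fun i j hij => sup_le_sup_right (rowSigma_mono X hij) _) hrowle a
    (R := fun n i => ∑ j ∈ Finset.range (i + 1), D n (triSize i + j))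
    -- A row has at most n entries, each contributing at most 2Kℓ²/n².
    (c := fun n => 2 * K * ℓ n ^ 2 / n)
    (fun n i hi => by
      refine Finset.stronglyMeasurable_sum _ fun j hj => ?_
      have := hDm n (triSize i + j)
      rwa [hrowidx hj] at this)
    (fun n i hi => by
      have hall : ∀ᵐ ω ∂P, ∀ j, j ∈ Finset.range (i + 1) →
          |D n (triSize i + j) ω| ≤ K / n ^ 2 * (2 * ℓ n ^ 2) := by
        refine ae_all_iff.2 fun j => ?_
        by_cases hj : j ∈ Finset.range (i + 1)
        · filter_upwards [hDb n _ (hidx hi hj)] with ω h _ using h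
        · exact ae_of_all _ fun ω h => absurd h hj
      filter_upwards [hall] with ω hω
      rw [Finset.sum_apply]
      refine (Finset.abs_sum_le_sum_abs _ _).trans ((Finset.sum_le_sum hω).trans ?_)
      rw [Finset.sum_const, Finset.card_range, nsmul_eq_mul]
      have hn : (0 : ℝ) < n := by exact_mod_cast (Nat.zero_le i).trans_lt hi
      have hin : ((i + 1 : ℕ) : ℝ) ≤ n := by exact_mod_cast hi
      calc ((i + 1 : ℕ) : ℝ) * (K / n ^ 2 * (2 * ℓ n ^ 2))
          ≤ n * (K / n ^ 2 * (2 * ℓ n ^ 2)) := by gcongr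
        _ = 2 * K * ℓ n ^ 2 / n := by field_simp)
    (fun n i hi => by
      have h1 := condExp_finsetSum (μ := P) (s := Finset.range (i + 1))
        (f := fun j => D n (triSize i + j)) (fun j hj => hDi n _ (hidx hi hj))
        (rowSigma X ((i : ℤ) + 1 - a) ⊔ fullSigma Y)
      have h2 : ∀ᵐ ω ∂P, ∀ j, j ∈ Finset.range (i + 1) →
          (P[D n (triSize i + j) | rowSigma X ((i : ℤ) + 1 - a) ⊔ fullSigma Y]) ω = 0 := by
        refine ae_all_iff.2 fun j => ?_
        by_cases hj : j ∈ Finset.range (i + 1)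
        · have := hD0 n _ (hidx hi hj)
          rw [hrowidx hj] at this
          filter_upwards [this] with ω h _ using h
        · exact ae_of_all _ fun ω h => absurd h hj
      filter_upwards [h1, h2] with ω h1 h2
      rw [h1, Finset.sum_apply, Finset.sum_eq_zero h2, Pi.zero_apply])
    (by
      refine Summable.of_nonneg_of_le (fun n => by positivity) (fun n => ?_)
        ((Real.summable_one_div_nat_rpow (p := 3 / 2)).2 (by norm_num) |>.mul_left (1024 * K ^ 4))
      rcases Nat.eq_zero_or_pos n with rfl | hn
      · simp
      have hn' : (0 : ℝ) < n := by exact_mod_cast hn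
      have e1 : (n : ℝ) ^ (3 / 2 : ℝ) = n * √n := by
        rw [Real.sqrt_eq_rpow, ← Real.rpow_one_add' hn'.le (by norm_num)]
        norm_num
      -- The fourth power of the row bound contains ℓ⁸; keeping it below √n is what dictates the
      -- exponent 1/16 of the truncation level.
      have e2 : ℓ n ^ 8 ≤ √n := truncLevel_log_pow_le hn.ne'
      have hs : 0 < √(n : ℝ) := Real.sqrt_pos.2 hn'
      have e4 : √(n : ℝ) ^ 2 = n := Real.sq_sqrt hn'.le
      rw [e1]
      calc 4 * (n : ℝ) ^ 2 * (2 * (2 * K * ℓ n ^ 2 / n)) ^ 4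
          = 1024 * K ^ 4 * ℓ n ^ 8 * (1 / n ^ 2) := by field_simp; ring
        _ ≤ 1024 * K ^ 4 * √n * (1 / n ^ 2) := by gcongr
        _ = 1024 * K ^ 4 * (1 / (n * √n)) := by
            rw [mul_assoc]
            congr 1
            field_simp
            exact e4)
  filter_upwards [main] with ω hω
  refine hω.congr fun n => ?_
  rw [sum_range_triSize]
  refine Finset.sum_congr rfl fun i _ => ?_
  rw [Finset.sum_apply]
  refine Finset.sum_congr rfl fun j _ => ?_
  exact mul_comm _ _

end Terms

/-! ### The quadratic term in `X` and the assembled comparison. -/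

theorem ae_tendsto_tailAverage {Ω : Type*} {m0 : MeasurableSpace Ω} {P : Measure Ω} {τ : ℕ → ℝ}
    {Z : ℕ → Ω → ℝ} (hZ2 : ∀ k, MemLp (Z k) 2 P)
    (hZτ : ∀ k m, ∫ ω, truncAbove (truncLevel m) (Z k ω) ^ 2 ∂P ≤ τ m) (hτ : Summable τ) :
    ∀ᵐ ω ∂P, Tendsto (fun n : ℕ => tailAverage (truncLevel (Nat.log 2 n)) (fun k => Z k ω) n)
      atTop (𝓝 0) :=
  ae_tendsto_dyadic_average (V := fun k m ω => truncAbove (truncLevel m) (Z k ω) ^ 2)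
    (fun _ _ => ae_of_all _ fun _ => sq_nonneg _)
    (fun k _ => (memLp_truncAbove (hZ2 k) _).integrable_sq) hZτ hτ

section Main

variable {Ω : Type*} {m0 : MeasurableSpace Ω} {P : Measure Ω} [IsProbabilityMeasure P]
  {X : ℤ × ℤ → Ω → ℝ} {Y : ℕ+ × ℕ+ → Ω → ℝ} {K : ℝ} {F : ℕ → (ℕ → ℝ) → ℝ}
  {D₁ D₂ : ℕ → ℕ → (ℕ → ℝ) → ℝ} {τ : ℕ → ℝ}

/-- Conditioning preserves nonnegativity and means, so the dyadic argument applies unchanged. -/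
theorem ae_tendsto_condExp_tailAverage {Z : ℕ → Ω → ℝ}
    (hZτ : ∀ k m, ∫ ω, truncAbove (truncLevel m) (Z k ω) ^ 2 ∂P ≤ τ m) (hτ : Summable τ)
    {𝒢 : ℕ → MeasurableSpace Ω} (h𝒢 : ∀ k, 𝒢 k ≤ m0) :
    ∀ᵐ ω ∂P, Tendsto (fun n : ℕ => (∑ k ∈ Finset.range (triSize n),
      (P[fun ω' => truncAbove (truncLevel (Nat.log 2 n)) (Z k ω') ^ 2 | 𝒢 k]) ω) / (n : ℝ) ^ 2)
      atTop (𝓝 0) :=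
  ae_tendsto_dyadic_average
    (V := fun k m => P[fun ω' => truncAbove (truncLevel m) (Z k ω') ^ 2 | 𝒢 k])
    (fun _ _ => condExp_nonneg (ae_of_all _ fun _ => sq_nonneg _))
    (fun _ _ => integrable_condExp)
    (fun k m => (integral_condExp (h𝒢 k)).le.trans (hZτ k m)) hτ

theorem SmoothAtScale.abs_sum_mul_le (hF : SmoothAtScale K F D₁ D₂) (n : ℕ) (w : ℕ → ℝ)
    (A : ℕ → ℕ → ℝ) :
    |∑ k ∈ Finset.range (triSize n), w k * D₂ n k (A k)| ≤
      K * ((∑ k ∈ Finset.range (triSize n), |w k|) / n ^ 2) := by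
  refine (Finset.abs_sum_le_sum_abs _ _).trans ?_
  rw [Finset.sum_div, Finset.mul_sum]
  refine Finset.sum_le_sum fun k hk => ?_
  rw [abs_mul]
  refine (mul_le_mul_of_nonneg_left (hF.bound₂ n k _ (Finset.mem_range.1 hk))
    (abs_nonneg _)).trans (le_of_eq ?_)
  ring

theorem ae_tendsto_quadratic_X (hF : SmoothAtScale K F D₁ D₂) (hX : ∀ p, Measurable (X p))
    (hY : ∀ p, Measurable (Y p)) (hind : Indep (fullSigma X) (fullSigma Y) P)
    (hX2 : ∀ p, MemLp (X p) 2 P)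
    (hXτ : ∀ k m, ∫ ω, truncAbove (truncLevel m) (X (triPos k) ω) ^ 2 ∂P ≤ τ m)
    (hτ : Summable τ) {s : ℕ → ℝ} {C : ℝ} (hs : ∀ k, s k ^ 2 ≤ C)
    (hmix : ∀ᵐ ω ∂P, ∀ ε : ℝ, 0 < ε → ∃ a : ℕ, 1 ≤ a ∧ ∀ᶠ n : ℕ in atTop,
      (∑ k ∈ Finset.range (triSize n), |(P[fun ω' => X (triPos k) ω' ^ 2 - s k ^ 2 |
        pastSigma X a (triPos k)]) ω|) / (n : ℝ) ^ 2 < ε) :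
    ∀ᵐ ω ∂P, Tendsto (fun n : ℕ => ∑ k ∈ Finset.range (triSize n),
      (X (triPos k) ω ^ 2 - s k ^ 2) *
      D₂ n k (hybrid 1 (fun q => X (triPos q) ω) (fun q => Y (triPosPNat q) ω) k))
      atTop (𝓝 0) := by
  have hK := hF.nonneg
  have hC : 0 ≤ C := (sq_nonneg _).trans (hs 0)
  have hpast : ∀ a k, pastSigma X a (triPos k) ≤ m0 := fun a k =>
    (iSup_comap_le_fullSigma _ X).trans (fullSigma_le hX)
  -- Null sets are discarded for all `a`, n and k at once, because `a` will be chosen depending on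
  -- the outcome.
  have hcond : ∀ᵐ ω ∂P, ∀ a n k : ℕ,
      (P[fun ω' => truncBelow (truncLevel (Nat.log 2 n)) (X (triPos k) ω') ^ 2 |
          pastSigma X a (triPos k)]) ω =
        (P[fun ω' => X (triPos k) ω' ^ 2 - s k ^ 2 | pastSigma X a (triPos k)]) ω + s k ^ 2 -
        (P[fun ω' => truncAbove (truncLevel (Nat.log 2 n)) (X (triPos k) ω') ^ 2 |
          pastSigma X a (triPos k)]) ω := by
    refine ae_all_iff.2 fun a => ae_all_iff.2 fun n => ae_all_iff.2 fun k => ?_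
    set u : Ω → ℝ := fun ω' => X (triPos k) ω' ^ 2 - s k ^ 2
    set c : Ω → ℝ := fun _ => s k ^ 2
    set t : Ω → ℝ := fun ω' => truncAbove (truncLevel (Nat.log 2 n)) (X (triPos k) ω') ^ 2
    have hu : Integrable u P := (hX2 _).integrable_sq.sub (integrable_const _)
    have hc : Integrable c P := integrable_const _
    have ht : Integrable t P := (memLp_truncAbove (hX2 _) _).integrable_sq
    have e : (fun ω' => truncBelow (truncLevel (Nat.log 2 n)) (X (triPos k) ω') ^ 2) =
        u + c - t := by
      funext ω'
      have := sq_truncBelow_add_sq_truncAbove (truncLevel (Nat.log 2 n)) (X (triPos k) ω')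
      simp only [u, c, t, Pi.sub_apply, Pi.add_apply]
      linarith
    rw [e]
    have hcc : P[c | pastSigma X a (triPos k)] = c := condExp_const (hpast a k) _
    filter_upwards [condExp_sub (hu.add hc) ht (pastSigma X a (triPos k)),
      condExp_add hu hc (pastSigma X a (triPos k))] with ω h1 h2
    rw [h1, Pi.sub_apply, h2, Pi.add_apply, hcc]
  have hctail := ae_all_iff.2 fun a : ℕ => ae_tendsto_condExp_tailAverage (P := P)
    hXτ hτ (fun k => hpast a k)
  have hcnn : ∀ᵐ ω ∂P, ∀ a n k : ℕ,
      0 ≤ (P[fun ω' => truncAbove (truncLevel (Nat.log 2 n)) (X (triPos k) ω') ^ 2 |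
          pastSigma X a (triPos k)]) ω :=
    ae_all_iff.2 fun a => ae_all_iff.2 fun n => ae_all_iff.2 fun k =>
      condExp_nonneg (ae_of_all _ fun _ => sq_nonneg _)
  have hcent : ∀ᵐ ω ∂P, ∀ a : ℕ, 1 ≤ a → Tendsto (fun n : ℕ => ∑ k ∈ Finset.range (triSize n),
      (truncBelow (truncLevel (Nat.log 2 n)) (X (triPos k) ω) ^ 2 -
        (P[fun ω' => truncBelow (truncLevel (Nat.log 2 n)) (X (triPos k) ω') ^ 2 |
          pastSigma X a (triPos k)]) ω) *
      D₂ n k (hybrid a (fun q => X (triPos q) ω) (fun q => Y (triPosPNat q) ω) k))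
      atTop (𝓝 0) := by
    refine ae_all_iff.2 fun a => ?_
    by_cases ha : 1 ≤ a
    · filter_upwards [ae_tendsto_quadratic_X_centered hF hX hY hind ha] with ω h _ using h
    · exact ae_of_all _ fun ω h => absurd h ha
  filter_upwards [hmix, hcond, hctail, hcnn, hcent,
    ae_tendsto_tailAverage (P := P) (fun k => hX2 (triPos k)) hXτ hτ] with ω hmix hcond hctail
      hcnn hcent htail
  set x : ℕ → ℝ := fun q => X (triPos q) ω
  set y : ℕ → ℝ := fun q => Y (triPosPNat q) ω
  set ℓ : ℕ → ℝ := fun n => truncLevel (Nat.log 2 n) with hℓ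
  have hℓ1 : ∀ n, 1 ≤ ℓ n := fun n => one_le_truncLevel _
  rw [Metric.tendsto_atTop']
  intro ε hε
  -- `K + 1` replaces `K` in the denominator because `K` may vanish.
  obtain ⟨a, ha, hQ⟩ := hmix (ε / (2 * (K + 1))) (by positivity)
  set Q : ℕ → ℝ := fun n => (∑ k ∈ Finset.range (triSize n),
    |(P[fun ω' => X (triPos k) ω' ^ 2 - s k ^ 2 | pastSigma X a (triPos k)]) ω|) / (n : ℝ) ^ 2
    with hQdef
  set T : ℕ → ℝ := fun n => (∑ k ∈ Finset.range (triSize n),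
      (P[fun ω' => truncAbove (ℓ n) (X (triPos k) ω') ^ 2 | pastSigma X a (triPos k)]) ω) /
        (n : ℝ) ^ 2 with hT
  set M : ℕ → ℝ := fun n => ∑ k ∈ Finset.range (triSize n),
      (truncBelow (ℓ n) (x k) ^ 2 -
        (P[fun ω' => truncBelow (ℓ n) (X (triPos k) ω') ^ 2 | pastSigma X a (triPos k)]) ω) *
      D₂ n k (hybrid a x y k) with hM
  set small : ℕ → ℝ := fun n => K * tailAverage (ℓ n) x n +
    (1 + C) * K * (2 * a) ^ 2 * (ℓ n ^ 3 / √n + tailAverage (ℓ n) x n) + |M n| + K * T n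
    with hsmall
  have hsmall0 : Tendsto small atTop (𝓝 0) := by
    have h1 := (((htail.const_mul K).add
      ((tendsto_truncLevel_cube_div_sqrt.add htail).const_mul ((1 + C) * K * (2 * a) ^ 2))).add
      (hcent a ha).abs).add ((hctail a).const_mul K)
    simpa using h1
  have hbound : ∀ n, |∑ k ∈ Finset.range (triSize n),
      (x k ^ 2 - s k ^ 2) * D₂ n k (hybrid 1 x y k)| ≤ small n + K * Q n := by
    intro n
    -- The five sums are: the tail square; the cost of deleting nearby entries, paid with the
    -- bounded truncated square; the centered lagged martingale; the conditional variance defect of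
    -- the hypothesis; and the conditional tail created by truncation. For fixed `a` only the fourth
    -- need not vanish.
    have hdec : ∑ k ∈ Finset.range (triSize n), (x k ^ 2 - s k ^ 2) * D₂ n k (hybrid 1 x y k) =
        ∑ k ∈ Finset.range (triSize n), truncAbove (ℓ n) (x k) ^ 2 * D₂ n k (hybrid 1 x y k) +
        ∑ k ∈ Finset.range (triSize n), (truncBelow (ℓ n) (x k) ^ 2 - s k ^ 2) *
          (D₂ n k (hybrid 1 x y k) - D₂ n k (hybrid a x y k)) + M n +
        ∑ k ∈ Finset.range (triSize n), (P[fun ω' => X (triPos k) ω' ^ 2 - s k ^ 2 |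
          pastSigma X a (triPos k)]) ω * D₂ n k (hybrid a x y k) -
        ∑ k ∈ Finset.range (triSize n), (P[fun ω' => truncAbove (ℓ n) (X (triPos k) ω') ^ 2 |
          pastSigma X a (triPos k)]) ω * D₂ n k (hybrid a x y k) := by
      rw [hM]
      simp only
      rw [← Finset.sum_add_distrib, ← Finset.sum_add_distrib, ← Finset.sum_add_distrib,
        ← Finset.sum_sub_distrib]
      refine Finset.sum_congr rfl fun k _ => ?_
      rw [hcond a n k, ← sq_truncBelow_add_sq_truncAbove (ℓ n) (x k)]
      ring
    have b1 := hF.abs_sum_mul_le n (fun k => truncAbove (ℓ n) (x k) ^ 2) (hybrid 1 x y)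
    have b2 := hF.abs_sum_mul_hybrid_sub_le (hℓ1 n) a n x y
      (fun k => truncBelow (ℓ n) (x k) ^ 2 - s k ^ 2) (M := 1 + C) (fun k _ => by
        have h1 : truncBelow (ℓ n) (x k) ^ 2 ≤ ℓ n ^ 2 := by
          rw [← sq_abs]
          exact pow_le_pow_left₀ (abs_nonneg _)
            (abs_truncBelow_le (zero_le_one.trans (hℓ1 n)) _) 2
        have h2 := hs k
        have h3 : 1 ≤ ℓ n ^ 2 := one_le_pow₀ (hℓ1 n)
        have h4 : C ≤ C * ℓ n ^ 2 := le_mul_of_one_le_right hC h3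
        rw [abs_le]
        constructor <;> nlinarith [sq_nonneg (truncBelow (ℓ n) (x k)), sq_nonneg (s k)])
      (by positivity)
    have b3 := hF.abs_sum_mul_le n (fun k => (P[fun ω' => X (triPos k) ω' ^ 2 - s k ^ 2 |
          pastSigma X a (triPos k)]) ω) (hybrid a x y)
    have b4 := hF.abs_sum_mul_le n (fun k => (P[fun ω' => truncAbove (ℓ n) (X (triPos k) ω') ^ 2 |
          pastSigma X a (triPos k)]) ω) (hybrid a x y)
    have e4 : ∑ k ∈ Finset.range (triSize n), |(P[fun ω' =>
        truncAbove (ℓ n) (X (triPos k) ω') ^ 2 | pastSigma X a (triPos k)]) ω| =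
        ∑ k ∈ Finset.range (triSize n), (P[fun ω' =>
          truncAbove (ℓ n) (X (triPos k) ω') ^ 2 | pastSigma X a (triPos k)]) ω :=
      Finset.sum_congr rfl fun k _ => abs_of_nonneg (hcnn a n k)
    simp only [abs_of_nonneg (sq_nonneg (truncAbove (ℓ n) _))] at b1
    simp only [e4] at b4
    rw [hdec]
    refine (abs_sub _ _).trans ?_
    refine (add_le_add (abs_add_le _ _) le_rfl).trans ?_
    refine (add_le_add (add_le_add (abs_add_le _ _) le_rfl) le_rfl).trans ?_
    refine (add_le_add (add_le_add (add_le_add (abs_add_le _ _) le_rfl) le_rfl) le_rfl).trans ?_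
    simp only [hsmall, hQdef, hT]
    rw [← tailAverage] at b1
    linarith
  have h1 : ∀ᶠ n in atTop, small n < ε / 2 := hsmall0.eventually_lt_const (by positivity)
  obtain ⟨N, hN⟩ := eventually_atTop.1 (h1.and hQ)
  refine ⟨N, fun n hn => ?_⟩
  rw [Real.dist_0_eq_abs]
  obtain ⟨h2, h3⟩ := hN n hn.le
  have h4 : K * Q n ≤ ε / 2 := by
    have h5 : K * Q n ≤ (K + 1) * (ε / (2 * (K + 1))) :=
      mul_le_mul (by linarith) h3.le (by positivity) (by linarith)
    refine h5.trans (le_of_eq ?_)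
    field_simp
  linarith [hbound n]

theorem ae_tendsto_of_smoothAtScale (hF : SmoothAtScale K F D₁ D₂) (hX : ∀ p, Measurable (X p))
    (hY : ∀ p, Measurable (Y p)) (hind : Indep (fullSigma X) (fullSigma Y) P)
    (hX2 : ∀ p, MemLp (X p) 2 P)
    (hX0 : ∀ k, P[X (triPos k) | pastSigma X 1 (triPos k)] =ᵐ[P] 0)
    (hXτ : ∀ k m, ∫ ω, truncAbove (truncLevel m) (X (triPos k) ω) ^ 2 ∂P ≤ τ m)
    (hτ : Summable τ) (hτ' : Summable fun n : ℕ => τ (Nat.log 2 n) / n)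
    {s : ℕ → ℝ} {C : ℝ} (hs : ∀ k, s k ^ 2 ≤ C)
    (hmix : ∀ᵐ ω ∂P, ∀ ε : ℝ, 0 < ε → ∃ a : ℕ, 1 ≤ a ∧ ∀ᶠ n : ℕ in atTop,
      (∑ k ∈ Finset.range (triSize n), |(P[fun ω' => X (triPos k) ω' ^ 2 - s k ^ 2 |
        pastSigma X a (triPos k)]) ω|) / (n : ℝ) ^ 2 < ε)
    (hYind : iIndepFun Y P) (hY2 : ∀ k, MemLp (Y (triPosPNat k)) 2 P)
    (hY0 : ∀ k, ∫ ω, Y (triPosPNat k) ω ∂P = 0)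
    (hYτ : ∀ k m, ∫ ω, truncAbove (truncLevel m) (Y (triPosPNat k) ω) ^ 2 ∂P ≤ τ m) {D : ℝ}
    (hY4 : ∀ k, MemLp (fun ω => Y (triPosPNat k) ω ^ 2 - s k ^ 2) 2 P)
    (hYs : ∀ k, ∫ ω, (Y (triPosPNat k) ω ^ 2 - s k ^ 2) ∂P = 0)
    (hYD : ∀ k, ∫ ω, (Y (triPosPNat k) ω ^ 2 - s k ^ 2) ^ 2 ∂P ≤ D) :
    ∀ᵐ ω ∂P, Tendsto (fun n : ℕ =>
      F n (fun k => X (triPos k) ω) - F n (fun k => Y (triPosPNat k) ω)) atTop (𝓝 0) := by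
  filter_upwards [ae_tendsto_linear_X hF hX hY hind hX2 hX0 hXτ hτ',
    ae_tendsto_linear_Y hF hX hY hind hYind hY2 hY0 hYτ hτ',
    ae_tendsto_quadratic_X hF hX hY hind hX2 hXτ hτ hs hmix,
    ae_tendsto_quadratic_Y hF hX hY hind hYind hY4 hYs hYD,
    ae_tendsto_tailAverage (P := P) (fun k => hX2 (triPos k)) hXτ hτ,
    ae_tendsto_tailAverage (P := P) hY2 hYτ hτ] with ω h1 h2 h3 h4 h5 h6
  refine squeeze_zero_norm (fun n => hF.abs_sub_le (truncLevel (Nat.log 2 n)) n _ _ s) ?_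
  have h7 := (h1.abs.add h2.abs).add h3.abs |>.add h4.abs |>.add
    ((((tendsto_truncLevel_cube_div_sqrt.const_mul 2).add h5).add h6).const_mul K)
  simp only [abs_zero, mul_zero, add_zero] at h7
  refine h7.congr fun n => ?_
  rw [abs_of_nonneg (zero_le_one.trans (one_le_truncLevel (Nat.log 2 n)))]

end Main

/-! ### Gaussian moments -/

/-- Scaling from the standard Gaussian covers the degenerate case and gives a bound uniform in the
variance; the value of the standard fourth moment is immaterial. -/
theorem integral_pow_four_gaussianReal (s : ℝ≥0) :
    ∫ x, x ^ 4 ∂(gaussianReal 0 (s ^ 2)) = (s : ℝ) ^ 4 * ∫ x, x ^ 4 ∂(gaussianReal 0 1) := by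
  have h := gaussianReal_map_const_mul (μ := 0) (v := 1) (s : ℝ)
  have hv : NNReal.mk ((s : ℝ) ^ 2) (sq_nonneg _) * 1 = s ^ 2 := by
    rw [mul_one]
    exact NNReal.eq (NNReal.coe_pow s 2).symm
  rw [mul_zero, hv] at h
  rw [← h, integral_map (by fun_prop) (by fun_prop), ← integral_const_mul]
  congr 1
  ext x
  ring

section Gaussian

variable {Ω : Type*} {m0 : MeasurableSpace Ω} {P : Measure Ω} {Y : Ω → ℝ}
  {s : ℝ≥0}

theorem memLp_of_map_eq_gaussianReal (hY : Measurable Y)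
    (h : P.map Y = gaussianReal 0 (s ^ 2)) (p : ℝ≥0) : MemLp Y p P := by
  have := memLp_id_gaussianReal (μ := 0) (v := s ^ 2) p
  rw [← h, memLp_map_measure_iff aestronglyMeasurable_id hY.aemeasurable] at this
  exact this

theorem integral_of_map_eq_gaussianReal (hY : Measurable Y)
    (h : P.map Y = gaussianReal 0 (s ^ 2)) : ∫ ω, Y ω ∂P = 0 := by
  have := integral_id_gaussianReal (μ := 0) (v := s ^ 2)
  rwa [← h, integral_map hY.aemeasurable (by fun_prop)] at this

theorem integral_sq_of_map_eq_gaussianReal (hY : Measurable Y)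
    (h : P.map Y = gaussianReal 0 (s ^ 2)) : ∫ ω, Y ω ^ 2 ∂P = (s : ℝ) ^ 2 := by
  have h1 := variance_fun_id_gaussianReal (μ := 0) (v := s ^ 2)
  rw [variance_of_integral_eq_zero (by fun_prop) integral_id_gaussianReal, ← h,
    integral_map hY.aemeasurable (by fun_prop)] at h1
  simpa using h1

theorem integral_pow_four_of_map_eq_gaussianReal (hY : Measurable Y)
    (h : P.map Y = gaussianReal 0 (s ^ 2)) :
    ∫ ω, Y ω ^ 4 ∂P = (s : ℝ) ^ 4 * ∫ x, x ^ 4 ∂(gaussianReal 0 1) := by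
  rw [← integral_pow_four_gaussianReal, ← h, integral_map hY.aemeasurable (by fun_prop)]

theorem integrable_pow_four_of_map_eq_gaussianReal (hY : Measurable Y)
    (h : P.map Y = gaussianReal 0 (s ^ 2)) : Integrable (fun ω => Y ω ^ 4) P := by
  have := (memLp_of_map_eq_gaussianReal hY h 4).integrable_norm_pow (by norm_num)
  refine this.congr (ae_of_all _ fun ω => ?_)
  simp only [Real.norm_eq_abs]
  exact Even.pow_abs (by decide) _

/-- Where |Z| > ℓ ≥ 1, also Z² ≥ ℓ, so ℓ Z² ≤ Z⁴. -/
theorem integral_sq_truncAbove_le_of_pow_four {Z : Ω → ℝ} (hZ2 : MemLp Z 2 P)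
    (hZ4 : Integrable (fun ω => Z ω ^ 4) P) {ℓ : ℝ} (hℓ : 1 ≤ ℓ) :
    ∫ ω, truncAbove ℓ (Z ω) ^ 2 ∂P ≤ (∫ ω, Z ω ^ 4 ∂P) * ℓ⁻¹ := by
  rw [← integral_mul_const]
  refine integral_mono (memLp_truncAbove hZ2 ℓ).integrable_sq (hZ4.mul_const _) fun ω => ?_
  have hℓ0 : 0 < ℓ := zero_lt_one.trans_le hℓ
  simp only
  rw [← div_eq_mul_inv, le_div_iff₀ hℓ0]
  unfold truncAbove
  split_ifs with h
  · have : 0 ≤ Z ω ^ 4 := by positivity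
    simpa using this
  · have h1 : ℓ ≤ Z ω ^ 2 := by
      rw [← sq_abs]
      nlinarith [not_le.1 h]
    nlinarith [sq_nonneg (Z ω)]

end Gaussian

theorem summable_inv_truncLevel : Summable fun m => (truncLevel m)⁻¹ := by
  have h : Summable fun m : ℕ => ((2 : ℝ) ^ m)⁻¹ := by
    simpa [inv_pow] using summable_geometric_two
  exact summable_comp_div h 16

/-! ### The conditional variance condition in terms of the enumeration -/

theorem sum_Icc_int_eq_sum_range {M : Type*} [AddCommMonoid M] (g : ℤ → M) (n : ℕ) :
    ∑ i ∈ Finset.Icc (1 : ℤ) n, g i = ∑ i ∈ Finset.range n, g ((i : ℤ) + 1) := by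
  induction n with
  | zero => simp
  | succ n ih =>
    have h : Finset.Icc (1 : ℤ) ((n + 1 : ℕ) : ℤ) =
        insert ((n : ℤ) + 1) (Finset.Icc (1 : ℤ) n) := by
      ext i
      simp only [Finset.mem_Icc, Finset.mem_insert]
      push_cast
      omega
    rw [h, Finset.sum_insert (by simp), ih, Finset.sum_range_succ, add_comm]

theorem sum_Icc_Icc_eq_sum_triPos {M : Type*} [AddCommMonoid M] (g : ℤ → ℤ → M) (n : ℕ) :
    ∑ i ∈ Finset.Icc (1 : ℤ) n, ∑ j ∈ Finset.Icc (1 : ℤ) i, g i j =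
      ∑ k ∈ Finset.range (triSize n), g (triPos k).1 (triPos k).2 := by
  rw [sum_range_triSize, sum_Icc_int_eq_sum_range]
  refine Finset.sum_congr rfl fun i _ => ?_
  have := sum_Icc_int_eq_sum_range (g ((i : ℤ) + 1)) (i + 1)
  push_cast at this
  rw [this]
  refine Finset.sum_congr rfl fun j hj => ?_
  have hj' := Nat.lt_succ_iff.1 (Finset.mem_range.1 hj)
  simp only [triPos, triRow_eq hj', triCol_eq hj']

/-- One good distance `a` for each `ε` is all that is used. The limsup lives in `EReal`, so no
boundedness has to be checked. -/
theorem eventually_lt_of_tendsto_limsup {q : ℕ → ℕ → ℝ}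
    (hq : Tendsto (fun a : ℕ => limsup (fun n : ℕ => (q a n : EReal)) atTop) atTop (𝓝 0))
    {ε : ℝ} (hε : 0 < ε) : ∃ a : ℕ, 1 ≤ a ∧ ∀ᶠ n : ℕ in atTop, q a n < ε := by
  have h1 : (0 : EReal) < (ε : EReal) := by exact_mod_cast hε
  obtain ⟨a, ha, ha1⟩ := ((hq.eventually_lt_const h1).and (eventually_ge_atTop 1)).exists
  refine ⟨a, ha1, ?_⟩
  filter_upwards [eventually_lt_of_limsup_lt ha] with n hn
  exact_mod_cast hn

end MartingaleMatrix

/-! ### The comparison theorem. -/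

theorem mainTheorem2 {Ω : Type*} [MeasurableSpace Ω] (P : Measure Ω) [IsProbabilityMeasure P]
    (X : ℤ × ℤ → Ω → ℝ) (Y : ℕ+ × ℕ+ → Ω → ℝ) (σ : ℤ × ℤ → ℝ≥0)
    (hX_meas : ∀ p, Measurable (X p)) (hY_meas : ∀ p, Measurable (Y p))
    -- the standing setting
    (hX_sq : ∀ p, MemLp (X p) 2 P)
    (hX_mean : ∀ p, ∫ ω, X p ω ∂P = 0)
    (hX_var : ∀ p, ∫ ω, (X p ω) ^ 2 ∂P = (σ p : ℝ) ^ 2)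
    (hY_gauss : ∀ p : ℕ+ × ℕ+, P.map (Y p) = gaussianReal 0 (σ ((p.1 : ℤ), (p.2 : ℤ)) ^ 2))
    (hY_indep : iIndepFun Y P)
    (hXY_indep : IndepFun (fun ω p => X p ω) (fun ω p => Y p ω) P)
    -- the martingale difference condition
    (h_mart : ∀ i j : ℤ, 1 ≤ j → j ≤ i →
      P[X (i, j) | MartingaleMatrix.pastSigma X 1 (i, j)] =ᵐ[P] 0)
    -- the moment condition
    (h : ℝ → ℝ) (h_mono : MonotoneOn h (Set.Ici 0)) (h_one : ∀ x, 0 ≤ x → 1 ≤ h x)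
    (h_anti : AntitoneOn (fun x => x⁻¹ * h x) (Set.Ioi 0))
    (h_sum : Summable fun n : ℕ => ((n : ℝ) * h n)⁻¹)
    (C : ℝ) (hC : 0 < C)
    (h_moment : ∀ i j : ℤ, 1 ≤ j → j ≤ i →
      Integrable (fun ω => (X (i, j) ω) ^ 2 * h |X (i, j) ω|) P ∧
        ∫ ω, (X (i, j) ω) ^ 2 * h |X (i, j) ω| ∂P ≤ C)
    -- the almost sure conditional variance condition
    (h_mix : ∀ᵐ ω ∂P, Tendsto
      (fun a : ℕ => limsup
        (fun n : ℕ => (((1 / (n : ℝ) ^ 2) *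
          ∑ i ∈ Finset.Icc (1 : ℤ) n, ∑ j ∈ Finset.Icc (1 : ℤ) i,
            |(P[fun ω' => (X (i, j) ω') ^ 2 - (σ (i, j) : ℝ) ^ 2 |
              MartingaleMatrix.pastSigma X a (i, j)]) ω| : ℝ) : EReal)) atTop)
      atTop (𝓝 0)) :
    ∀ z : ℂ, 0 < z.im → ∀ᵐ ω ∂P, Tendsto
      (fun n : ℕ =>
        MartingaleMatrix.spectralStieltjes (fun p => X ((p.1 : ℤ), (p.2 : ℤ)) ω) n z -
          MartingaleMatrix.spectralStieltjes (fun p => Y p ω) n z)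
      atTop (𝓝 0) := by
  open MartingaleMatrix in
  intro z hz
  have hpos1 : ∀ k, 1 ≤ (triPos k).2 := fun k => by simp [triPos]
  set s : ℕ → ℝ := fun k => (σ (triPos k) : ℝ) with hs_def
  have hcast : ∀ k, (((triPosPNat k).1 : ℤ), ((triPosPNat k).2 : ℤ)) = triPos k := by
    intro k
    simp [triPosPNat, triPos]
  have hgauss : ∀ k, P.map (Y (triPosPNat k)) = gaussianReal 0 (σ (triPos k) ^ 2) := by
    intro k
    rw [hY_gauss, hcast]
  have hmom : ∀ k, Integrable (fun ω => X (triPos k) ω ^ 2 * h |X (triPos k) ω|) P ∧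
      ∫ ω, X (triPos k) ω ^ 2 * h |X (triPos k) ω| ∂P ≤ C := fun k =>
    h_moment _ _ (hpos1 k) (triPos_snd_le_fst k)
  -- Since h ≥ 1, the moment constant also bounds the variances, and through them the Gaussian
  -- fourth moments.
  have hs : ∀ k, s k ^ 2 ≤ C := by
    intro k
    rw [hs_def]
    simp only
    rw [← hX_var]
    refine le_trans (integral_mono (hX_sq _).integrable_sq (hmom k).1 fun ω => ?_) (hmom k).2
    exact le_mul_of_one_le_right (sq_nonneg _) (h_one _ (abs_nonneg _))
  set κ : ℝ := ∫ x, x ^ 4 ∂(gaussianReal 0 1) with hκ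
  have hκ0 : 0 ≤ κ := integral_nonneg fun x => by positivity
  have hY2 : ∀ k, MemLp (Y (triPosPNat k)) 2 P := fun k => by
    exact_mod_cast memLp_of_map_eq_gaussianReal (hY_meas _) (hgauss k) 2
  have hY4i : ∀ k, Integrable (fun ω => Y (triPosPNat k) ω ^ 4) P := fun k =>
    integrable_pow_four_of_map_eq_gaussianReal (hY_meas _) (hgauss k)
  have hs4 : ∀ k, s k ^ 4 ≤ C ^ 2 := fun k => by
    have := pow_le_pow_left₀ (sq_nonneg (s k)) (hs k) 2
    rwa [← pow_mul] at this
  have hY4 : ∀ k, ∫ ω, Y (triPosPNat k) ω ^ 4 ∂P ≤ C ^ 2 * κ := fun k => by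
    rw [integral_pow_four_of_map_eq_gaussianReal (hY_meas _) (hgauss k)]
    exact mul_le_mul_of_nonneg_right (hs4 k) hκ0
  have hℓ0 : ∀ m, 0 < truncLevel m := fun m => zero_lt_one.trans_le (one_le_truncLevel m)
  have hh0 : ∀ m, 0 < h (truncLevel m) := fun m => zero_lt_one.trans_le (h_one _ (hℓ0 m).le)
  -- A single tail majorant for both arrays: the first summand dominates the tails of `X`, the
  -- second those of `Y`.
  set τ : ℕ → ℝ := fun m => C * (h (truncLevel m))⁻¹ + C ^ 2 * κ * (truncLevel m)⁻¹ with hτ_def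
  have hτ : Summable τ :=
    ((summable_inv_comp_truncLevel h_mono h_one h_sum).mul_left C).add
      (summable_inv_truncLevel.mul_left _)
  have hτ0 : ∀ m, 0 ≤ τ m := fun m => by
    have := hℓ0 m
    have := hh0 m
    positivity
  have hτanti : Antitone τ := by
    intro m m' hmm
    have h1 := hℓ0 m
    have h2 := hh0 m
    have h3 := truncLevel_mono hmm
    have h4 := h_mono (hℓ0 m).le (hℓ0 m').le h3
    simp only [hτ_def]
    gcongr
  have hXτ : ∀ k m, ∫ ω, truncAbove (truncLevel m) (X (triPos k) ω) ^ 2 ∂P ≤ τ m := by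
    intro k m
    refine (integral_sq_truncAbove_le (hX_sq _) h_mono h_one (hmom k).1 (hmom k).2
      (hℓ0 m).le).trans ?_
    have := hℓ0 m
    exact le_add_of_nonneg_right (by positivity)
  have hYτ : ∀ k m, ∫ ω, truncAbove (truncLevel m) (Y (triPosPNat k) ω) ^ 2 ∂P ≤ τ m := by
    intro k m
    refine (integral_sq_truncAbove_le_of_pow_four (hY2 k) (hY4i k) (one_le_truncLevel m)).trans ?_
    have h1 := hh0 m
    have h2 := mul_le_mul_of_nonneg_right (hY4 k) (inv_nonneg.2 (hℓ0 m).le)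
    exact h2.trans (le_add_of_nonneg_left (by positivity))
  have hYsq4 : ∀ k, MemLp (fun ω => Y (triPosPNat k) ω ^ 2 - s k ^ 2) 2 P := by
    intro k
    refine MemLp.sub ?_ (memLp_const _)
    rw [memLp_two_iff_integrable_sq ((hY_meas _).pow_const 2).aestronglyMeasurable]
    refine (hY4i k).congr (ae_of_all _ fun ω => ?_)
    ring
  have hYs : ∀ k, ∫ ω, (Y (triPosPNat k) ω ^ 2 - s k ^ 2) ∂P = 0 := by
    intro k
    rw [integral_sub (hY2 k).integrable_sq (integrable_const _),
      integral_sq_of_map_eq_gaussianReal (hY_meas _) (hgauss k)]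
    simp [hs_def]
  have hYD : ∀ k, ∫ ω, (Y (triPosPNat k) ω ^ 2 - s k ^ 2) ^ 2 ∂P ≤ C ^ 2 * κ + C ^ 2 := by
    intro k
    have h1 : ∫ ω, (Y (triPosPNat k) ω ^ 2 - s k ^ 2) ^ 2 ∂P ≤
        ∫ ω, (Y (triPosPNat k) ω ^ 4 + s k ^ 4) ∂P := by
      refine integral_mono (hYsq4 k).integrable_sq ((hY4i k).add (integrable_const _)) fun ω => ?_
      simp only
      nlinarith [mul_nonneg (sq_nonneg (Y (triPosPNat k) ω)) (sq_nonneg (s k))]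
    rw [integral_add (hY4i k) (integrable_const _)] at h1
    simp only [integral_const, probReal_univ, smul_eq_mul, one_mul] at h1
    linarith [hY4 k, hs4 k]
  have hmix : ∀ᵐ ω ∂P, ∀ ε : ℝ, 0 < ε → ∃ a : ℕ, 1 ≤ a ∧ ∀ᶠ n : ℕ in atTop,
      (∑ k ∈ Finset.range (triSize n), |(P[fun ω' => X (triPos k) ω' ^ 2 - s k ^ 2 |
        pastSigma X a (triPos k)]) ω|) / (n : ℝ) ^ 2 < ε := by
    filter_upwards [h_mix] with ω hω ε hε
    obtain ⟨a, ha, hlt⟩ := eventually_lt_of_tendsto_limsup hω hε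
    refine ⟨a, ha, ?_⟩
    filter_upwards [hlt] with n hn
    rw [sum_Icc_Icc_eq_sum_triPos (fun i j => |(P[fun ω' => (X (i, j) ω') ^ 2 -
      (σ (i, j) : ℝ) ^ 2 | pastSigma X a (i, j)]) ω|), one_div, inv_mul_eq_div] at hn
    exact hn
  have hind : Indep (fullSigma X) (fullSigma Y) P := (IndepFun_iff_Indep _ _ _).1 hXY_indep
  -- The expansion is for real functions, so it is applied to the real and imaginary parts
  -- separately.
  have hreal : ∀ φ : ℂ →L[ℝ] ℝ, (∀ w, |φ w| ≤ ‖w‖) → ∀ᵐ ω ∂P, Tendsto (fun n : ℕ =>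
      φ (triStieltjes z n (fun k => X (triPos k) ω)) -
        φ (triStieltjes z n (fun k => Y (triPosPNat k) ω))) atTop (𝓝 0) := by
    intro φ hφ
    have hF := smoothAtScale_triStieltjes hz φ hφ
    have hX0 : ∀ k, P[X (triPos k) | pastSigma X 1 (triPos k)] =ᵐ[P] 0 := fun k =>
      h_mart _ _ (hpos1 k) (triPos_snd_le_fst k)
    have hY0 : ∀ k, ∫ ω, Y (triPosPNat k) ω ∂P = 0 := fun k =>
      integral_of_map_eq_gaussianReal (hY_meas _) (hgauss k)
    have hτ' := summable_comp_log_div hτ hτ0 hτanti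
    have hconv := ae_tendsto_of_smoothAtScale hF hX_meas hY_meas hind hX_sq hX0 hXτ hτ hτ' hs hmix
      hY_indep hY2 hY0 hYτ hYsq4 hYs hYD
    exact hconv
  filter_upwards [hreal Complex.reCLM Complex.abs_re_le_norm,
    hreal Complex.imCLM Complex.abs_im_le_norm] with ω hre him
  have h1 := hre.abs.add him.abs
  simp only [abs_zero, add_zero] at h1
  refine squeeze_zero_norm (fun n => ?_) h1
  have e1 : (fun k => X ((((Nat.succPNat (triRow k), Nat.succPNat (triCol k)) : ℕ+ × ℕ+).1 : ℤ),
      (((Nat.succPNat (triRow k), Nat.succPNat (triCol k)) : ℕ+ × ℕ+).2 : ℤ)) ω) =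
      fun k => X (triPos k) ω := by
    funext k
    exact congrArg (fun p => X p ω) (hcast k)
  rw [spectralStieltjes_eq_triStieltjes _ _ _ hz, spectralStieltjes_eq_triStieltjes _ _ _ hz, e1,
    ← map_sub, ← map_sub]
  exact Complex.norm_le_abs_re_add_abs_im _
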